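/- Theorem B. Let $\mathbb{R}^m_s$ denote $\mathbb{R}^m$ with the scalar product $\langle x,x\rangle=\sum_{i\le m-s}x_i^2-\sum_{i>m-s}x_i^2$, and let $Q^3_1=\{[x]\in\mathbb{R}P^4 : x\in\mathbb{R}^5_2\setminus\{0\},\ \langle x,x\rangle=0\}$ be the projectivized light cone, on which $O(3,2)$ acts by conformal transformations. Put $S^3_1=\{x\in\mathbb{R}^4_1:\langle x,x\rangle=1\}$ and $H^3_1=\{x\in\mathbb{R}^4_2:\langle x,x\rangle=-1\}$, and embed the three Lorentzian space forms conformally in $Q^3_1$ by $$\varphi_0(x)=\Big[\Big(\tfrac{-1+\langle x,x\rangle}{2},x,\tfrac{1+\langle x,x\rangle}{2}\Big)\Big]\ (x\in\mathbb{R}^3_1),\quad \varphi_+(x)=[(x,1)]\ (x\in S^3_1),\quad \varphi_-(x)=[(1,x)]\ (x\in H^3_1).$$ Let $M$ be a connected smooth surface and $y:M\to Q^3_1$ a smooth timelike immersion. For asymptotic coordinates $(u,v)$ on an open set of $M$ and a canonical local lift $Y$ of $y$ to the light cone, i.e. $\langle Y_u,Y_u\rangle=\langle Y_v,Y_v\rangle=0$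 and $\langle Y_u,Y_v\rangle=\frac12$, put $V=\mathrm{Span}\{Y,Y_u,Y_v,Y_{uv}\}$, and let the conformal Hopf differentials $\kappa_1,\kappa_2$ be the $V^\perp$-components of $Y_{uu}$ and $Y_{vv}$. The surface $y$ is called isothermic if it has no umbilic points (points where $\kappa_1=\kappa_2=0$) and, for a fixed choice of the sign, there are around each point of $M$ such $(u,v)$ and $Y$ with $\kappa_1=\pm\kappa_2$. It is called Willmore if it is a critical point of $W(y)=2\int_M\langle\kappa_1,\kappa_2\rangle\,du\,dv$ with respect to all compactly supported smooth timelike variations of $y$ (the integral being taken over the compact set that contains the support of the variation). If $y$ is both isothermic and Willmore, then it is conformally equivalent to a timelike minimal surface in one of the three Lorentzian space forms: there are $T\in O(3,2)$ and a smooth timelike immersion $x$ of $M$ with vanishing mean curvature into $\mathbb{R}^3_1$, $S^3_1$ or $H^3_1$ such that $T\circ y=\varphi\circ x$, where $\varphi$ is $\varphi_0$, $\varphi_+$ or $\varphi_-$ respectively. -/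

import Mathlib

open scoped Manifold ContDiff LinearAlgebra.Projectivization Topology
open MeasureTheory

noncomputable section

namespace TimelikeSurface

/-! ### Pseudo-Euclidean spaces and the conformal space -/

/-- The scalar product of `ℝ^m_s`: the first `m - s` coordinates are positive, the last `s`
coordinates are negative. -/
def pinner (m s : ℕ) (x y : Fin m → ℝ) : ℝ :=
  ∑ i : Fin m, if (i : ℕ) + s < m then x i * y i else -(x i * y i)

theorem pinner_smul_smul (m s : ℕ) (a : ℝ) (x : Fin m → ℝ) :
    pinner m s (a • x) (a • x) = a ^ 2 * pinner m s x x := by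
  unfold pinner
  rw [Finset.mul_sum]
  refine Finset.sum_congr rfl fun i _ => ?_
  simp only [Pi.smul_apply, smul_eq_mul]
  split_ifs <;> ring

/-- The conformal space `Q^3_1`: the projectivized light cone of `ℝ^5_2`. -/
def Q31 : Type :=
  {q : ℙ ℝ (Fin 5 → ℝ) // ∀ v ∈ q.submodule, pinner 5 2 v v = 0}

/-- The point `[v]` of `Q^3_1` for a nonzero lightlike vector `v`. -/
def Q31.mk (v : Fin 5 → ℝ) (hv : v ≠ 0) (h : pinner 5 2 v v = 0) : Q31 :=
  ⟨Projectivization.mk ℝ v hv, by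
    intro w hw
    rw [Projectivization.submodule_mk, Submodule.mem_span_singleton] at hw
    obtain ⟨a, rfl⟩ := hw
    rw [pinner_smul_smul, h, mul_zero]⟩

/-- The orthogonal group `O(3,2)` of `ℝ^5_2`. -/
structure O32 where
  toEquiv : (Fin 5 → ℝ) ≃ₗ[ℝ] (Fin 5 → ℝ)
  pinner_map : ∀ v w, pinner 5 2 (toEquiv v) (toEquiv w) = pinner 5 2 v w

/-- The conformal transformation `[v] ↦ [T v]` of `Q^3_1` induced by `T ∈ O(3,2)`. -/
def O32.act (T : O32) (q : Q31) : Q31 :=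
  ⟨Projectivization.map T.toEquiv.toLinearMap T.toEquiv.injective q.1, by
    obtain ⟨q, hq⟩ := q
    induction q using Projectivization.ind with
    | h v hv =>
      intro w hw
      rw [Projectivization.map_mk, Projectivization.submodule_mk,
        Submodule.mem_span_singleton] at hw
      obtain ⟨a, rfl⟩ := hw
      rw [pinner_smul_smul]
      have h0 : pinner 5 2 v v = 0 := hq v (by
        rw [Projectivization.submodule_mk]; exact Submodule.mem_span_singleton_self v)
      have h1 := T.pinner_map v v
      simp only [LinearEquiv.coe_coe]
      rw [h1, h0, mul_zero]⟩

/-! ### The three Lorentzian space forms and their conformal embeddings -/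

/-- Minkowski space `ℝ^3_1`, as a set with the scalar product `pinner 3 1`. -/
abbrev R31 : Type := Fin 3 → ℝ

/-- De Sitter space `S^3_1 = {x ∈ ℝ^4_1 : ⟨x, x⟩ = 1}`. -/
def S31 : Set (Fin 4 → ℝ) := {x | pinner 4 1 x x = 1}

/-- Anti-de Sitter space `H^3_1 = {x ∈ ℝ^4_2 : ⟨x, x⟩ = -1}`. -/
def H31 : Set (Fin 4 → ℝ) := {x | pinner 4 2 x x = -1}

/-- `x ↦ [((-1 + ⟨x, x⟩) / 2, x, (1 + ⟨x, x⟩) / 2)]`. -/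
def phiR (x : R31) : Q31 :=
  Q31.mk ![(-1 + pinner 3 1 x x) / 2, x 0, x 1, x 2, (1 + pinner 3 1 x x) / 2]
    (by
      intro h
      have h0 := congrFun h 0
      have h4 := congrFun h 4
      simp at h0 h4
      linarith)
    (by simp [pinner, Fin.sum_univ_succ]; ring)

/-- `x ↦ [(x, 1)]`. -/
def phiS (x : S31) : Q31 :=
  Q31.mk ![x.1 0, x.1 1, x.1 2, x.1 3, 1]
    (by
      intro h
      have h4 := congrFun h 4
      simp at h4)
    (by
      have hx : pinner 4 1 x.1 x.1 = 1 := x.2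
      simp [pinner, Fin.sum_univ_succ] at hx ⊢
      linarith)

/-- `x ↦ [(1, x)]`. -/
def phiH (x : H31) : Q31 :=
  Q31.mk ![1, x.1 0, x.1 1, x.1 2, x.1 3]
    (by
      intro h
      have h0 := congrFun h 0
      simp at h0)
    (by
      have hx : pinner 4 2 x.1 x.1 = -1 := x.2
      simp [pinner, Fin.sum_univ_succ] at hx ⊢
      linarith)

/-! ### Coordinates on surfaces -/

/-- The coordinate plane. -/
abbrev E2 : Type := EuclideanSpace ℝ (Fin 2)

/-- The coordinate vector `∂/∂u`. -/
def ex : E2 := EuclideanSpace.single 0 1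

/-- The coordinate vector `∂/∂v`. -/
def ey : E2 := EuclideanSpace.single 1 1

/-- The derivative of `Y` in the constant direction `ξ`. -/
def pd {m : ℕ} (ξ : E2) (Y : E2 → Fin m → ℝ) (x : E2) : Fin m → ℝ := fderiv ℝ Y x ξ

/-- The determinant `⟨Y_u, Y_u⟩⟨Y_v, Y_v⟩ - ⟨Y_u, Y_v⟩²` of the metric induced by `Y`. It is
negative exactly if the metric has signature `(1,1)` (and then `Y` is an immersion). -/
def metricDet {m : ℕ} (s : ℕ) (Y : E2 → Fin m → ℝ) (x : E2) : ℝ :=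
  pinner m s (pd ex Y x) (pd ex Y x) * pinner m s (pd ey Y x) (pd ey Y x)
    - pinner m s (pd ex Y x) (pd ey Y x) ^ 2

variable {M : Type*} [TopologicalSpace M]

/-- `Y` is a smooth lift to the light cone, over the set `O` of coordinates, of the map `y`
written in the chart `e`. -/
def IsLift (y : M → Q31) (e : OpenPartialHomeomorph M E2) (O : Set E2)
    (Y : E2 → Fin 5 → ℝ) : Prop :=
  ContDiffOn ℝ ∞ Y O ∧
    ∀ x ∈ O, ∃ h : Y x ≠ 0, (y (e.symm x)).1 = Projectivization.mk ℝ (Y x) h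

/-- The bundle `V = Span {Y, Y_ξ, Y_η, Y_ξη}` at `x`. -/
def gaussSpace (Y : E2 → Fin 5 → ℝ) (x ξ η : E2) : Submodule ℝ (Fin 5 → ℝ) :=
  Submodule.span ℝ {Y x, pd ξ Y x, pd η Y x, pd η (pd ξ Y) x}

/-- `(ξ, η)` is an asymptotic frame at `x` with `⟨Y_ξ, Y_η⟩ = 1/2`, and `κ₁`, `κ₂` are the
conformal Hopf differentials in this frame: the components of `Y_ξξ` and `Y_ηη` in the orthogonal
complement of `V`. For a lift `Y`, these are tensorial in the frame: they depend only on the values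
of `ξ` and `η` at the point, and not on the coordinates in which they are constant. -/
def IsHopfPair (Y : E2 → Fin 5 → ℝ) (x ξ η : E2) (κ₁ κ₂ : Fin 5 → ℝ) : Prop :=
  pinner 5 2 (pd ξ Y x) (pd ξ Y x) = 0 ∧
  pinner 5 2 (pd η Y x) (pd η Y x) = 0 ∧
  pinner 5 2 (pd ξ Y x) (pd η Y x) = 1 / 2 ∧
  (∀ v ∈ gaussSpace Y x ξ η, pinner 5 2 κ₁ v = 0) ∧
  (∀ v ∈ gaussSpace Y x ξ η, pinner 5 2 κ₂ v = 0) ∧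
  pd ξ (pd ξ Y) x - κ₁ ∈ gaussSpace Y x ξ η ∧
  pd η (pd η Y) x - κ₂ ∈ gaussSpace Y x ξ η

variable [ChartedSpace E2 M]

/-- `y : M → Q^3_1` is a smooth immersed timelike surface. -/
def IsTimelike (y : M → Q31) : Prop :=
  ∀ p : M, ∃ e ∈ IsManifold.maximalAtlas (𝓡 2) ∞ M, p ∈ e.source ∧
    ∃ Y : E2 → Fin 5 → ℝ, IsLift y e e.target Y ∧ ∀ x ∈ e.target, metricDet 2 Y x < 0

/-! ### The Willmore functional -/

/-- `w` is the value, in the coordinates `e` at the point `x`, of the density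
`2 ⟨κ₁, κ₂⟩ du dv`, where `(u, v)` are asymptotic coordinates with coordinate vectors
`ξ` and `η` at that point, so that `du dv` is `1 / |det (ξ, η)|` times Lebesgue measure. -/
def IsWillmoreDensityAt (y : M → Q31) (e : OpenPartialHomeomorph M E2) (x : E2) (w : ℝ) : Prop :=
  ∃ O : Set E2, IsOpen O ∧ x ∈ O ∧ O ⊆ e.target ∧ ∃ Y : E2 → Fin 5 → ℝ, IsLift y e O Y ∧
    ∃ (ξ η : E2) (κ₁ κ₂ : Fin 5 → ℝ), IsHopfPair Y x ξ η κ₁ κ₂ ∧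
      w = 2 * pinner 5 2 κ₁ κ₂ / |ξ 0 * η 1 - ξ 1 * η 0|

/-- `W = 2 ∫_K ⟨κ₁, κ₂⟩ du dv`: the integral of the Willmore density over `K ⊆ M`, computed by
cutting `K` into finitely many disjoint measurable pieces that lie in charts. -/
def HasWillmoreEnergy (y : M → Q31) (K : Set M) (W : ℝ) : Prop :=
  ∃ (N : ℕ) (e : Fin N → OpenPartialHomeomorph M E2) (A : Fin N → Set M) (w : Fin N → E2 → ℝ),
    (∀ i, e i ∈ IsManifold.maximalAtlas (𝓡 2) ∞ M ∧ A i ⊆ (e i).source ∧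
      MeasurableSet (e i '' A i) ∧
      (∀ x ∈ e i '' A i, IsWillmoreDensityAt y (e i) x (w i x)) ∧
      IntegrableOn (w i) (e i '' A i) volume) ∧
    (∀ i j, i ≠ j → Disjoint (A i) (A j)) ∧
    (⋃ i, A i) = K ∧
    W = ∑ i, ∫ x in e i '' A i, w i x

/-- `z` is a smooth timelike variation of `y`, for times `t ∈ (-ε, ε)`, which moves `y` only inside
the set `K`. -/
def IsTimelikeVariation (y : M → Q31) (K : Set M) (ε : ℝ) (z : ℝ → M → Q31) : Prop :=
  z 0 = y ∧
  (∀ t ∈ Set.Ioo (-ε) ε, IsTimelike (z t)) ∧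
  (∀ t ∈ Set.Ioo (-ε) ε, ∀ p ∉ K, z t p = y p) ∧
  (∀ t₀ ∈ Set.Ioo (-ε) ε, ∀ p : M, ∃ e ∈ IsManifold.maximalAtlas (𝓡 2) ∞ M, p ∈ e.source ∧
    ∃ (I : Set ℝ) (Y : ℝ × E2 → Fin 5 → ℝ), IsOpen I ∧ t₀ ∈ I ∧
      ContDiffOn ℝ ∞ Y (I ×ˢ e.target) ∧
      ∀ t ∈ I, ∀ x ∈ e.target, ∃ h : Y (t, x) ≠ 0,
        (z t (e.symm x)).1 = Projectivization.mk ℝ (Y (t, x)) h)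

/-- `y` is a timelike Willmore surface: a critical point of the Willmore functional for all
compactly supported timelike variations. -/
def IsWillmore (y : M → Q31) : Prop :=
  IsTimelike y ∧
    ∀ (K : Set M) (ε : ℝ) (z : ℝ → M → Q31), IsCompact K → 0 < ε →
      IsTimelikeVariation y K ε z →
      ∀ W : ℝ → ℝ, (∀ᶠ t in 𝓝 (0 : ℝ), HasWillmoreEnergy (z t) K (W t)) → HasDerivAt W 0 0

/-! ### Isothermic surfaces -/

/-- `p` is an umbilic point of `y`: both conformal Hopf differentials vanish there. -/
def IsUmbilic (y : M → Q31) (p : M) : Prop :=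
  ∃ e ∈ IsManifold.maximalAtlas (𝓡 2) ∞ M, p ∈ e.source ∧
    ∃ Y : E2 → Fin 5 → ℝ, IsLift y e e.target Y ∧ ∃ ξ η : E2, IsHopfPair Y (e p) ξ η 0 0

/-- `y` is a timelike surface without umbilic points and around each point there are asymptotic
coordinates and a canonical lift with `κ₁ = σ κ₂`. -/
def IsSignedIsothermic (σ : ℝ) (y : M → Q31) : Prop :=
  IsTimelike y ∧ (∀ p, ¬ IsUmbilic y p) ∧
    ∀ p : M, ∃ e ∈ IsManifold.maximalAtlas (𝓡 2) ∞ M, p ∈ e.source ∧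
      ∃ Y : E2 → Fin 5 → ℝ, IsLift y e e.target Y ∧
        ∀ x ∈ e.target, ∃ κ₁ κ₂ : Fin 5 → ℝ, IsHopfPair Y x ex ey κ₁ κ₂ ∧ κ₁ = σ • κ₂

/-- `y` is a timelike isothermic surface, i.e. `(+)`-isothermic or `(-)`-isothermic. -/
def IsIsothermic (y : M → Q31) : Prop :=
  IsSignedIsothermic 1 y ∨ IsSignedIsothermic (-1) y

/-! ### Minimal surfaces in the space forms -/

/-- The mean curvature, i.e. half the trace of the second fundamental form with respect to the
induced metric, of the surface `X` in the direction of the normal vector `ν`. -/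
def meanCurvature {m : ℕ} (s : ℕ) (X : E2 → Fin m → ℝ) (x : E2) (ν : Fin m → ℝ) : ℝ :=
  (pinner m s (pd ey X x) (pd ey X x) * pinner m s (pd ex (pd ex X) x) ν
    - 2 * pinner m s (pd ex X x) (pd ey X x) * pinner m s (pd ey (pd ex X) x) ν
    + pinner m s (pd ex X x) (pd ex X x) * pinner m s (pd ey (pd ey X) x) ν)
    / (2 * metricDet s X x)

/-- `X : M → ℝ^m_s` is a smooth timelike immersion whose mean curvature vanishes for all unit
vectors `ν` that are normal to the surface and tangent to the ambient space form, where `T a` is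
the tangent space of this space form at its point `a`. -/
def IsTimelikeMinimal {m : ℕ} (s : ℕ) (T : (Fin m → ℝ) → Set (Fin m → ℝ))
    (X : M → Fin m → ℝ) : Prop :=
  ContMDiff (𝓡 2) 𝓘(ℝ, Fin m → ℝ) ∞ X ∧
    ∀ e ∈ IsManifold.maximalAtlas (𝓡 2) ∞ M, ∀ x ∈ e.target,
      metricDet s (X ∘ e.symm) x < 0 ∧
      ∀ ν ∈ T (X (e.symm x)), pinner m s ν ν = 1 →
        pinner m s ν (pd ex (X ∘ e.symm) x) = 0 → pinner m s ν (pd ey (X ∘ e.symm) x) = 0 →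
        meanCurvature s (X ∘ e.symm) x ν = 0

/-- `x` is a timelike minimal surface in `ℝ^3_1`. -/
def IsMinimalR (x : M → R31) : Prop :=
  IsTimelikeMinimal 1 (fun _ => Set.univ) x

/-- `x` is a timelike minimal surface in `S^3_1 ⊆ ℝ^4_1`. -/
def IsMinimalS (x : M → S31) : Prop :=
  IsTimelikeMinimal 1 (fun a => {ν | pinner 4 1 a ν = 0}) (fun p => (x p : Fin 4 → ℝ))

/-- `x` is a timelike minimal surface in `H^3_1 ⊆ ℝ^4_2`. -/
def IsMinimalH (x : M → H31) : Prop :=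
  IsTimelikeMinimal 2 (fun a => {ν | pinner 4 2 a ν = 0}) (fun p => (x p : Fin 4 → ℝ))

end TimelikeSurface

end

open scoped Manifold ContDiff LinearAlgebra.Projectivization Topology
open MeasureTheory

noncomputable section

namespace TimelikeSurface

-- Write subscripts for derivatives along the null coordinate vectors `a`, `b`. A canonical lift
-- `Y`, a null vector `N` and a unit normal `E` form a moving frame of `ℝ^5_2`. With `h_a = ⟪Y_aa,
-- E⟫` and `s_a = ⟪Y_aa, N⟫` its structure equations are `Y_aa = -s_a Y + h_a E`, `Y_ab = -h_a h_b Y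
-- + N / 2`, `E_a = 2 (h_a)_b Y - 2 h_a Y_b`, `N_a = -2 h_a h_b Y_a - 2 s_a Y_b + 2 (h_a)_b E`, and
-- their compatibility gives the Codazzi equation `(h_a)_bb + s_b h_a = (h_b)_aa + s_a h_b`.
--
-- The first variation along a bump function times `E` shows that the sum of the two Codazzi sides
-- vanishes, so each of them does (`NullFrame.dt_density`, `willmore_eq`). In isothermic coordinates
-- `h_a = σ k` and `h_b = k` with `σ = ±1`, and `k` has no zeros because there are no umbilics.
-- Hence `k_aa = -s_a k` and `k_bb = -s_b k`, which is what makes the vector `parallelVec` constant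
-- (`NullFrame.dd_parallelVec`). This constant vector `c` satisfies `⟪c, E⟫ = 0` and `⟪c, Y⟫ = k ≠
-- 0`: the conformal Gauss map lies in a fixed hyperplane.
--
-- Orthogonality to `E` determines `c` up to scale (`NullFrame.eq_smul_parallelVec`), and the line
-- of `E` does not depend on the lift or the coordinates (`IsGaussNormal.transfer`). So the line of
-- `c` is locally constant, hence constant on the connected surface (`exists_adapted`).
--
-- Normalizing the lift by `⟪c, ·⟫ = 1` puts the surface into a hyperplane section of the light
-- cone. By the sign of `⟪c, c⟫`, an orthogonal transformation turns this section into a copy of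
-- `S^3_1`, `ℝ^3_1` or `H^3_1`. There `E` is tangent to the space form and normal to the surface,
-- and its second fundamental form is trace-free, so the mean curvature is zero
-- (`IsAdapted.minimal`).

local notation "⟪" x ", " y "⟫" => pinner 5 2 x y

/-! ### Algebra of the scalar product -/

section Pinner

variable {m s : ℕ}

theorem pinner_comm (x y : Fin m → ℝ) : pinner m s x y = pinner m s y x := by
  unfold pinner
  exact Finset.sum_congr rfl fun i _ => by split_ifs <;> ring

theorem pinner_add_left (x y z : Fin m → ℝ) :
    pinner m s (x + y) z = pinner m s x z + pinner m s y z := by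
  unfold pinner
  rw [← Finset.sum_add_distrib]
  exact Finset.sum_congr rfl fun i _ => by simp only [Pi.add_apply]; split_ifs <;> ring

theorem pinner_smul_left (a : ℝ) (x z : Fin m → ℝ) :
    pinner m s (a • x) z = a * pinner m s x z := by
  unfold pinner
  rw [Finset.mul_sum]
  exact Finset.sum_congr rfl fun i _ => by
    simp only [Pi.smul_apply, smul_eq_mul]; split_ifs <;> ring

theorem pinner_add_right (z x y : Fin m → ℝ) :
    pinner m s z (x + y) = pinner m s z x + pinner m s z y := by
  rw [pinner_comm, pinner_add_left, pinner_comm x, pinner_comm y]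

theorem pinner_smul_right (a : ℝ) (z x : Fin m → ℝ) :
    pinner m s z (a • x) = a * pinner m s z x := by
  rw [pinner_comm, pinner_smul_left, pinner_comm x]

theorem pinner_neg_left (x z : Fin m → ℝ) : pinner m s (-x) z = -pinner m s x z := by
  rw [← neg_one_smul ℝ x, pinner_smul_left]; ring

theorem pinner_neg_right (z x : Fin m → ℝ) : pinner m s z (-x) = -pinner m s z x := by
  rw [pinner_comm, pinner_neg_left, pinner_comm x]

theorem pinner_sub_left (x y z : Fin m → ℝ) :
    pinner m s (x - y) z = pinner m s x z - pinner m s y z := by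
  rw [sub_eq_add_neg, pinner_add_left, pinner_neg_left, sub_eq_add_neg]

theorem pinner_sub_right (z x y : Fin m → ℝ) :
    pinner m s z (x - y) = pinner m s z x - pinner m s z y := by
  rw [sub_eq_add_neg, pinner_add_right, pinner_neg_right, sub_eq_add_neg]

theorem pinner_zero_left (z : Fin m → ℝ) : pinner m s 0 z = 0 := by
  simp [pinner]

theorem eq_zero_of_pinner_eq_zero (x : Fin m → ℝ) (h : ∀ w, pinner m s x w = 0) : x = 0 := by
  funext i
  have := h (Pi.single i 1)
  unfold pinner at this
  rw [Finset.sum_eq_single i] at this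
  · simp only [Pi.single_eq_same, mul_one] at this
    split_ifs at this
    · simpa using this
    · simpa using this
  · intro j _ hj
    simp [hj]
  · simp

/-- The scalar product as a bilinear map. -/
def pinnerL (m s : ℕ) : (Fin m → ℝ) →ₗ[ℝ] (Fin m → ℝ) →ₗ[ℝ] ℝ :=
  LinearMap.mk₂ ℝ (pinner m s) pinner_add_left pinner_smul_left pinner_add_right pinner_smul_right

@[simp] theorem pinnerL_apply (x y : Fin m → ℝ) : pinnerL m s x y = pinner m s x y := rfl

end Pinner

/-! ### Frames of `ℝ^5_2` -/

/-- The vectors `a, b, c, d, e` of `ℝ^5_2` have a Gram matrix that consists of the blocks of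
`(a, b)` with `⟨a, a⟩ = 0`, of `(c, d)` and of the unit vector `e`, up to `⟨b, c⟩` and `⟨b, d⟩`. -/
structure IsBlockFrame (a b c d e : Fin 5 → ℝ) : Prop where
  aa : pinner 5 2 a a = 0
  ab : pinner 5 2 a b ≠ 0
  ac : pinner 5 2 a c = 0
  ad : pinner 5 2 a d = 0
  cd : pinner 5 2 c c * pinner 5 2 d d - pinner 5 2 c d ^ 2 ≠ 0
  ee : pinner 5 2 e e = 1
  ea : pinner 5 2 e a = 0
  eb : pinner 5 2 e b = 0
  ec : pinner 5 2 e c = 0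
  ed : pinner 5 2 e d = 0

/-- Vectors `a, b, c, d` as in `IsBlockFrame` are linearly independent. -/
theorem linearIndependent_of_gram {a b c d : Fin 5 → ℝ} (aa : pinner 5 2 a a = 0)
    (ab : pinner 5 2 a b ≠ 0) (ac : pinner 5 2 a c = 0) (ad : pinner 5 2 a d = 0)
    (cd : pinner 5 2 c c * pinner 5 2 d d - pinner 5 2 c d ^ 2 ≠ 0) :
    LinearIndependent ℝ ![a, b, c, d] := by
  rw [Fintype.linearIndependent_iff]
  intro g hg
  simp only [Fin.sum_univ_four, Matrix.cons_val] at hg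
  have key : ∀ z, g 0 * pinner 5 2 a z + g 1 * pinner 5 2 b z + g 2 * pinner 5 2 c z
      + g 3 * pinner 5 2 d z = 0 := fun z => by
    have := congrArg (fun w => pinner 5 2 w z) hg
    simpa only [pinner_add_left, pinner_smul_left, pinner_zero_left] using this
  have h1 : g 1 = 0 := by
    have := key a
    rw [aa, pinner_comm c, pinner_comm d, ac, ad, pinner_comm b] at this
    have h : g 1 * pinner 5 2 a b = 0 := by linarith
    exact (mul_eq_zero.1 h).resolve_right ab
  have kc := key c
  have kd := key d
  rw [ac, h1, pinner_comm d c] at kc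
  rw [ad, h1] at kd
  have h2 : g 2 = 0 := by
    have h : g 2 * (pinner 5 2 c c * pinner 5 2 d d - pinner 5 2 c d ^ 2) = 0 := by
      linear_combination pinner 5 2 d d * kc - pinner 5 2 c d * kd
    exact (mul_eq_zero.1 h).resolve_right cd
  have h3 : g 3 = 0 := by
    have h : g 3 * (pinner 5 2 c c * pinner 5 2 d d - pinner 5 2 c d ^ 2) = 0 := by
      linear_combination pinner 5 2 c c * kd - pinner 5 2 c d * kc
    exact (mul_eq_zero.1 h).resolve_right cd
  have kb := key b
  rw [h1, h2, h3] at kb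
  have h0 : g 0 = 0 := by
    have h : g 0 * pinner 5 2 a b = 0 := by linarith
    exact (mul_eq_zero.1 h).resolve_right ab
  intro i
  fin_cases i <;> assumption

theorem IsBlockFrame.span_eq_top {a b c d e : Fin 5 → ℝ} (h : IsBlockFrame a b c d e) :
    Submodule.span ℝ (Set.range (Fin.cons e ![a, b, c, d] : Fin 5 → Fin 5 → ℝ)) = ⊤ := by
  have hli := linearIndependent_of_gram h.aa h.ab h.ac h.ad h.cd
  have hli5 : LinearIndependent ℝ (Fin.cons e ![a, b, c, d] : Fin 5 → Fin 5 → ℝ) := by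
    rw [linearIndependent_finCons]
    refine ⟨hli, fun hmem => ?_⟩
    have hle : Submodule.span ℝ (Set.range ![a, b, c, d])
        ≤ LinearMap.ker (pinnerL 5 2 e) := by
      rw [Submodule.span_le]
      rintro _ ⟨i, rfl⟩
      fin_cases i <;> simp [h.ea, h.eb, h.ec, h.ed]
    have := hle hmem
    simp [h.ee] at this
  exact hli5.span_eq_top_of_card_eq_finrank (by simp)

theorem IsBlockFrame.eq_zero {a b c d e : Fin 5 → ℝ} (h : IsBlockFrame a b c d e)
    {w : Fin 5 → ℝ} (wa : pinner 5 2 w a = 0) (wb : pinner 5 2 w b = 0) (wc : pinner 5 2 w c = 0)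
    (wd : pinner 5 2 w d = 0) (we : pinner 5 2 w e = 0) : w = 0 := by
  refine eq_zero_of_pinner_eq_zero (s := 2) w fun v => ?_
  have hle : Submodule.span ℝ (Set.range (Fin.cons e ![a, b, c, d] : Fin 5 → Fin 5 → ℝ))
        ≤ LinearMap.ker (pinnerL 5 2 w) := by
    rw [Submodule.span_le]
    rintro _ ⟨i, rfl⟩
    refine Fin.cases ?_ (fun j => ?_) i
    · simpa using we
    · fin_cases j <;> simp [wa, wb, wc, wd]
  have hv : v ∈ Submodule.span ℝ (Set.range (Fin.cons e ![a, b, c, d] : Fin 5 → Fin 5 → ℝ)) := by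
    rw [h.span_eq_top]; trivial
  simpa using hle hv

/-- Nondegeneracy: the orthogonal complement of `a, b, c, d` is the line of `e`. Every normal
direction below is identified in this way. -/
theorem IsBlockFrame.eq_smul {a b c d e : Fin 5 → ℝ} (h : IsBlockFrame a b c d e)
    {w : Fin 5 → ℝ} (wa : pinner 5 2 w a = 0) (wb : pinner 5 2 w b = 0) (wc : pinner 5 2 w c = 0)
    (wd : pinner 5 2 w d = 0) : w = pinner 5 2 w e • e := by
  rw [← sub_eq_zero]
  apply h.eq_zero <;>
    simp [pinner_sub_left, pinner_smul_left, wa, wb, wc, wd, h.ea, h.eb, h.ec, h.ed, h.ee]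

theorem IsBlockFrame.expand {a b c d e : Fin 5 → ℝ} (h : IsBlockFrame a b c d e)
    (hbb : pinner 5 2 b b = 0) (hab : pinner 5 2 a b = -1) (hcc : pinner 5 2 c c = 0)
    (hdd : pinner 5 2 d d = 0) (hcd : pinner 5 2 c d = 1 / 2) (hbc : pinner 5 2 b c = 0)
    (hbd : pinner 5 2 b d = 0) (w : Fin 5 → ℝ) :
    w = (-pinner 5 2 w b) • a + (-pinner 5 2 w a) • b + (2 * pinner 5 2 w d) • c
      + (2 * pinner 5 2 w c) • d + pinner 5 2 w e • e := by
  rw [← sub_eq_zero]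
  have ha := pinner_comm (s := 2) a
  apply h.eq_zero <;>
    simp only [pinner_sub_left, pinner_add_left, pinner_smul_left, h.aa, h.ac, h.ad, h.ea, h.eb,
      h.ec, h.ed, h.ee, hbb, hab, hcc, hdd, hcd, hbc, hbd, pinner_comm b a, pinner_comm c a,
      pinner_comm d a, pinner_comm c b, pinner_comm d b, pinner_comm d c, pinner_comm a e,
      pinner_comm b e, pinner_comm c e, pinner_comm d e] <;> ring

/-! ### The cross product of four vectors -/

/-- The vector that represents `w ↦ det (a, b, c, d, w)`. -/
def cross (a b c d : Fin 5 → ℝ) : Fin 5 → ℝ := fun i =>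
  (if (i : ℕ) + 2 < 5 then 1 else -1) * Matrix.det (Matrix.of ![a, b, c, d, Pi.single i 1])

theorem det_updateRow_eq_sum {n : ℕ} (A : Matrix (Fin n) (Fin n) ℝ) (k : Fin n)
    (w : Fin n → ℝ) :
    (A.updateRow k w).det = ∑ i, w i * (A.updateRow k (Pi.single i 1)).det := by
  let L : (Fin n → ℝ) →ₗ[ℝ] ℝ :=
    { toFun := fun v => (A.updateRow k v).det
      map_add' := Matrix.det_updateRow_add _ _
      map_smul' := Matrix.det_updateRow_smul _ _ }
  change L w = ∑ i, w i * L (Pi.single i 1)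
  rw [LinearMap.pi_apply_eq_sum_univ L w]
  refine Finset.sum_congr rfl fun i _ => ?_
  have hi : (fun j => if i = j then (1 : ℝ) else 0) = Pi.single i 1 := by
    funext j
    simp [Pi.single_apply, eq_comm]
  rw [hi, smul_eq_mul]

theorem pinner_cross (a b c d w : Fin 5 → ℝ) :
    pinner 5 2 (cross a b c d) w = Matrix.det (Matrix.of ![a, b, c, d, w]) := by
  have hw : Matrix.det (Matrix.of ![a, b, c, d, w])
      = ∑ i, w i * Matrix.det (Matrix.of ![a, b, c, d, Pi.single i 1]) := by
    have hup : ∀ v, Matrix.of ![a, b, c, d, v]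
        = Matrix.updateRow (Matrix.of ![a, b, c, d, w]) 4 v := by
      intro v
      ext i j
      fin_cases i <;> simp [Matrix.updateRow_apply]
    rw [hup w, det_updateRow_eq_sum]
    exact Finset.sum_congr rfl fun i _ => by rw [hup (Pi.single i 1)]
  rw [hw]
  unfold pinner cross
  refine Finset.sum_congr rfl fun i _ => ?_
  split_ifs <;> ring

theorem pinner_cross_fst (a b c d : Fin 5 → ℝ) : pinner 5 2 (cross a b c d) a = 0 := by
  rw [pinner_cross]
  exact Matrix.det_zero_of_row_eq (i := 0) (j := 4) (by decide) (by ext; simp)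

theorem pinner_cross_snd (a b c d : Fin 5 → ℝ) : pinner 5 2 (cross a b c d) b = 0 := by
  rw [pinner_cross]
  exact Matrix.det_zero_of_row_eq (i := 1) (j := 4) (by decide) (by ext; simp)

theorem pinner_cross_trd (a b c d : Fin 5 → ℝ) : pinner 5 2 (cross a b c d) c = 0 := by
  rw [pinner_cross]
  exact Matrix.det_zero_of_row_eq (i := 2) (j := 4) (by decide) (by ext; simp)

theorem pinner_cross_fth (a b c d : Fin 5 → ℝ) : pinner 5 2 (cross a b c d) d = 0 := by
  rw [pinner_cross]
  exact Matrix.det_zero_of_row_eq (i := 3) (j := 4) (by decide) (by ext; simp)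

/-- The Gram matrix of two families. -/
theorem det_pinner (u v : Fin 5 → Fin 5 → ℝ) :
    Matrix.det (Matrix.of fun i j => pinner 5 2 (u i) (v j))
      = Matrix.det (Matrix.of u) * Matrix.det (Matrix.of v) := by
  have h : (Matrix.of fun i j => pinner 5 2 (u i) (v j))
      = Matrix.of u * Matrix.diagonal ![1, 1, 1, -1, -1] * (Matrix.of v).transpose := by
    ext i j
    rw [Matrix.mul_apply]
    simp only [Matrix.of_apply, Matrix.mul_diagonal, Matrix.transpose_apply]
    unfold pinner
    refine Finset.sum_congr rfl fun l _ => ?_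
    fin_cases l <;> simp
  -- The signature matrix has determinant `1` (two minus signs), so no sign appears.
  rw [h, Matrix.det_mul, Matrix.det_mul, Matrix.det_transpose, Matrix.det_diagonal]
  simp [Fin.prod_univ_succ]

/-- Pair `a, b, c, d, w` with `a, b, c, d, m`, where `m` is the cross product and `w` is outside the
span. The Gram determinant is `det (.., w) * ⟪m, m⟫` by multiplicativity. Since `m` is orthogonal to
`a, b, c, d`, it is also the Gram determinant of these four vectors times `⟪w, m⟫ = det (.., w)`.
This nonzero factor cancels. -/
theorem pinner_cross_self {a b c d : Fin 5 → ℝ} (aa : pinner 5 2 a a = 0)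
    (ab : pinner 5 2 a b ≠ 0) (ac : pinner 5 2 a c = 0) (ad : pinner 5 2 a d = 0)
    (cd : pinner 5 2 c c * pinner 5 2 d d - pinner 5 2 c d ^ 2 ≠ 0) :
    pinner 5 2 (cross a b c d) (cross a b c d)
      = -pinner 5 2 a b ^ 2 * (pinner 5 2 c c * pinner 5 2 d d - pinner 5 2 c d ^ 2) := by
  have hli := linearIndependent_of_gram aa ab ac ad cd
  obtain ⟨w, hw⟩ : ∃ w, w ∉ Submodule.span ℝ (Set.range ![a, b, c, d]) := by
    by_contra! hall
    have htop : Submodule.span ℝ (Set.range ![a, b, c, d]) = ⊤ := eq_top_iff.2 fun w _ => hall w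
    have h1 := finrank_span_eq_card hli
    rw [htop, finrank_top] at h1
    simp at h1
  have hne : Matrix.det (Matrix.of ![a, b, c, d, w]) ≠ 0 := by
    have hli5 : LinearIndependent ℝ (Fin.snoc ![a, b, c, d] w : Fin 5 → Fin 5 → ℝ) :=
      linearIndependent_finSnoc.2 ⟨hli, hw⟩
    have he : (Fin.snoc ![a, b, c, d] w : Fin 5 → Fin 5 → ℝ) = ![a, b, c, d, w] := by
      ext i j
      fin_cases i <;> rfl
    rw [he] at hli5
    have := (Matrix.linearIndependent_rows_iff_isUnit
      (A := Matrix.of ![a, b, c, d, w])).1 hli5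
    exact ((Matrix.isUnit_iff_isUnit_det _).1 this).ne_zero
  set m := cross a b c d with hm
  have hdet := det_pinner ![a, b, c, d, w] ![a, b, c, d, m]
  rw [← pinner_cross a b c d m, ← hm] at hdet
  have hmw : pinner 5 2 w m = Matrix.det (Matrix.of ![a, b, c, d, w]) := by
    rw [pinner_comm, hm, pinner_cross]
  have hG : Matrix.det (Matrix.of fun i j => pinner 5 2 (![a, b, c, d, w] i) (![a, b, c, d, m] j))
      = -pinner 5 2 a b ^ 2 * (pinner 5 2 c c * pinner 5 2 d d - pinner 5 2 c d ^ 2)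
        * pinner 5 2 w m := by
    have e1 : pinner 5 2 a m = 0 := by rw [pinner_comm, hm, pinner_cross_fst]
    have e2 : pinner 5 2 b m = 0 := by rw [pinner_comm, hm, pinner_cross_snd]
    have e3 : pinner 5 2 c m = 0 := by rw [pinner_comm, hm, pinner_cross_trd]
    have e4 : pinner 5 2 d m = 0 := by rw [pinner_comm, hm, pinner_cross_fth]
    rw [Matrix.det_succ_row_zero]
    simp [Fin.sum_univ_succ, Matrix.det_succ_row_zero, Fin.succAbove, e1, e2, e3, e4, aa, ac, ad,
      pinner_comm b a, pinner_comm c a, pinner_comm d a, pinner_comm d c]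
    ring
  rw [hG, hmw] at hdet
  exact mul_right_cancel₀ hne (by linear_combination -hdet)

/-! ### Directional derivatives of smooth functions -/

section Derivatives

variable {P F : Type*} [NormedAddCommGroup P] [NormedSpace ℝ P] [NormedAddCommGroup F]
  [NormedSpace ℝ F]

/-- The derivative of `f` in the constant direction `ξ`. -/
def dd (ξ : P) (f : P → F) (x : P) : F := fderiv ℝ f x ξ

/-- `f` is smooth on the open set `O`. -/
structure Sm (O : Set P) (f : P → F) : Prop where
  isOpen : IsOpen O
  cd : ContDiffOn ℝ ∞ f O

variable {O : Set P} {f g : P → F} {c d : P → ℝ} {x : P} {ξ η : P}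

theorem Sm.contDiffAt (hf : Sm O f) (hx : x ∈ O) : ContDiffAt ℝ ∞ f x :=
  hf.cd.contDiffAt (hf.isOpen.mem_nhds hx)

theorem Sm.diff (hf : Sm O f) (hx : x ∈ O) : DifferentiableAt ℝ f x :=
  (hf.contDiffAt hx).differentiableAt (by simp)

theorem Sm.continuousOn (hf : Sm O f) : ContinuousOn f O := hf.cd.continuousOn

theorem Sm.mono (hf : Sm O f) {O' : Set P} (hO' : IsOpen O') (h : O' ⊆ O) : Sm O' f :=
  ⟨hO', hf.cd.mono h⟩

theorem Sm.congr (hf : Sm O f) (h : ∀ x ∈ O, g x = f x) : Sm O g :=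
  ⟨hf.isOpen, hf.cd.congr h⟩

theorem Sm.dd (hf : Sm O f) : Sm O (dd ξ f) :=
  ⟨hf.isOpen, (hf.cd.fderiv_of_isOpen hf.isOpen (by simp)).clm_apply contDiffOn_const⟩

theorem Sm.const (hO : IsOpen O) (v : F) : Sm O (fun _ => v) := ⟨hO, contDiffOn_const⟩

theorem Sm.add (hf : Sm O f) (hg : Sm O g) : Sm O (fun x => f x + g x) :=
  ⟨hf.isOpen, hf.cd.add hg.cd⟩

theorem Sm.sub (hf : Sm O f) (hg : Sm O g) : Sm O (fun x => f x - g x) :=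
  ⟨hf.isOpen, hf.cd.sub hg.cd⟩

theorem Sm.neg (hf : Sm O f) : Sm O (fun x => -f x) := ⟨hf.isOpen, hf.cd.neg⟩

theorem Sm.smul (hc : Sm O c) (hf : Sm O f) : Sm O (fun x => c x • f x) :=
  ⟨hf.isOpen, hc.cd.smul hf.cd⟩

theorem Sm.const_smul (hf : Sm O f) (r : ℝ) : Sm O (fun x => r • f x) :=
  ⟨hf.isOpen, contDiffOn_const.smul hf.cd⟩

theorem Sm.mul (hc : Sm O c) (hd : Sm O d) : Sm O (fun x => c x * d x) :=
  ⟨hc.isOpen, hc.cd.mul hd.cd⟩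

theorem Sm.const_mul (hc : Sm O c) (r : ℝ) : Sm O (fun x => r * c x) :=
  ⟨hc.isOpen, contDiffOn_const.mul hc.cd⟩

theorem Sm.pow (hc : Sm O c) (n : ℕ) : Sm O (fun x => c x ^ n) := ⟨hc.isOpen, hc.cd.pow n⟩

theorem Sm.div (hc : Sm O c) (hd : Sm O d) (h : ∀ x ∈ O, d x ≠ 0) :
    Sm O (fun x => c x / d x) := ⟨hc.isOpen, hc.cd.div hd.cd h⟩

theorem Sm.sqrt (hc : Sm O c) (h : ∀ x ∈ O, c x ≠ 0) : Sm O (fun x => √(c x)) :=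
  ⟨hc.isOpen, hc.cd.sqrt h⟩

theorem Sm.clm {G : Type*} [NormedAddCommGroup G] [NormedSpace ℝ G] (L : F →L[ℝ] G)
    (hf : Sm O f) : Sm O (fun x => L (f x)) := ⟨hf.isOpen, L.contDiff.comp_contDiffOn hf.cd⟩

theorem dd_congr (hO : IsOpen O) (h : ∀ x ∈ O, f x = g x) (hx : x ∈ O) :
    dd ξ f x = dd ξ g x := by
  have : f =ᶠ[𝓝 x] g := Filter.eventuallyEq_of_mem (hO.mem_nhds hx) h
  unfold dd
  rw [this.fderiv_eq]

@[simp] theorem dd_const (v : F) : dd ξ (fun _ : P => v) x = 0 := by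
  simp [dd]

theorem dd_eq_zero (hO : IsOpen O) {v : F} (h : ∀ x ∈ O, f x = v) (hx : x ∈ O) :
    dd ξ f x = 0 := by
  rw [dd_congr hO h hx, dd_const]

theorem dd_add (hf : DifferentiableAt ℝ f x) (hg : DifferentiableAt ℝ g x) :
    dd ξ (fun x => f x + g x) x = dd ξ f x + dd ξ g x := by
  unfold dd
  rw [fderiv_fun_add hf hg]
  rfl

theorem dd_sub (hf : DifferentiableAt ℝ f x) (hg : DifferentiableAt ℝ g x) :
    dd ξ (fun x => f x - g x) x = dd ξ f x - dd ξ g x := by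
  unfold dd
  rw [fderiv_fun_sub hf hg]
  rfl

theorem dd_neg : dd ξ (fun x => -f x) x = -dd ξ f x := by
  unfold dd
  rw [fderiv_fun_neg]
  rfl

theorem dd_smul (hc : DifferentiableAt ℝ c x) (hf : DifferentiableAt ℝ f x) :
    dd ξ (fun x => c x • f x) x = c x • dd ξ f x + dd ξ c x • f x := by
  unfold dd
  rw [fderiv_fun_smul hc hf]
  rfl

theorem dd_const_smul (hf : DifferentiableAt ℝ f x) (r : ℝ) :
    dd ξ (fun x => r • f x) x = r • dd ξ f x := by
  unfold dd
  rw [fderiv_fun_const_smul hf]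
  rfl

theorem dd_mul (hc : DifferentiableAt ℝ c x) (hd : DifferentiableAt ℝ d x) :
    dd ξ (fun x => c x * d x) x = c x * dd ξ d x + dd ξ c x * d x :=
  dd_smul hc hd

theorem dd_const_mul (hc : DifferentiableAt ℝ c x) (r : ℝ) :
    dd ξ (fun x => r * c x) x = r * dd ξ c x :=
  dd_const_smul hc r

theorem dd_clm {G : Type*} [NormedAddCommGroup G] [NormedSpace ℝ G] (L : F →L[ℝ] G)
    (hf : DifferentiableAt ℝ f x) : dd ξ (fun x => L (f x)) x = L (dd ξ f x) := by
  unfold dd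
  have := (L.hasFDerivAt.comp x hf.hasFDerivAt).fderiv
  rw [show (fun x => L (f x)) = L ∘ f from rfl, this]
  rfl

theorem dd_dir_add : dd (ξ + η) f x = dd ξ f x + dd η f x := by
  simp [dd]

theorem dd_dir_smul (r : ℝ) : dd (r • ξ) f x = r • dd ξ f x := by
  simp [dd]

theorem dd_dd_apply (hf : Sm O f) (hx : x ∈ O) :
    dd ξ (dd η f) x = fderiv ℝ (fderiv ℝ f) x ξ η := by
  have h : DifferentiableAt ℝ (fderiv ℝ f) x :=
    ((hf.cd.fderiv_of_isOpen hf.isOpen (m := ∞) (by simp)).contDiffAt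
      (hf.isOpen.mem_nhds hx)).differentiableAt (by simp)
  exact dd_clm (ContinuousLinearMap.apply ℝ F η) h

theorem dd_comm (hf : Sm O f) (hx : x ∈ O) : dd ξ (dd η f) x = dd η (dd ξ f) x := by
  rw [dd_dd_apply hf hx, dd_dd_apply hf hx]
  exact ((hf.contDiffAt hx).isSymmSndFDerivAt (by
    rw [minSmoothness_of_isRCLikeNormedField]
    exact WithTop.coe_le_coe.2 (le_top (a := (2 : ℕ∞))))).eq ξ η

variable {m s : ℕ} {X Z : P → Fin m → ℝ}

theorem Sm.pinner (hX : Sm O X) (hZ : Sm O Z) : Sm O (fun x => pinner m s (X x) (Z x)) :=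
  ⟨hX.isOpen, (((pinnerL m s).toContinuousBilinearMap.contDiff.comp_contDiffOn hX.cd).clm_apply
    hZ.cd)⟩

theorem dd_pinner (hX : DifferentiableAt ℝ X x) (hZ : DifferentiableAt ℝ Z x) :
    dd ξ (fun x => pinner m s (X x) (Z x)) x
      = pinner m s (dd ξ X x) (Z x) + pinner m s (X x) (dd ξ Z x) := by
  have := ((pinnerL m s).toContinuousBilinearMap.hasFDerivAt_of_bilinear
    hX.hasFDerivAt hZ.hasFDerivAt).fderiv
  unfold dd
  rw [add_comm]
  exact congrArg (fun L => L ξ) this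

/-- The workhorse of the moving frame method: an identity between scalar products on an open set is
differentiated to find a frame coefficient of a derivative. -/
theorem dd_pinner_eq (hX : Sm O X) (hZ : Sm O Z) {g : P → ℝ}
    (h : ∀ x ∈ O, TimelikeSurface.pinner m s (X x) (Z x) = g x) (hx : x ∈ O) :
    TimelikeSurface.pinner m s (dd ξ X x) (Z x) + TimelikeSurface.pinner m s (X x) (dd ξ Z x)
      = dd ξ g x := by
  rw [← dd_pinner (hX.diff hx) (hZ.diff hx)]
  exact dd_congr hX.isOpen h hx

theorem dd_pinner_eq_zero (hX : Sm O X) (hZ : Sm O Z) {r : ℝ}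
    (h : ∀ x ∈ O, TimelikeSurface.pinner m s (X x) (Z x) = r) (hx : x ∈ O) :
    TimelikeSurface.pinner m s (dd ξ X x) (Z x) + TimelikeSurface.pinner m s (X x) (dd ξ Z x)
      = 0 := by
  rw [dd_pinner_eq hX hZ h hx, dd_const]

theorem Sm.det {n : ℕ} {A : P → Fin n → Fin n → ℝ} (hO : IsOpen O)
    (hA : ∀ i, Sm O (fun x => A x i)) : Sm O (fun x => Matrix.det (Matrix.of (A x))) := by
  refine ⟨hO, ?_⟩
  simp only [Matrix.det_apply]
  refine ContDiffOn.sum fun σ _ => ?_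
  have h : ContDiffOn ℝ ∞ (fun x => ∏ i, A x (σ i) i) O :=
    contDiffOn_prod fun i _ => contDiffOn_pi.1 (hA (σ i)).cd i
  simpa [Units.smul_def, zsmul_eq_mul] using contDiffOn_const.mul h

theorem Sm.cross {p q r t : P → Fin 5 → ℝ} (hp : Sm O p) (hq : Sm O q) (hr : Sm O r)
    (ht : Sm O t) : Sm O (fun x => cross (p x) (q x) (r x) (t x)) := by
  refine ⟨hp.isOpen, contDiffOn_pi.2 fun i => ?_⟩
  have h : Sm O (fun x => Matrix.det (Matrix.of ![p x, q x, r x, t x, Pi.single i 1])) :=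
    Sm.det hp.isOpen fun j => by
      fin_cases j
      exacts [hp, hq, hr, ht, Sm.const hp.isOpen _]
  exact (h.const_mul _).cd

end Derivatives

/-! ### Structure equations in asymptotic coordinates -/

/-- A canonical lift `Y` in asymptotic coordinates with coordinate vectors `a` and `b`, completed
by the lightlike vector `N` and the unit normal vector `E` of the conformal Gauss map. -/
structure NullFrame (O : Set E2) (Y N E : E2 → Fin 5 → ℝ) (a b : E2) : Prop where
  smY : Sm O Y
  smN : Sm O N
  smE : Sm O E
  YY : ∀ x ∈ O, ⟪Y x, Y x⟫ = 0
  NN : ∀ x ∈ O, ⟪N x, N x⟫ = 0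
  YN : ∀ x ∈ O, ⟪Y x, N x⟫ = -1
  AA : ∀ x ∈ O, ⟪dd a Y x, dd a Y x⟫ = 0
  BB : ∀ x ∈ O, ⟪dd b Y x, dd b Y x⟫ = 0
  AB : ∀ x ∈ O, ⟪dd a Y x, dd b Y x⟫ = 1 / 2
  NA : ∀ x ∈ O, ⟪N x, dd a Y x⟫ = 0
  NB : ∀ x ∈ O, ⟪N x, dd b Y x⟫ = 0
  EE : ∀ x ∈ O, ⟪E x, E x⟫ = 1
  EY : ∀ x ∈ O, ⟪E x, Y x⟫ = 0
  EN : ∀ x ∈ O, ⟪E x, N x⟫ = 0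
  EA : ∀ x ∈ O, ⟪E x, dd a Y x⟫ = 0
  EB : ∀ x ∈ O, ⟪E x, dd b Y x⟫ = 0
  EAB : ∀ x ∈ O, ⟪E x, dd b (dd a Y) x⟫ = 0

/-- The coefficient of the conformal Hopf differential `Y_aa` in the direction of `E`. -/
def hopf (Y E : E2 → Fin 5 → ℝ) (a : E2) (x : E2) : ℝ := ⟪dd a (dd a Y) x, E x⟫

/-- Half of the Schwarzian coefficient of `Y_aa`. -/
def schwarz (Y N : E2 → Fin 5 → ℝ) (a : E2) (x : E2) : ℝ := ⟪dd a (dd a Y) x, N x⟫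

namespace NullFrame

variable {O : Set E2} {Y N E : E2 → Fin 5 → ℝ} {a b x : E2}

theorem isOpen (F : NullFrame O Y N E a b) : IsOpen O := F.smY.isOpen

theorem mono (F : NullFrame O Y N E a b) {O' : Set E2} (hO' : IsOpen O') (h : O' ⊆ O) :
    NullFrame O' Y N E a b where
  smY := F.smY.mono hO' h
  smN := F.smN.mono hO' h
  smE := F.smE.mono hO' h
  YY := fun x hx => F.YY x (h hx)
  NN := fun x hx => F.NN x (h hx)
  YN := fun x hx => F.YN x (h hx)
  AA := fun x hx => F.AA x (h hx)
  BB := fun x hx => F.BB x (h hx)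
  AB := fun x hx => F.AB x (h hx)
  NA := fun x hx => F.NA x (h hx)
  NB := fun x hx => F.NB x (h hx)
  EE := fun x hx => F.EE x (h hx)
  EY := fun x hx => F.EY x (h hx)
  EN := fun x hx => F.EN x (h hx)
  EA := fun x hx => F.EA x (h hx)
  EB := fun x hx => F.EB x (h hx)
  EAB := fun x hx => F.EAB x (h hx)

/-- The frame conditions are symmetric in the two null directions, so each identity for `a` has a
twin for `b`. -/
theorem swap (F : NullFrame O Y N E a b) : NullFrame O Y N E b a where
  smY := F.smY
  smN := F.smN
  smE := F.smE
  YY := F.YY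
  NN := F.NN
  YN := F.YN
  AA := F.BB
  BB := F.AA
  AB := fun x hx => by rw [pinner_comm, F.AB x hx]
  NA := F.NB
  NB := F.NA
  EE := F.EE
  EY := F.EY
  EN := F.EN
  EA := F.EB
  EB := F.EA
  EAB := fun x hx => by rw [dd_comm F.smY hx, F.EAB x hx]

theorem smA (F : NullFrame O Y N E a b) : Sm O (dd a Y) := F.smY.dd

theorem smB (F : NullFrame O Y N E a b) : Sm O (dd b Y) := F.smY.dd

theorem smHopf (F : NullFrame O Y N E a b) : Sm O (hopf Y E a) := F.smA.dd.pinner F.smE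

theorem smSchwarz (F : NullFrame O Y N E a b) : Sm O (schwarz Y N a) := F.smA.dd.pinner F.smN

theorem YA (F : NullFrame O Y N E a b) (x : E2) (hx : x ∈ O) : ⟪Y x, dd a Y x⟫ = 0 := by
  have := dd_pinner_eq_zero (ξ := a) F.smY F.smY F.YY hx
  rw [pinner_comm (dd a Y x)] at this
  linarith

theorem Y_AA (F : NullFrame O Y N E a b) (x : E2) (hx : x ∈ O) :
    ⟪Y x, dd a (dd a Y) x⟫ = 0 := by
  have := dd_pinner_eq_zero (ξ := a) F.smY F.smA F.YA hx
  rw [F.AA x hx] at this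
  linarith

theorem Y_AB (F : NullFrame O Y N E a b) (x : E2) (hx : x ∈ O) :
    ⟪Y x, dd b (dd a Y) x⟫ = -1 / 2 := by
  have := dd_pinner_eq_zero (ξ := b) F.smY F.smA F.YA hx
  rw [pinner_comm (dd b Y x), F.AB x hx] at this
  linarith

theorem A_AA (F : NullFrame O Y N E a b) (x : E2) (hx : x ∈ O) :
    ⟪dd a Y x, dd a (dd a Y) x⟫ = 0 := by
  have := dd_pinner_eq_zero (ξ := a) F.smA F.smA F.AA hx
  rw [pinner_comm (dd a (dd a Y) x)] at this
  linarith

theorem A_AB (F : NullFrame O Y N E a b) (x : E2) (hx : x ∈ O) :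
    ⟪dd a Y x, dd b (dd a Y) x⟫ = 0 := by
  have := dd_pinner_eq_zero (ξ := b) F.smA F.smA F.AA hx
  rw [pinner_comm (dd b (dd a Y) x)] at this
  linarith

theorem B_AB (F : NullFrame O Y N E a b) (x : E2) (hx : x ∈ O) :
    ⟪dd b Y x, dd b (dd a Y) x⟫ = 0 := by
  rw [dd_comm F.smY hx, F.swap.A_AB x hx]

/-- Together with `Y_AA` and `A_AA` this leaves only `Y` and `E` components in `Y_aa`. -/
theorem B_AA (F : NullFrame O Y N E a b) (x : E2) (hx : x ∈ O) :
    ⟪dd b Y x, dd a (dd a Y) x⟫ = 0 := by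
  have := dd_pinner_eq_zero (ξ := a) F.smA F.smB F.AB hx
  rw [dd_comm (ξ := a) (η := b) F.smY hx, F.A_AB x hx, pinner_comm] at this
  linarith

theorem block (F : NullFrame O Y N E a b) (hx : x ∈ O) :
    IsBlockFrame (Y x) (N x) (dd a Y x) (dd b Y x) (E x) where
  aa := F.YY x hx
  ab := by rw [F.YN x hx]; norm_num
  ac := F.YA x hx
  ad := F.swap.YA x hx
  cd := by rw [F.AA x hx, F.AB x hx]; norm_num
  ee := F.EE x hx
  ea := F.EY x hx
  eb := F.EN x hx
  ec := F.EA x hx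
  ed := F.EB x hx

theorem expand (F : NullFrame O Y N E a b) (hx : x ∈ O) (w : Fin 5 → ℝ) :
    w = (-⟪w, N x⟫) • Y x + (-⟪w, Y x⟫) • N x + (2 * ⟪w, dd b Y x⟫) • dd a Y x
      + (2 * ⟪w, dd a Y x⟫) • dd b Y x + ⟪w, E x⟫ • E x :=
  (F.block hx).expand (F.NN x hx) (F.YN x hx) (F.AA x hx) (F.BB x hx) (F.AB x hx) (F.NA x hx)
    (F.NB x hx) w

theorem aa_eq (F : NullFrame O Y N E a b) (x : E2) (hx : x ∈ O) :
    dd a (dd a Y) x = (-schwarz Y N a x) • Y x + hopf Y E a x • E x := by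
  have h := F.expand hx (dd a (dd a Y) x)
  rw [pinner_comm _ (Y x), pinner_comm _ (dd b Y x), pinner_comm _ (dd a Y x), F.Y_AA x hx,
    F.B_AA x hx, F.A_AA x hx] at h
  simpa [schwarz, hopf] using h

theorem ab_eq_aux (F : NullFrame O Y N E a b) (x : E2) (hx : x ∈ O) :
    dd b (dd a Y) x = (-⟪dd b (dd a Y) x, N x⟫) • Y x + (1 / 2 : ℝ) • N x := by
  have h := F.expand hx (dd b (dd a Y) x)
  rw [pinner_comm _ (Y x), pinner_comm _ (dd b Y x), pinner_comm _ (dd a Y x),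
    pinner_comm _ (E x), F.Y_AB x hx, F.B_AB x hx, F.A_AB x hx, F.EAB x hx] at h
  have e : (-(-1 / 2) : ℝ) = 1 / 2 := by norm_num
  rw [e] at h
  simpa using h

/-- The Gauss equation. -/
theorem ab_N (F : NullFrame O Y N E a b) (x : E2) (hx : x ∈ O) :
    ⟪dd b (dd a Y) x, N x⟫ = hopf Y E a x * hopf Y E b x := by
  -- Differentiating `⟪Y_a, Y_ab⟫ = 0` along `b` and `⟪Y_a, Y_bb⟫ = 0` along `a` and comparing the
  -- third derivatives gives `⟪Y_ab, Y_ab⟫ = ⟪Y_aa, Y_bb⟫`.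
  have h1 := dd_pinner_eq_zero (ξ := b) F.smA F.smA.dd F.A_AB hx
  have h2 := dd_pinner_eq_zero (ξ := a) F.smA F.smB.dd F.swap.B_AA hx
  have h3 : dd a (dd b (dd b Y)) x = dd b (dd b (dd a Y)) x := by
    rw [dd_comm F.smB hx]
    exact dd_congr F.isOpen (fun z hz => dd_comm F.smY hz) hx
  have h4 : ⟪dd a (dd a Y) x, dd b (dd b Y) x⟫ = hopf Y E a x * hopf Y E b x := by
    rw [F.aa_eq x hx, F.swap.aa_eq x hx]
    simp only [pinner_add_left, pinner_add_right, pinner_smul_left, pinner_smul_right, F.YY x hx,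
      F.EE x hx, F.EY x hx, pinner_comm (Y x) (E x)]
    ring
  have h5 : ⟪dd b (dd a Y) x, dd b (dd a Y) x⟫ = ⟪dd b (dd a Y) x, N x⟫ := by
    nth_rewrite 1 [F.ab_eq_aux x hx]
    rw [pinner_add_left, pinner_smul_left, pinner_smul_left, F.Y_AB x hx, pinner_comm (N x)]
    ring
  rw [h3, h4] at h2
  linarith

theorem ab_eq (F : NullFrame O Y N E a b) (x : E2) (hx : x ∈ O) :
    dd b (dd a Y) x = (-(hopf Y E a x * hopf Y E b x)) • Y x + (1 / 2 : ℝ) • N x := by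
  have := F.ab_eq_aux x hx
  rwa [F.ab_N x hx] at this

theorem EA_Y (F : NullFrame O Y N E a b) (x : E2) (hx : x ∈ O) : ⟪dd a E x, Y x⟫ = 0 := by
  have := dd_pinner_eq_zero (ξ := a) F.smE F.smY F.EY hx
  rw [F.EA x hx] at this
  linarith

theorem EA_A (F : NullFrame O Y N E a b) (x : E2) (hx : x ∈ O) :
    ⟪dd a E x, dd a Y x⟫ = -hopf Y E a x := by
  have := dd_pinner_eq_zero (ξ := a) F.smE F.smA F.EA hx
  rw [pinner_comm (E x)] at this
  unfold hopf
  linarith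

theorem EA_B (F : NullFrame O Y N E a b) (x : E2) (hx : x ∈ O) :
    ⟪dd a E x, dd b Y x⟫ = 0 := by
  have := dd_pinner_eq_zero (ξ := a) F.smE F.smB F.EB hx
  rw [dd_comm F.smY hx, F.EAB x hx] at this
  linarith

theorem EA_E (F : NullFrame O Y N E a b) (x : E2) (hx : x ∈ O) : ⟪dd a E x, E x⟫ = 0 := by
  have := dd_pinner_eq_zero (ξ := a) F.smE F.smE F.EE hx
  rw [pinner_comm (E x)] at this
  linarith

theorem aab (F : NullFrame O Y N E a b) (x : E2) (hx : x ∈ O) :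
    dd b (dd a (dd a Y)) x = dd a (dd b (dd a Y)) x :=
  dd_comm F.smA hx

/-- Equate `Y_aab` and `Y_aba` against `E`: the first gives `(h_a)_b`, because `E_b` is orthogonal
to `Y_aa`, and the second gives `-⟪E_a, Y_ab⟫ = -⟪E_a, N⟫ / 2`. -/
theorem EA_N (F : NullFrame O Y N E a b) (x : E2) (hx : x ∈ O) :
    ⟪dd a E x, N x⟫ = -2 * dd b (hopf Y E a) x := by
  have h1 := dd_pinner_eq_zero (ξ := a) F.smE F.smA.dd F.EAB hx
  have h2 := dd_pinner_eq (ξ := b) F.smA.dd F.smE (g := hopf Y E a) (fun _ _ => rfl) hx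
  have h3 : ⟪dd a (dd a Y) x, dd b E x⟫ = 0 := by
    rw [F.aa_eq x hx, pinner_add_left, pinner_smul_left, pinner_smul_left, pinner_comm (Y x),
      pinner_comm (E x), F.swap.EA_Y x hx, F.swap.EA_E x hx]
    ring
  have h4 : ⟪dd a E x, dd b (dd a Y) x⟫ = 1 / 2 * ⟪dd a E x, N x⟫ := by
    rw [F.ab_eq x hx, pinner_add_right, pinner_smul_right, pinner_smul_right, F.EA_Y x hx]
    ring
  rw [F.aab x hx, pinner_comm, h3] at h2
  rw [h4] at h1
  linarith

theorem ea_eq (F : NullFrame O Y N E a b) (x : E2) (hx : x ∈ O) :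
    dd a E x = (2 * dd b (hopf Y E a) x) • Y x + (-2 * hopf Y E a x) • dd b Y x := by
  have h := F.expand hx (dd a E x)
  rw [F.EA_Y x hx, F.EA_A x hx, F.EA_B x hx, F.EA_E x hx, F.EA_N x hx] at h
  rw [h]
  module

theorem NA_Y (F : NullFrame O Y N E a b) (x : E2) (hx : x ∈ O) : ⟪dd a N x, Y x⟫ = 0 := by
  have := dd_pinner_eq_zero (ξ := a) F.smY F.smN F.YN hx
  rw [pinner_comm (dd a Y x), F.NA x hx, pinner_comm] at this
  linarith

theorem NA_A (F : NullFrame O Y N E a b) (x : E2) (hx : x ∈ O) :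
    ⟪dd a N x, dd a Y x⟫ = -schwarz Y N a x := by
  have := dd_pinner_eq_zero (ξ := a) F.smN F.smA F.NA hx
  rw [pinner_comm (N x)] at this
  unfold schwarz
  linarith

theorem NA_B (F : NullFrame O Y N E a b) (x : E2) (hx : x ∈ O) :
    ⟪dd a N x, dd b Y x⟫ = -(hopf Y E a x * hopf Y E b x) := by
  have := dd_pinner_eq_zero (ξ := a) F.smN F.smB F.NB hx
  rw [pinner_comm (N x), dd_comm F.smY hx, F.ab_N x hx] at this
  linarith

theorem NA_N (F : NullFrame O Y N E a b) (x : E2) (hx : x ∈ O) : ⟪dd a N x, N x⟫ = 0 := by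
  have := dd_pinner_eq_zero (ξ := a) F.smN F.smN F.NN hx
  rw [pinner_comm (N x)] at this
  linarith

theorem NA_E (F : NullFrame O Y N E a b) (x : E2) (hx : x ∈ O) :
    ⟪dd a N x, E x⟫ = 2 * dd b (hopf Y E a) x := by
  have := dd_pinner_eq_zero (ξ := a) F.smE F.smN F.EN hx
  rw [F.EA_N x hx, pinner_comm (E x)] at this
  linarith

theorem na_eq (F : NullFrame O Y N E a b) (x : E2) (hx : x ∈ O) :
    dd a N x = (-2 * (hopf Y E a x * hopf Y E b x)) • dd a Y x
      + (-2 * schwarz Y N a x) • dd b Y x + (2 * dd b (hopf Y E a) x) • E x := by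
  have h := F.expand hx (dd a N x)
  rw [F.NA_Y x hx, F.NA_A x hx, F.NA_B x hx, F.NA_E x hx, F.NA_N x hx] at h
  rw [h]
  module

theorem eab_N (F : NullFrame O Y N E a b) (x : E2) (hx : x ∈ O) :
    ⟪dd b (dd a E) x, N x⟫
      = -2 * dd b (dd b (hopf Y E a)) x - 2 * (schwarz Y N b x * hopf Y E a x) := by
  have h := dd_pinner_eq (ξ := b) F.smE.dd F.smN F.EA_N hx
  rw [dd_const_mul (F.smHopf.dd.diff hx)] at h
  have h2 : ⟪dd a E x, dd b N x⟫ = 2 * (schwarz Y N b x * hopf Y E a x) := by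
    rw [F.ea_eq x hx, pinner_add_left, pinner_smul_left, pinner_smul_left, pinner_comm (Y x),
      pinner_comm (dd b Y x), F.swap.NA_Y x hx, F.swap.NA_A x hx]
    ring
  rw [h2] at h
  linarith

/-- The Codazzi equation. -/
theorem codazzi (F : NullFrame O Y N E a b) (x : E2) (hx : x ∈ O) :
    dd b (dd b (hopf Y E a)) x + schwarz Y N b x * hopf Y E a x
      = dd a (dd a (hopf Y E b)) x + schwarz Y N a x * hopf Y E b x := by
  -- Both sides come from `⟪E_ab, N⟫ = ⟪E_ba, N⟫`.
  have h1 := F.eab_N x hx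
  have h2 := F.swap.eab_N x hx
  rw [dd_comm F.smE hx, h2] at h1
  linarith

/-- The Gauss equation for the Schwarzian. -/
theorem schwarz_b (F : NullFrame O Y N E a b) (x : E2) (hx : x ∈ O) :
    dd b (schwarz Y N a) x = 2 * (hopf Y E a x * dd a (hopf Y E b) x)
      + dd a (fun z => hopf Y E a z * hopf Y E b z) x := by
  -- Again `Y_aab = Y_aba`, now paired with `N`.
  have h1 := dd_pinner_eq (ξ := b) F.smA.dd F.smN (g := schwarz Y N a) (fun _ _ => rfl) hx
  have h2 := dd_pinner_eq (ξ := a) F.smA.dd F.smN F.ab_N hx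
  have h3 : ⟪dd a (dd a Y) x, dd b N x⟫ = 2 * (hopf Y E a x * dd a (hopf Y E b) x) := by
    rw [F.aa_eq x hx, pinner_add_left, pinner_smul_left, pinner_smul_left, pinner_comm (Y x),
      pinner_comm (E x), F.swap.NA_Y x hx, F.swap.NA_E x hx]
    ring
  have h4 : ⟪dd b (dd a Y) x, dd a N x⟫ = 0 := by
    rw [F.ab_eq x hx, pinner_add_left, pinner_smul_left, pinner_smul_left, pinner_comm (Y x),
      pinner_comm (N x), F.NA_Y x hx, F.NA_N x hx]
    ring
  rw [F.aab x hx, h3] at h1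
  rw [h4] at h2
  linarith

end NullFrame

/-! ### The parallel vector of an isothermic Willmore surface -/

/-- The vector with `⟨c, Y⟩ = k`, `⟨c, E⟩ = 0` that is constant for isothermic Willmore surfaces
with conformal Hopf differentials `α k E` and `β k E`. -/
def parallelVec (Y N : E2 → Fin 5 → ℝ) (k : E2 → ℝ) (γ : ℝ) (a b x : E2) : Fin 5 → ℝ :=
  (-(2 * dd b (dd a k) x + 2 * γ * k x ^ 3)) • Y x + (2 * dd b k x) • dd a Y x
    + (2 * dd a k x) • dd b Y x + (-k x) • N x

namespace NullFrame

variable {O : Set E2} {Y N E : E2 → Fin 5 → ℝ} {a b x : E2} {k : E2 → ℝ} {α β : ℝ}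

theorem parallelVec_swap (hk : Sm O k) (γ : ℝ) (hx : x ∈ O) :
    parallelVec Y N k γ a b x = parallelVec Y N k γ b a x := by
  unfold parallelVec
  rw [dd_comm hk hx]
  module

/-- In the frame expansion of the derivative, the `N` and `Y_a` components cancel by the choice of
coefficients, the `E` component because both Hopf coefficients are constant multiples of `k`, and
the `Y_b` component by the Willmore equation `hW`. The `Y` component needs the third derivative
`k_aba`, found from `hW` and the Gauss equation for the Schwarzian. The other direction follows by
`swap`. -/
theorem dd_parallelVec (F : NullFrame O Y N E a b) (hk : Sm O k)
    (h1 : ∀ x ∈ O, hopf Y E a x = α * k x) (h2 : ∀ x ∈ O, hopf Y E b x = β * k x)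
    (hW : ∀ x ∈ O, dd a (dd a k) x = -(schwarz Y N a x * k x)) (hx : x ∈ O) :
    dd a (parallelVec Y N k (α * β) a b) x = 0 := by
  have smr : Sm O (fun x => 2 * dd b (dd a k) x + 2 * (α * β) * k x ^ 3) :=
    (hk.dd.dd.const_mul 2).add ((hk.pow 3).const_mul _)
  have d1 : dd b (hopf Y E a) x = α * dd b k x := by
    rw [dd_congr F.isOpen h1 hx, dd_const_mul (hk.diff hx)]
  have d2 : dd a (hopf Y E b) x = β * dd a k x := by
    rw [dd_congr F.isOpen h2 hx, dd_const_mul (hk.diff hx)]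
  have d3 : dd a (fun z => hopf Y E a z * hopf Y E b z) x
      = 2 * (α * β) * (k x * dd a k x) := by
    rw [dd_mul (F.smHopf.diff hx) (F.swap.smHopf.diff hx), d2, dd_congr F.isOpen h1 hx,
      dd_const_mul (hk.diff hx), h1 x hx, h2 x hx]
    ring
  have dp : dd b (schwarz Y N a) x = 4 * (α * β) * (k x * dd a k x) := by
    rw [F.schwarz_b x hx, d3, d2, h1 x hx]
    ring
  -- Differentiate `k_aa = -s_a k` along `b`; the derivative of the Schwarzian is `dp`.
  have dk : dd a (dd b (dd a k)) x
      = -(schwarz Y N a x * dd b k x + 4 * (α * β) * (k x * dd a k x) * k x) := by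
    rw [dd_comm hk.dd hx, dd_congr F.isOpen hW hx, dd_neg,
      dd_mul (F.smSchwarz.diff hx) (hk.diff hx), dp]
  have dpow : dd a (fun x => k x ^ 3) x = 3 * k x ^ 2 * dd a k x := by
    have e : (fun x => k x ^ 3) = fun x => k x * (k x * k x) := by
      funext z; ring
    rw [e, dd_mul (hk.diff hx) ((hk.mul hk).diff hx), dd_mul (hk.diff hx) (hk.diff hx)]
    ring
  have dr : dd a (fun x => 2 * dd b (dd a k) x + 2 * (α * β) * k x ^ 3) x
      = -2 * schwarz Y N a x * dd b k x - 2 * (α * β) * k x ^ 2 * dd a k x := by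
    rw [dd_add ((hk.dd.dd.const_mul 2).diff hx) (((hk.pow 3).const_mul _).diff hx),
      dd_const_mul (hk.dd.dd.diff hx), dd_const_mul ((hk.pow 3).diff hx), dk, dpow]
    ring
  have s1 := smr.neg.smul F.smY
  have s2 := (hk.dd (ξ := b).const_mul 2).smul F.smA
  have s3 := (hk.dd (ξ := a).const_mul 2).smul F.smB
  have s4 := hk.neg.smul F.smN
  unfold parallelVec
  rw [dd_add (((s1.add s2).add s3).diff hx) (s4.diff hx), dd_add ((s1.add s2).diff hx) (s3.diff hx),
    dd_add (s1.diff hx) (s2.diff hx), dd_smul (smr.neg.diff hx) (F.smY.diff hx),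
    dd_smul ((hk.dd.const_mul 2).diff hx) (F.smA.diff hx),
    dd_smul ((hk.dd.const_mul 2).diff hx) (F.smB.diff hx),
    dd_smul (hk.neg.diff hx) (F.smN.diff hx), dd_neg, dd_neg, dd_const_mul (hk.dd.diff hx),
    dd_const_mul (hk.dd.diff hx), dr, F.na_eq x hx, F.aa_eq x hx, dd_comm F.smY hx,
    F.ab_eq x hx, dd_comm hk hx, h1 x hx, h2 x hx, d1, hW x hx]
  module

theorem parallelVec_Y (F : NullFrame O Y N E a b) (γ : ℝ) (hx : x ∈ O) :
    ⟪parallelVec Y N k γ a b x, Y x⟫ = k x := by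
  unfold parallelVec
  rw [pinner_comm]
  simp only [pinner_add_right, pinner_smul_right, F.YY x hx, F.YA x hx, F.swap.YA x hx, F.YN x hx]
  ring

theorem parallelVec_A (F : NullFrame O Y N E a b) (γ : ℝ) (hx : x ∈ O) :
    ⟪parallelVec Y N k γ a b x, dd a Y x⟫ = dd a k x := by
  unfold parallelVec
  simp only [pinner_add_left, pinner_smul_left, F.YA x hx, F.AA x hx, pinner_comm (dd b Y x),
    F.AB x hx, F.NA x hx]
  ring

theorem parallelVec_N (F : NullFrame O Y N E a b) (γ : ℝ) (hx : x ∈ O) :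
    ⟪parallelVec Y N k γ a b x, N x⟫ = 2 * dd b (dd a k) x + 2 * γ * k x ^ 3 := by
  unfold parallelVec
  simp only [pinner_add_left, pinner_smul_left, F.YN x hx, F.NN x hx, pinner_comm (dd b Y x),
    pinner_comm (dd a Y x), F.NA x hx, F.NB x hx]
  ring

theorem parallelVec_E (F : NullFrame O Y N E a b) (γ : ℝ) (hx : x ∈ O) :
    ⟪parallelVec Y N k γ a b x, E x⟫ = 0 := by
  unfold parallelVec
  rw [pinner_comm]
  simp only [pinner_add_right, pinner_smul_right, F.EY x hx, F.EN x hx, F.EA x hx, F.EB x hx]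
  ring

/-- A constant vector orthogonal to `E` is a multiple of the parallel vector. -/
theorem eq_smul_parallelVec (F : NullFrame O Y N E a b) (hk : Sm O k) (hk0 : ∀ x ∈ O, k x ≠ 0)
    (hα : α ≠ 0) (hβ : β ≠ 0)
    (h1 : ∀ x ∈ O, hopf Y E a x = α * k x) (h2 : ∀ x ∈ O, hopf Y E b x = β * k x)
    {v : Fin 5 → ℝ} (hv : ∀ x ∈ O, ⟪v, E x⟫ = 0) (hx : x ∈ O) :
    v = (⟪v, Y x⟫ / k x) • parallelVec Y N k (α * β) a b x := by
  have smv : Sm O (fun _ : E2 => v) := Sm.const F.isOpen v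
  have smf : Sm O (fun x => ⟪v, Y x⟫) := smv.pinner F.smY
  have dY : ∀ ξ, ∀ x ∈ O, dd ξ (fun x => ⟪v, Y x⟫) x = ⟪v, dd ξ Y x⟫ := fun ξ x hx => by
    rw [dd_pinner (smv.diff hx) (F.smY.diff hx), dd_const, pinner_zero_left, zero_add]
  -- Since `E_a` and `E_b` lie in the spans of `Y, Y_b` and of `Y, Y_a`, this gives `k ⟪v, Y_b⟫ =
  -- k_b ⟪v, Y⟫` and its twin. So `⟪v, Y⟫` and `k` have proportional first derivatives, and one more
  -- derivative fixes the `Y_ab` pairing. All frame pairings of `v` are then those of a multiple of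
  -- the parallel vector.
  have dE : ∀ ξ, ∀ x ∈ O, ⟪v, dd ξ E x⟫ = 0 := fun ξ x hx => by
    have := dd_pinner_eq_zero (ξ := ξ) smv F.smE hv hx
    rwa [dd_const, pinner_zero_left, zero_add] at this
  have d1 : ∀ x ∈ O, dd b (hopf Y E a) x = α * dd b k x := fun x hx => by
    rw [dd_congr F.isOpen h1 hx, dd_const_mul (hk.diff hx)]
  have d2 : ∀ x ∈ O, dd a (hopf Y E b) x = β * dd a k x := fun x hx => by
    rw [dd_congr F.isOpen h2 hx, dd_const_mul (hk.diff hx)]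
  have eB : ∀ x ∈ O, k x * ⟪v, dd b Y x⟫ = dd b k x * ⟪v, Y x⟫ := fun x hx => by
    have := dE a x hx
    rw [F.ea_eq x hx, pinner_add_right, pinner_smul_right, pinner_smul_right, d1 x hx,
      h1 x hx] at this
    exact mul_left_cancel₀ hα (by linarith)
  have eA : ∀ x ∈ O, k x * ⟪v, dd a Y x⟫ = dd a k x * ⟪v, Y x⟫ := fun x hx => by
    have := dE b x hx
    rw [F.swap.ea_eq x hx, pinner_add_right, pinner_smul_right, pinner_smul_right, d2 x hx,
      h2 x hx] at this
    exact mul_left_cancel₀ hβ (by linarith)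
  have smvA : Sm O (fun x => ⟪v, dd a Y x⟫) := smv.pinner F.smA
  have eAB : k x * ⟪v, dd b (dd a Y) x⟫ = dd b (dd a k) x * ⟪v, Y x⟫ := by
    have h := dd_congr (ξ := b) F.isOpen eA hx
    rw [dd_mul (hk.diff hx) (smvA.diff hx), dd_mul (hk.dd.diff hx) (smf.diff hx),
      dd_pinner (smv.diff hx) (F.smA.diff hx), dY b x hx, dd_const, pinner_zero_left,
      zero_add] at h
    refine mul_left_cancel₀ (hk0 x hx) ?_
    linear_combination k x * h - dd b k x * eA x hx + dd a k x * eB x hx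
  have kx := hk0 x hx
  rw [← sub_eq_zero]
  apply (F.block hx).eq_zero
  · rw [pinner_sub_left, pinner_smul_left, F.parallelVec_Y _ hx]
    field_simp
    ring
  · rw [pinner_sub_left, pinner_smul_left, F.parallelVec_N _ hx]
    rw [F.ab_eq x hx, pinner_add_right, pinner_smul_right, pinner_smul_right, h1 x hx,
      h2 x hx] at eAB
    field_simp
    linear_combination 2 * eAB
  · rw [pinner_sub_left, pinner_smul_left, F.parallelVec_A _ hx]
    field_simp
    linear_combination eA x hx
  · rw [pinner_sub_left, pinner_smul_left, parallelVec_swap hk _ hx, F.swap.parallelVec_A _ hx]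
    field_simp
    linear_combination eB x hx
  · rw [pinner_sub_left, pinner_smul_left, F.parallelVec_E _ hx, hv x hx]
    ring

end NullFrame

/-! ### Null frames and the Willmore density -/

theorem IsBlockFrame.mem_span {a b c d e : Fin 5 → ℝ} (h : IsBlockFrame a b c d e)
    {w : Fin 5 → ℝ} (hw : ⟪e, w⟫ = 0) : w ∈ Submodule.span ℝ (Set.range ![a, b, c, d]) := by
  have hmem : w ∈ Submodule.span ℝ (Set.range (Fin.cons e ![a, b, c, d] : Fin 5 → Fin 5 → ℝ)) := by
    rw [h.span_eq_top]; trivial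
  rw [Fin.range_cons, Submodule.mem_span_insert] at hmem
  obtain ⟨t, z, hz, rfl⟩ := hmem
  have hle : Submodule.span ℝ (Set.range ![a, b, c, d])
      ≤ LinearMap.ker (pinnerL 5 2 e) := by
    rw [Submodule.span_le]
    rintro _ ⟨i, rfl⟩
    fin_cases i <;> simp [h.ea, h.eb, h.ec, h.ed]
  have hz0 : ⟪e, z⟫ = 0 := by simpa using hle hz
  rw [pinner_add_right, pinner_smul_right, h.ee, hz0] at hw
  have ht : t = 0 := by linarith
  simpa [ht] using hz

/-- An indefinite quadratic form in two variables has a null basis. -/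
theorem exists_null_basis {p q r : ℝ} (h : p * r - q ^ 2 < 0) : ∃ a b c d : ℝ,
    p * a ^ 2 + 2 * q * (a * b) + r * b ^ 2 = 0 ∧ p * c ^ 2 + 2 * q * (c * d) + r * d ^ 2 = 0 ∧
      p * (a * c) + q * (a * d + b * c) + r * (b * d) = 1 / 2 := by
  by_cases hp : p = 0
  · subst hp
    have hq : q ≠ 0 := by
      rintro rfl
      simp at h
    -- The first basis vector is already null. The pairing condition forces `d = 1 / (2 q)`, and
    -- nullity then fixes `c`.
    refine ⟨1, 0, -r / (4 * q ^ 2), 1 / (2 * q), by ring, ?_, ?_⟩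
    · field_simp
      ring
    · field_simp
      ring
  · obtain ⟨s, hs, hs2⟩ : ∃ s : ℝ, s ≠ 0 ∧ s ^ 2 = q ^ 2 - p * r :=
      ⟨√(q ^ 2 - p * r), (Real.sqrt_pos.2 (by linarith)).ne', Real.sq_sqrt (by linarith)⟩
    have hr : r = (q ^ 2 - s ^ 2) / p := by
      field_simp
      linarith
    subst hr
    -- The null directions are `(-q ± s, p)`. Their mutual product is `-2 p s²`, whence the scaling
    -- factor.
    refine ⟨-q + s, p, (-q - s) / (-4 * p * s ^ 2), p / (-4 * p * s ^ 2), ?_, ?_, ?_⟩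
    · field_simp
      ring
    · field_simp
      ring
    · field_simp
      ring

/-- The Willmore density in terms of the first and the second fundamental form. -/
def wDensity (g₁₁ g₁₂ g₂₂ h₁₁ h₁₂ h₂₂ : ℝ) : ℝ :=
  (h₁₁ * h₂₂ - h₁₂ ^ 2 + (g₂₂ * h₁₁ - 2 * g₁₂ * h₁₂ + g₁₁ * h₂₂) ^ 2
    / (4 * (g₁₂ ^ 2 - g₁₁ * g₂₂))) / √(g₁₂ ^ 2 - g₁₁ * g₂₂)

/-- In a null basis with determinant `P`, the product of the two diagonal entries of `h` is its
determinant plus the square of the mixed entry, which is the trace term. In the coordinate basis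
this reads `P² (det h + tr² / (4 D))`, and `√D |P| = 1 / 2` converts the area factor. -/
theorem wDensity_eq {g₁₁ g₁₂ g₂₂ a b c d : ℝ} (h₁₁ h₁₂ h₂₂ : ℝ)
    (h : g₁₁ * g₂₂ - g₁₂ ^ 2 < 0)
    (e1 : g₁₁ * a ^ 2 + 2 * g₁₂ * (a * b) + g₂₂ * b ^ 2 = 0)
    (e2 : g₁₁ * c ^ 2 + 2 * g₁₂ * (c * d) + g₂₂ * d ^ 2 = 0)
    (e3 : g₁₁ * (a * c) + g₁₂ * (a * d + b * c) + g₂₂ * (b * d) = 1 / 2) :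
    2 * ((h₁₁ * a ^ 2 + 2 * h₁₂ * (a * b) + h₂₂ * b ^ 2)
      * (h₁₁ * c ^ 2 + 2 * h₁₂ * (c * d) + h₂₂ * d ^ 2)) / |a * d - b * c|
      = wDensity g₁₁ g₁₂ g₂₂ h₁₁ h₁₂ h₂₂ := by
  set P := a * d - b * c with hP
  set D := g₁₂ ^ 2 - g₁₁ * g₂₂ with hD
  have hD0 : 0 < D := by rw [hD]; linarith
  -- `f1`, `f2`, `f3` invert the change of basis: the coordinate vectors in terms of the null basis
  -- recover the metric.
  have f1 : g₁₁ * P ^ 2 = -(b * d) := by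
    rw [hP]
    linear_combination d ^ 2 * e1 - 2 * b * d * e3 + b ^ 2 * e2
  have f2 : g₂₂ * P ^ 2 = -(a * c) := by
    rw [hP]
    linear_combination c ^ 2 * e1 - 2 * a * c * e3 + a ^ 2 * e2
  have f3 : g₁₂ * P ^ 2 = 1 / 2 * (a * d + b * c) := by
    rw [hP]
    linear_combination -c * d * e1 + (a * d + b * c) * e3 - a * b * e2
  have f4' : D * P ^ 2 * P ^ 2 = 1 / 4 * P ^ 2 := by
    have : D * P ^ 2 * P ^ 2 = (g₁₂ * P ^ 2) ^ 2 - (g₁₁ * P ^ 2) * (g₂₂ * P ^ 2) := by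
      rw [hD]; ring
    rw [this, f1, f2, f3, hP]
    ring
  have hP0 : P ≠ 0 := by
    intro h0
    rw [h0] at f1 f2 f3
    have k1 : b * d = 0 := by linarith
    have k2 : a * c = 0 := by linarith
    have k3 : a * d + b * c = 0 := by linarith
    rw [k1, k2, k3] at e3
    norm_num at e3
  have f4 : D * P ^ 2 = 1 / 4 := mul_right_cancel₀ (pow_ne_zero 2 hP0) f4'
  have hsq : √D * |P| = 1 / 2 := by
    rw [← Real.sqrt_sq_eq_abs, ← Real.sqrt_mul hD0.le, f4]
    rw [show (1 / 4 : ℝ) = (1 / 2) ^ 2 by norm_num]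
    exact Real.sqrt_sq (by norm_num)
  have hsD : √D ≠ 0 := (Real.sqrt_pos.2 hD0).ne'
  have habs : |P| ≠ 0 := abs_ne_zero.2 hP0
  have htr : (g₂₂ * h₁₁ - 2 * g₁₂ * h₁₂ + g₁₁ * h₂₂) * P ^ 2
      = -(h₁₁ * (a * c) + h₁₂ * (a * d + b * c) + h₂₂ * (b * d)) := by
    linear_combination h₁₁ * f2 - 2 * h₁₂ * f3 + h₂₂ * f1
  have habs2 : |P| ^ 2 = P ^ 2 := sq_abs P
  unfold wDensity
  rw [← hD, div_eq_div_iff habs hsD]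
  have hnum : (h₁₁ * h₂₂ - h₁₂ ^ 2
      + (g₂₂ * h₁₁ - 2 * g₁₂ * h₁₂ + g₁₁ * h₂₂) ^ 2 / (4 * D)) * P ^ 2
      = (h₁₁ * a ^ 2 + 2 * h₁₂ * (a * b) + h₂₂ * b ^ 2)
      * (h₁₁ * c ^ 2 + 2 * h₁₂ * (c * d) + h₂₂ * d ^ 2) := by
    have hDP : (g₂₂ * h₁₁ - 2 * g₁₂ * h₁₂ + g₁₁ * h₂₂) ^ 2 / (4 * D)
        = ((g₂₂ * h₁₁ - 2 * g₁₂ * h₁₂ + g₁₁ * h₂₂) * P ^ 2) ^ 2 / P ^ 2 := by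
      rw [div_eq_div_iff (by positivity) (pow_ne_zero 2 hP0)]
      linear_combination -(4 * P ^ 2 * (g₂₂ * h₁₁ - 2 * g₁₂ * h₁₂ + g₁₁ * h₂₂) ^ 2) * f4
    rw [hDP, htr, add_mul, div_mul_cancel₀ _ (pow_ne_zero 2 hP0), hP]
    ring
  have hs2 : √D = 1 / 2 * |P| / P ^ 2 := by
    rw [eq_div_iff (pow_ne_zero 2 hP0), ← habs2]
    linear_combination |P| * hsq
  rw [← hnum, hs2]
  field_simp

/-- The Willmore density of a lift at a point, computed with any unit vector `n` that is normal
to the lift and its derivatives. -/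
theorem exists_hopfPair {O : Set E2} {Z : E2 → Fin 5 → ℝ} {x : E2} (hZ : Sm O Z)
    (hnull : ∀ x ∈ O, ⟪Z x, Z x⟫ = 0) (hx : x ∈ O) (hdet : metricDet 2 Z x < 0)
    {n : Fin 5 → ℝ} (nn : ⟪n, n⟫ = 1) (nZ : ⟪n, Z x⟫ = 0) (n1 : ⟪n, dd ex Z x⟫ = 0)
    (n2 : ⟪n, dd ey Z x⟫ = 0) :
    ∃ (ξ η : E2) (κ₁ κ₂ : Fin 5 → ℝ), IsHopfPair Z x ξ η κ₁ κ₂ ∧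
      2 * ⟪κ₁, κ₂⟫ / |ξ 0 * η 1 - ξ 1 * η 0|
        = wDensity ⟪dd ex Z x, dd ex Z x⟫ ⟪dd ex Z x, dd ey Z x⟫ ⟪dd ey Z x, dd ey Z x⟫
          ⟪n, dd ex (dd ex Z) x⟫ ⟪n, dd ey (dd ex Z) x⟫ ⟪n, dd ey (dd ey Z) x⟫ := by
  change ⟪dd ex Z x, dd ex Z x⟫ * ⟪dd ey Z x, dd ey Z x⟫ - ⟪dd ex Z x, dd ey Z x⟫ ^ 2 < 0 at hdet
  obtain ⟨a, b, c, d, e1, e2, e3⟩ := exists_null_basis hdet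
  set ξ : E2 := a • ex + b • ey with hξ
  set η : E2 := c • ex + d • ey with hη
  have hξ0 : ξ 0 = a := by simp [hξ, ex, ey]
  have hξ1 : ξ 1 = b := by simp [hξ, ex, ey]
  have hη0 : η 0 = c := by simp [hη, ex, ey]
  have hη1 : η 1 = d := by simp [hη, ex, ey]
  have one : ∀ (p q : ℝ), dd (p • ex + q • ey) Z = fun x => p • dd ex Z x + q • dd ey Z x := by
    intro p q
    funext z
    rw [dd_dir_add, dd_dir_smul, dd_dir_smul]
  have two : ∀ (p q r s : ℝ), dd (r • ex + s • ey) (dd (p • ex + q • ey) Z) x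
      = (p * r) • dd ex (dd ex Z) x + (p * s + q * r) • dd ey (dd ex Z) x
        + (q * s) • dd ey (dd ey Z) x := by
    intro p q r s
    rw [one, dd_add ((hZ.dd.const_smul p).diff hx) ((hZ.dd.const_smul q).diff hx),
      dd_const_smul (hZ.dd.diff hx), dd_const_smul (hZ.dd.diff hx)]
    simp only [dd_dir_add, dd_dir_smul]
    rw [dd_comm (ξ := ex) (η := ey) hZ hx]
    module
  have YD : ∀ ζ, ∀ x ∈ O, ⟪Z x, dd ζ Z x⟫ = 0 := fun ζ x hx => by
    have := dd_pinner_eq_zero (ξ := ζ) hZ hZ hnull hx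
    rw [pinner_comm (dd ζ Z x)] at this
    linarith
  have YDD : ∀ ζ ζ', ⟪Z x, dd ζ' (dd ζ Z) x⟫ = -⟪dd ζ' Z x, dd ζ Z x⟫ := fun ζ ζ' => by
    have := dd_pinner_eq_zero (ξ := ζ') hZ hZ.dd (YD ζ) hx
    linarith
  have g1 : ⟪dd ξ Z x, dd ξ Z x⟫ = 0 := by
    rw [hξ, one]
    simp only [pinner_add_left, pinner_add_right, pinner_smul_left, pinner_smul_right,
      pinner_comm (dd ey Z x) (dd ex Z x)]
    linear_combination e1
  have g2 : ⟪dd η Z x, dd η Z x⟫ = 0 := by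
    rw [hη, one]
    simp only [pinner_add_left, pinner_add_right, pinner_smul_left, pinner_smul_right,
      pinner_comm (dd ey Z x) (dd ex Z x)]
    linear_combination e2
  have g3 : ⟪dd ξ Z x, dd η Z x⟫ = 1 / 2 := by
    rw [hη, hξ, one, one]
    simp only [pinner_add_left, pinner_add_right, pinner_smul_left, pinner_smul_right,
      pinner_comm (dd ey Z x) (dd ex Z x)]
    linear_combination e3
  have n3 : ∀ p q, ⟪n, dd (p • ex + q • ey) Z x⟫ = 0 := fun p q => by
    rw [one, pinner_add_right, pinner_smul_right, pinner_smul_right, n1, n2]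
    ring
  set W := dd η (dd ξ Z) x with hW
  -- As `⟪Z, W⟫ = -1 / 2`, this multiple of `Z` makes `n'` orthogonal to all of `V`. It keeps the
  -- length of `n` and, `ξ` and `η` being null, also the pairings with `Z_ξξ` and `Z_ηη`. Hence any
  -- unit normal computes the density.
  set n' : Fin 5 → ℝ := n + (2 * ⟪n, W⟫) • Z x with hn'
  have ZW : ⟪Z x, W⟫ = -1 / 2 := by
    rw [hW, YDD, pinner_comm, g3]; norm_num
  have hframe : IsBlockFrame (Z x) W (dd ξ Z x) (dd η Z x) n' := by
    refine ⟨hnull x hx, by rw [ZW]; norm_num, YD _ x hx, YD _ x hx, by rw [g1, g3]; norm_num,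
      ?_, ?_, ?_, ?_, ?_⟩
    · simp only [hn', pinner_add_left, pinner_add_right, pinner_smul_left, pinner_smul_right,
        pinner_comm (Z x) n, nZ, nn, hnull x hx]
      ring
    · simp only [hn', pinner_add_left, pinner_smul_left, nZ, hnull x hx]
      ring
    · rw [hn', pinner_add_left, pinner_smul_left, ZW]
      ring
    · rw [hn', pinner_add_left, pinner_smul_left, YD _ x hx, hξ, n3]
      ring
    · rw [hn', pinner_add_left, pinner_smul_left, YD _ x hx, hη, n3]
      ring
  have hspan : Submodule.span ℝ (Set.range ![Z x, W, dd ξ Z x, dd η Z x])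
      = gaussSpace Z x ξ η := by
    unfold gaussSpace
    congr 1
    ext z
    simp only [Set.mem_range, Fin.exists_fin_succ, Matrix.cons_val_zero, Matrix.cons_val_succ,
      IsEmpty.exists_iff, Set.mem_insert_iff, Set.mem_singleton_iff, or_false]
    change (Z x = z ∨ W = z ∨ dd ξ Z x = z ∨ dd η Z x = z)
      ↔ (z = Z x ∨ z = dd ξ Z x ∨ z = dd η Z x ∨ z = W)
    rw [eq_comm (a := Z x), eq_comm (a := W), eq_comm (a := dd ξ Z x), eq_comm (a := dd η Z x)]
    tauto
  have horth : ∀ r : ℝ, ∀ v ∈ gaussSpace Z x ξ η, ⟪r • n', v⟫ = 0 := by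
    intro r v hv
    have hle : gaussSpace Z x ξ η ≤ LinearMap.ker (pinnerL 5 2 n') := by
      rw [← hspan, Submodule.span_le]
      rintro _ ⟨i, rfl⟩
      fin_cases i <;> simp [hframe.ea, hframe.eb, hframe.ec, hframe.ed]
    have : ⟪n', v⟫ = 0 := by simpa using hle hv
    rw [pinner_smul_left, this, mul_zero]
  have hmem : ∀ ζ, ⟪dd ζ Z x, dd ζ Z x⟫ = 0 →
      dd ζ (dd ζ Z) x - ⟪n, dd ζ (dd ζ Z) x⟫ • n' ∈ gaussSpace Z x ξ η := by
    intro ζ hζ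
    rw [← hspan]
    apply hframe.mem_span
    rw [pinner_sub_right, pinner_smul_right, hframe.ee, hn', pinner_add_left, pinner_smul_left,
      YDD, hζ]
    ring
  refine ⟨ξ, η, ⟪n, dd ξ (dd ξ Z) x⟫ • n', ⟪n, dd η (dd η Z) x⟫ • n',
    ⟨g1, g2, g3, horth _, horth _, hmem ξ g1, hmem η g2⟩, ?_⟩
  rw [hξ0, hξ1, hη0, hη1, pinner_smul_left, pinner_smul_right, hframe.ee,
    ← wDensity_eq _ _ _ hdet e1 e2 e3, hξ, hη, two, two]
  simp only [pinner_add_right, pinner_smul_right]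
  congr 1
  ring

/-! ### Normal variations -/

section Slices

variable {F : Type*} [NormedAddCommGroup F] [NormedSpace ℝ F] {I : Set ℝ} {O : Set E2}
  {Φ : ℝ × E2 → F} {f : E2 → F} {t : ℝ} {x : E2}

theorem Sm.comp_snd (hI : IsOpen I) (hf : Sm O f) : Sm (I ×ˢ O) (fun p => f p.2) :=
  ⟨hI.prod hf.isOpen, hf.cd.comp contDiff_snd.contDiffOn fun _ hp => hp.2⟩

theorem dd_slice (hΦ : Sm (I ×ˢ O) Φ) (ht : t ∈ I) (hx : x ∈ O) (ξ : E2) :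
    dd ξ (fun z => Φ (t, z)) x = dd (0, ξ) Φ (t, x) := by
  have h : HasFDerivAt (fun z : E2 => (t, z)) (ContinuousLinearMap.inr ℝ ℝ E2) x :=
    hasFDerivAt_prodMk_right t x
  have h2 := ((hΦ.diff (x := (t, x)) ⟨ht, hx⟩).hasFDerivAt.comp x h).fderiv
  unfold dd
  rw [show (fun z => Φ (t, z)) = Φ ∘ fun z : E2 => (t, z) from rfl, h2]
  rfl

theorem Sm.slice (hΦ : Sm (I ×ˢ O) Φ) (hO : IsOpen O) (ht : t ∈ I) : Sm O (fun z => Φ (t, z)) :=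
  ⟨hO, hΦ.cd.comp (contDiff_prodMk_right t).contDiffOn fun _ hz => ⟨ht, hz⟩⟩

theorem dd_dd_slice (hΦ : Sm (I ×ˢ O) Φ) (hO : IsOpen O) (ht : t ∈ I) (hx : x ∈ O) (ξ η : E2) :
    dd η (dd ξ (fun z => Φ (t, z))) x = dd (0, η) (dd (0, ξ) Φ) (t, x) := by
  rw [dd_congr hO (fun z hz => dd_slice hΦ ht hz ξ) hx, dd_slice hΦ.dd ht hx]

theorem hasDerivAt_slice (hΦ : Sm (I ×ˢ O) Φ) (ht : t ∈ I) (hx : x ∈ O) :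
    HasDerivAt (fun s => Φ (s, x)) (dd (1, 0) Φ (t, x)) t := by
  have h : HasFDerivAt (fun s : ℝ => (s, x)) (ContinuousLinearMap.inl ℝ ℝ E2) t :=
    hasFDerivAt_prodMk_left t x
  have h2 := ((hΦ.diff (x := (t, x)) ⟨ht, hx⟩).hasFDerivAt.comp t h).hasDerivAt
  simpa [dd, Function.comp_def] using h2

end Slices

/-- Differentiation under the integral over a compact set. -/
theorem hasDerivAt_setIntegral {O K : Set E2} {ε : ℝ} (hε : 0 < ε) {w : ℝ × E2 → ℝ}
    (hw : Sm (Set.Ioo (-ε) ε ×ˢ O) w) (hO : IsOpen O) (hK : IsCompact K) (hKO : K ⊆ O) :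
    HasDerivAt (fun t => ∫ x in K, w (t, x)) (∫ x in K, dd (1, 0) w (0, x)) 0 := by
  have hsub : Set.Icc (-(ε / 2)) (ε / 2) ⊆ Set.Ioo (-ε) ε := fun t ht =>
    ⟨by linarith [ht.1], by linarith [ht.2]⟩
  have hcomp : IsCompact (Set.Icc (-(ε / 2)) (ε / 2) ×ˢ K) := isCompact_Icc.prod hK
  have h0 : (0 : ℝ) ∈ Set.Ioo (-ε) ε := ⟨by linarith, hε⟩
  obtain ⟨C, hC⟩ := hcomp.exists_bound_of_continuousOn
    ((hw.dd (ξ := ((1 : ℝ), (0 : E2)))).continuousOn.mono (Set.prod_mono hsub hKO))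
  have hcont : ∀ t ∈ Set.Ioo (-ε) ε, ContinuousOn (fun x => w (t, x)) K := fun t ht =>
    (hw.slice hO ht).continuousOn.mono hKO
  refine (hasDerivAt_integral_of_dominated_loc_of_deriv_le (μ := volume.restrict K)
    (F := fun t x => w (t, x)) (F' := fun t x => dd (1, 0) w (t, x))
    (s := Set.Ioo (-(ε / 2)) (ε / 2)) (bound := fun _ => C)
    (Ioo_mem_nhds (by linarith) (by linarith)) ?_ ?_ ?_ ?_ ?_ ?_).2
  · filter_upwards [Ioo_mem_nhds (show -ε < 0 by linarith) hε] with t ht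
    exact (hcont t ht).aestronglyMeasurable hK.measurableSet
  · exact (hcont 0 h0).integrableOn_compact hK
  · exact ((hw.dd.slice hO h0).continuousOn.mono hKO).aestronglyMeasurable hK.measurableSet
  · filter_upwards [ae_restrict_mem hK.measurableSet] with x hx t ht
    exact hC (t, x) ⟨⟨ht.1.le, ht.2.le⟩, hx⟩
  · exact continuousOn_const.integrableOn_compact hK
  · filter_upwards [ae_restrict_mem hK.measurableSet] with x hx t ht
    exact hasDerivAt_slice hw (hsub ⟨ht.1.le, ht.2.le⟩) (hKO hx)

/-- The normal variation `Y + t f E + t² f² / 2 N`. -/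
def variation (Y N E : E2 → Fin 5 → ℝ) (f : E2 → ℝ) (p : ℝ × E2) : Fin 5 → ℝ :=
  Y p.2 + ((p.1 * f p.2) • E p.2 + (p.1 ^ 2 * (f p.2 ^ 2 / 2)) • N p.2)

/-- A normal vector of the variation. -/
def variationNormal (Y N E : E2 → Fin 5 → ℝ) (f : E2 → ℝ) (a b : E2) (p : ℝ × E2) : Fin 5 → ℝ :=
  cross (variation Y N E f p) (N p.2) (dd (0, a) (variation Y N E f) p)
    (dd (0, b) (variation Y N E f) p)

/-- The coefficients of the metric of a family of surfaces. -/
def metricCoeff (Z : ℝ × E2 → Fin 5 → ℝ) (a b : E2) (p : ℝ × E2) : ℝ :=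
  ⟪dd (0, a) Z p, dd (0, b) Z p⟫

/-- The negative of the determinant of the metric. -/
def negDet (Z : ℝ × E2 → Fin 5 → ℝ) (a b : E2) (p : ℝ × E2) : ℝ :=
  metricCoeff Z a b p * metricCoeff Z a b p - metricCoeff Z a a p * metricCoeff Z b b p

/-- The coefficients of the second fundamental form with respect to `variationNormal`. -/
def secondCoeff (Y N E : E2 → Fin 5 → ℝ) (f : E2 → ℝ) (a b ξ η : E2) (p : ℝ × E2) : ℝ :=
  ⟪variationNormal Y N E f a b p, dd (0, η) (dd (0, ξ) (variation Y N E f)) p⟫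

/-- The trace of the second fundamental form, up to the determinant of the metric. -/
def secondTrace (Y N E : E2 → Fin 5 → ℝ) (f : E2 → ℝ) (a b : E2) (p : ℝ × E2) : ℝ :=
  metricCoeff (variation Y N E f) b b p * secondCoeff Y N E f a b a a p
    - 2 * (metricCoeff (variation Y N E f) a b p * secondCoeff Y N E f a b a b p)
    + metricCoeff (variation Y N E f) a a p * secondCoeff Y N E f a b b b p

/-- The Willmore density of the variation. -/
def variationDensity (Y N E : E2 → Fin 5 → ℝ) (f : E2 → ℝ) (a b : E2) (p : ℝ × E2) : ℝ :=
  (secondCoeff Y N E f a b a a p * secondCoeff Y N E f a b b b p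
      - secondCoeff Y N E f a b a b p * secondCoeff Y N E f a b a b p
      + secondTrace Y N E f a b p * secondTrace Y N E f a b p
        / (4 * negDet (variation Y N E f) a b p))
    / (negDet (variation Y N E f) a b p * √(negDet (variation Y N E f) a b p))

namespace NullFrame

variable {O : Set E2} {Y N E : E2 → Fin 5 → ℝ} {a b x : E2} {f : E2 → ℝ} {I : Set ℝ} {t : ℝ}

theorem smVariation (F : NullFrame O Y N E a b) (hf : Sm O f) (hI : IsOpen I) :
    Sm (I ×ˢ O) (variation Y N E f) := by
  have h1 : Sm (I ×ˢ O) (fun p => p.1) := ⟨hI.prod F.isOpen, contDiff_fst.contDiffOn⟩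
  have hf' := Sm.comp_snd hI hf
  have h2 : Sm (I ×ˢ O) (fun p => p.1 ^ 2 * (f p.2 ^ 2 / 2)) :=
    ((h1.pow 2).mul ((hf'.pow 2).const_mul (1 / 2))).congr fun p _ => by ring
  exact (Sm.comp_snd hI F.smY).add (((h1.mul hf').smul (Sm.comp_snd hI F.smE)).add
    (h2.smul (Sm.comp_snd hI F.smN)))

theorem smMetric (F : NullFrame O Y N E a b) (hf : Sm O f) (hI : IsOpen I) (ξ η : E2) :
    Sm (I ×ˢ O) (metricCoeff (variation Y N E f) ξ η) :=
  (F.smVariation hf hI).dd.pinner (F.smVariation hf hI).dd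

theorem smNegDet (F : NullFrame O Y N E a b) (hf : Sm O f) (hI : IsOpen I) (ξ η : E2) :
    Sm (I ×ˢ O) (negDet (variation Y N E f) ξ η) :=
  ((F.smMetric hf hI _ _).mul (F.smMetric hf hI _ _)).sub
    ((F.smMetric hf hI _ _).mul (F.smMetric hf hI _ _))

theorem smNormal (F : NullFrame O Y N E a b) (hf : Sm O f) (hI : IsOpen I) :
    Sm (I ×ˢ O) (variationNormal Y N E f a b) :=
  Sm.cross (F.smVariation hf hI) (Sm.comp_snd hI F.smN) (F.smVariation hf hI).dd
    (F.smVariation hf hI).dd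

theorem smSecond (F : NullFrame O Y N E a b) (hf : Sm O f) (hI : IsOpen I) (ξ η : E2) :
    Sm (I ×ˢ O) (secondCoeff Y N E f a b ξ η) :=
  (F.smNormal hf hI).pinner (F.smVariation hf hI).dd.dd

theorem smTrace (F : NullFrame O Y N E a b) (hf : Sm O f) (hI : IsOpen I) :
    Sm (I ×ˢ O) (secondTrace Y N E f a b) :=
  ((((F.smMetric hf hI _ _).mul (F.smSecond hf hI _ _)).sub
    (((F.smMetric hf hI _ _).mul (F.smSecond hf hI _ _)).const_mul 2))).add
    ((F.smMetric hf hI _ _).mul (F.smSecond hf hI _ _))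

theorem smTraceTerm (F : NullFrame O Y N E a b) (hf : Sm O f) (hI : IsOpen I)
    (hD : ∀ p ∈ I ×ˢ O, 0 < negDet (variation Y N E f) a b p) :
    Sm (I ×ˢ O) (fun p => secondTrace Y N E f a b p * secondTrace Y N E f a b p
        / (4 * negDet (variation Y N E f) a b p)) :=
  ((F.smTrace hf hI).mul (F.smTrace hf hI)).div ((F.smNegDet hf hI a b).const_mul 4)
    fun p hp => (mul_pos (by norm_num) (hD p hp)).ne'

theorem smNum (F : NullFrame O Y N E a b) (hf : Sm O f) (hI : IsOpen I)
    (hD : ∀ p ∈ I ×ˢ O, 0 < negDet (variation Y N E f) a b p) :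
    Sm (I ×ˢ O) (fun p => secondCoeff Y N E f a b a a p * secondCoeff Y N E f a b b b p
      - secondCoeff Y N E f a b a b p * secondCoeff Y N E f a b a b p
      + secondTrace Y N E f a b p * secondTrace Y N E f a b p
        / (4 * negDet (variation Y N E f) a b p)) :=
  (((F.smSecond hf hI _ _).mul (F.smSecond hf hI _ _)).sub
    ((F.smSecond hf hI _ _).mul (F.smSecond hf hI _ _))).add (F.smTraceTerm hf hI hD)

theorem smSqrt (F : NullFrame O Y N E a b) (hf : Sm O f) (hI : IsOpen I)
    (hD : ∀ p ∈ I ×ˢ O, 0 < negDet (variation Y N E f) a b p) :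
    Sm (I ×ˢ O) (fun p => √(negDet (variation Y N E f) a b p)) :=
  (F.smNegDet hf hI a b).sqrt fun p hp => (hD p hp).ne'

theorem smDensity (F : NullFrame O Y N E a b) (hf : Sm O f) (hI : IsOpen I)
    (hD : ∀ p ∈ I ×ˢ O, 0 < negDet (variation Y N E f) a b p) :
    Sm (I ×ˢ O) (variationDensity Y N E f a b) :=
  (F.smNum hf hI hD).div ((F.smNegDet hf hI a b).mul (F.smSqrt hf hI hD))
    fun p hp => (mul_pos (hD p hp) (Real.sqrt_pos.2 (hD p hp))).ne'

/-- The quadratic term in `N` compensates `⟪t f E, t f E⟫ = t² f²`, because `⟪Y, N⟫ = -1`. -/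
theorem variation_null (F : NullFrame O Y N E a b) (hx : x ∈ O) :
    ⟪variation Y N E f (t, x), variation Y N E f (t, x)⟫ = 0 := by
  simp only [variation, pinner_add_left, pinner_add_right, pinner_smul_left, pinner_smul_right,
    F.YY x hx, F.EE x hx, F.EY x hx, F.EN x hx, F.YN x hx, F.NN x hx, pinner_comm (Y x) (E x),
    pinner_comm (N x) (Y x), pinner_comm (N x) (E x)]
  ring

/-- Keeps the varied lift nonzero, and makes `Z, N, Z_a, Z_b` a block Gram system, so that the cross
product has an explicit length. -/
theorem variation_N (F : NullFrame O Y N E a b) (hx : x ∈ O) :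
    ⟪variation Y N E f (t, x), N x⟫ = -1 := by
  simp only [variation, pinner_add_left, pinner_smul_left, F.EN x hx, F.YN x hx, F.NN x hx]
  ring

theorem variation_zero : (fun z => variation Y N E f (0, z)) = Y := by
  funext z
  simp [variation]

theorem variation_dd_null (F : NullFrame O Y N E a b) (hf : Sm O f) (hI : IsOpen I)
    (ht : t ∈ I) (hx : x ∈ O) (ξ : E2) :
    ⟪variation Y N E f (t, x), dd (0, ξ) (variation Y N E f) (t, x)⟫ = 0 := by
  have sv := F.smVariation hf hI
  have h := dd_pinner_eq_zero (ξ := ((0 : ℝ), ξ)) sv sv (r := 0)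
    (fun p hp => F.variation_null (t := p.1) hp.2) (x := (t, x)) ⟨ht, hx⟩
  rw [pinner_comm (dd _ _ _)] at h
  linarith

/-- The length of the normal vector of the variation. -/
theorem normal_self (F : NullFrame O Y N E a b) (hf : Sm O f) (hI : IsOpen I) {p : ℝ × E2}
    (hp : p ∈ I ×ˢ O) (hD : 0 < negDet (variation Y N E f) a b p) :
    ⟪variationNormal Y N E f a b p, variationNormal Y N E f a b p⟫
      = negDet (variation Y N E f) a b p := by
  obtain ⟨t, x⟩ := p
  unfold negDet metricCoeff at hD ⊢
  unfold variationNormal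
  rw [pinner_cross_self (F.variation_null hp.2) (by rw [F.variation_N hp.2]; norm_num)
    (F.variation_dd_null hf hI hp.1 hp.2 a) (F.variation_dd_null hf hI hp.1 hp.2 b)
    (by nlinarith), F.variation_N hp.2]
  ring

section AtZero

variable (F : NullFrame O Y N E a b) (hf : Sm O f)
include F hf

theorem dd_variation_zero (hx : x ∈ O) (ξ : E2) :
    dd (0, ξ) (variation Y N E f) (0, x) = dd ξ Y x := by
  rw [← dd_slice (F.smVariation hf isOpen_univ) (Set.mem_univ 0) hx, variation_zero]

theorem dd_dd_variation_zero (hx : x ∈ O) (ξ η : E2) :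
    dd (0, η) (dd (0, ξ) (variation Y N E f)) (0, x) = dd η (dd ξ Y) x := by
  rw [← dd_dd_slice (F.smVariation hf isOpen_univ) F.isOpen (Set.mem_univ 0) hx, variation_zero]

theorem dt_variation (hx : x ∈ O) :
    dd (1, 0) (variation Y N E f) (0, x) = f x • E x := by
  have h1 := hasDerivAt_slice (F.smVariation hf isOpen_univ) (Set.mem_univ 0) hx
  have h2 : HasDerivAt (fun s => variation Y N E f (s, x)) (f x • E x) 0 := by
    have e1 : HasDerivAt (fun s : ℝ => (s * f x) • E x) ((1 * f x) • E x) 0 :=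
      ((hasDerivAt_id (0 : ℝ)).mul_const (f x)).smul_const (E x)
    have e2 : HasDerivAt (fun s : ℝ => (s ^ 2 * (f x ^ 2 / 2)) • N x)
        ((((2 : ℕ) : ℝ) * 0 ^ (2 - 1) * (f x ^ 2 / 2)) • N x) 0 :=
      ((hasDerivAt_pow 2 (0 : ℝ)).mul_const (f x ^ 2 / 2)).smul_const (N x)
    have e3 := (e1.add e2).const_add (Y x)
    simpa [variation] using e3
  exact h1.unique h2

/-- The time derivative is a directional derivative on `ℝ × E2`, so it commutes with the space
derivatives and may be taken first, where it is `f E`. -/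
theorem dt_dd_variation (hx : x ∈ O) (ξ : E2) :
    dd (1, 0) (dd (0, ξ) (variation Y N E f)) (0, x) = dd ξ (fun z => f z • E z) x := by
  have sv := F.smVariation hf isOpen_univ
  rw [dd_comm sv ⟨Set.mem_univ 0, hx⟩, ← dd_slice sv.dd (Set.mem_univ 0) hx]
  exact dd_congr F.isOpen (fun z hz => F.dt_variation hf hz) hx

theorem dt_dd_dd_variation (hx : x ∈ O) (ξ η : E2) :
    dd (1, 0) (dd (0, η) (dd (0, ξ) (variation Y N E f))) (0, x)
      = dd η (dd ξ (fun z => f z • E z)) x := by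
  have sv := F.smVariation hf isOpen_univ
  rw [dd_comm sv.dd ⟨Set.mem_univ 0, hx⟩, ← dd_slice sv.dd.dd (Set.mem_univ 0) hx]
  exact dd_congr F.isOpen (fun z hz => F.dt_dd_variation hf hz ξ) hx

theorem dd_fE (hx : x ∈ O) (ξ : E2) :
    dd ξ (fun z => f z • E z) x = f x • dd ξ E x + dd ξ f x • E x :=
  dd_smul (hf.diff hx) (F.smE.diff hx)

theorem E_dd_dd_fE (hx : x ∈ O) : ⟪E x, dd a (dd a (fun z => f z • E z)) x⟫ = dd a (dd a f) x := by
  -- It equals `-⟪E_a, E_a⟫`, and `E_a` lies in the isotropic span of `Y` and `Y_b`.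
  have hEE : ⟪E x, dd a (dd a E) x⟫ = 0 := by
    have h := dd_pinner_eq_zero (ξ := a) F.smE.dd F.smE F.EA_E hx
    have h2 : ⟪dd a E x, dd a E x⟫ = 0 := by
      nth_rewrite 2 [F.ea_eq x hx]
      rw [pinner_add_right, pinner_smul_right, pinner_smul_right, F.EA_Y x hx, F.EA_B x hx]
      ring
    rw [pinner_comm (E x)]
    linarith
  rw [dd_congr F.isOpen (fun z hz => F.dd_fE hf hz a) hx,
    dd_add ((hf.smul F.smE.dd).diff hx) ((hf.dd.smul F.smE).diff hx),
    dd_smul (hf.diff hx) (F.smE.dd.diff hx), dd_smul (hf.dd.diff hx) (F.smE.diff hx)]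
  simp only [pinner_add_right, pinner_smul_right, hEE, F.EE x hx, pinner_comm (E x) (dd a E x),
    F.EA_E x hx]
  ring

theorem negDet_zero (hx : x ∈ O) : negDet (variation Y N E f) a b (0, x) = 1 / 4 := by
  unfold negDet metricCoeff
  rw [F.dd_variation_zero hf hx, F.dd_variation_zero hf hx, F.AA x hx, F.AB x hx]
  norm_num

/-- The area is stationary to first order: the mixed coefficient does not change because `E_a ⟂ Y_b`
and `E_b ⟂ Y_a`, and the changes of the diagonal coefficients are multiplied by diagonal
coefficients that vanish at `t = 0`. -/
theorem dt_negDet (hx : x ∈ O) : dd (1, 0) (negDet (variation Y N E f) a b) (0, x) = 0 := by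
  have hp : ((0 : ℝ), x) ∈ (Set.univ : Set ℝ) ×ˢ O := ⟨Set.mem_univ 0, hx⟩
  have s := fun ξ η => F.smMetric hf isOpen_univ ξ η
  have sv := (F.smVariation hf isOpen_univ)
  have e1 : dd (1, 0) (metricCoeff (variation Y N E f) a b) (0, x) = 0 := by
    unfold metricCoeff
    rw [dd_pinner (sv.dd.diff hp) (sv.dd.diff hp), F.dt_dd_variation hf hx,
      F.dt_dd_variation hf hx, F.dd_variation_zero hf hx, F.dd_variation_zero hf hx,
      F.dd_fE hf hx, F.dd_fE hf hx]
    simp only [pinner_add_left, pinner_smul_left, pinner_comm (dd a Y x) _, F.EA x hx, F.EB x hx,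
      F.EA_B x hx, F.swap.EA_B x hx]
    ring
  have e2 : metricCoeff (variation Y N E f) a a (0, x) = 0 := by
    unfold metricCoeff
    rw [F.dd_variation_zero hf hx, F.AA x hx]
  have e3 : metricCoeff (variation Y N E f) b b (0, x) = 0 := by
    unfold metricCoeff
    rw [F.dd_variation_zero hf hx, F.BB x hx]
  unfold negDet
  rw [dd_sub (((s a b).mul (s a b)).diff hp) (((s a a).mul (s b b)).diff hp),
    dd_mul ((s a b).diff hp) ((s a b).diff hp), dd_mul ((s a a).diff hp) ((s b b).diff hp),
    e1, e2, e3]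
  ring

theorem normal_zero (hx : x ∈ O) : variationNormal Y N E f a b (0, x)
    = ⟪variationNormal Y N E f a b (0, x), E x⟫ • E x := by
  have hZ : variation Y N E f (0, x) = Y x := congrFun variation_zero x
  refine (F.block hx).eq_smul ?_ ?_ ?_ ?_ <;> unfold variationNormal
  · rw [← hZ, pinner_cross_fst]
  · rw [pinner_cross_snd]
  · rw [← F.dd_variation_zero hf hx a, pinner_cross_trd]
  · rw [← F.dd_variation_zero hf hx b, pinner_cross_fth]

/-- The cross product is `E / 2` up to sign. The sign is never needed, since the density is
quadratic in the normal. -/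
theorem normal_E_sq (hx : x ∈ O) : ⟪variationNormal Y N E f a b (0, x), E x⟫ ^ 2 = 1 / 4 := by
  have h := F.normal_self hf isOpen_univ (p := (0, x)) ⟨Set.mem_univ 0, hx⟩
    (by rw [F.negDet_zero hf hx]; norm_num)
  rw [F.negDet_zero hf hx, F.normal_zero hf hx] at h
  simp only [pinner_smul_left, pinner_smul_right, F.EE x hx] at h
  linarith

/-- Differentiate the orthogonality of the normal to the varied lift. This tilt towards `Y` produces
the Schwarzian term in the first variation. -/
theorem dt_normal_Y (hx : x ∈ O) : ⟪dd (1, 0) (variationNormal Y N E f a b) (0, x), Y x⟫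
    = -(⟪variationNormal Y N E f a b (0, x), E x⟫ * f x) := by
  have hZ : variation Y N E f (0, x) = Y x := congrFun variation_zero x
  have h := dd_pinner_eq_zero (ξ := ((1 : ℝ), (0 : E2))) (F.smNormal hf isOpen_univ)
    (F.smVariation hf isOpen_univ) (r := 0) (fun p _ => by
      unfold variationNormal; rw [pinner_cross_fst]) (x := (0, x)) ⟨Set.mem_univ 0, hx⟩
  rw [F.dt_variation hf hx, hZ, pinner_smul_right] at h
  linarith

/-- The squared length of the normal is `negDet`, stationary at `t = 0`, and the normal there is a
nonzero multiple of `E`. -/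
theorem dt_normal_E (hx : x ∈ O)
    (hD : ∀ p ∈ (Set.Ioo (-t) t) ×ˢ O, 0 < negDet (variation Y N E f) a b p) (ht : 0 < t) :
    ⟪dd (1, 0) (variationNormal Y N E f a b) (0, x), E x⟫ = 0 := by
  have hp : ((0 : ℝ), x) ∈ (Set.Ioo (-t) t) ×ˢ O := ⟨⟨by linarith, ht⟩, hx⟩
  have sn := F.smNormal hf (isOpen_Ioo (a := -t) (b := t))
  have h := dd_pinner_eq (ξ := ((1 : ℝ), (0 : E2))) sn sn
    (g := negDet (variation Y N E f) a b)
    (fun p hp => F.normal_self hf isOpen_Ioo hp (hD p hp)) hp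
  rw [F.dt_negDet hf hx, pinner_comm (variationNormal _ _ _ _ _ _ _), F.normal_zero hf hx,
    pinner_smul_right] at h
  have h2 := F.normal_E_sq hf hx
  have h3 : ⟪variationNormal Y N E f a b (0, x), E x⟫ ≠ 0 := by
    intro h0
    rw [h0] at h2
    norm_num at h2
  have h4 : ⟪variationNormal Y N E f a b (0, x), E x⟫
      * ⟪dd (1, 0) (variationNormal Y N E f a b) (0, x), E x⟫ = 0 := by linarith
  exact (mul_eq_zero.1 h4).resolve_left h3

theorem second_zero (hx : x ∈ O) (ξ η : E2) : secondCoeff Y N E f a b ξ η (0, x)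
    = ⟪variationNormal Y N E f a b (0, x), E x⟫ * ⟪E x, dd η (dd ξ Y) x⟫ := by
  unfold secondCoeff
  rw [F.dd_dd_variation_zero hf hx, F.normal_zero hf hx, pinner_smul_left, pinner_smul_left,
    F.EE x hx, mul_one]

theorem dt_second (hx : x ∈ O) (ξ η : E2) : dd (1, 0) (secondCoeff Y N E f a b ξ η) (0, x)
    = ⟪dd (1, 0) (variationNormal Y N E f a b) (0, x), dd η (dd ξ Y) x⟫
      + ⟪variationNormal Y N E f a b (0, x), E x⟫
        * ⟪E x, dd η (dd ξ (fun z => f z • E z)) x⟫ := by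
  have hp : ((0 : ℝ), x) ∈ (Set.univ : Set ℝ) ×ˢ O := ⟨Set.mem_univ 0, hx⟩
  unfold secondCoeff
  rw [dd_pinner ((F.smNormal hf isOpen_univ).diff hp)
    ((F.smVariation hf isOpen_univ).dd.dd.diff hp), F.dt_dd_dd_variation hf hx,
    F.dd_dd_variation_zero hf hx]
  congr 1
  nth_rewrite 1 [F.normal_zero hf hx]
  rw [pinner_smul_left]

/-- The first variation of the Willmore density. -/
theorem dt_density (hx : x ∈ O)
    (hD : ∀ p ∈ (Set.Ioo (-t) t) ×ˢ O, 0 < negDet (variation Y N E f) a b p) (ht : 0 < t) :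
    dd (1, 0) (variationDensity Y N E f a b) (0, x)
      = 2 * (hopf Y E a x * (dd b (dd b f) x + schwarz Y N b x * f x)
        + hopf Y E b x * (dd a (dd a f) x + schwarz Y N a x * f x)) := by
  have hI := isOpen_Ioo (a := -t) (b := t)
  have hp : ((0 : ℝ), x) ∈ (Set.Ioo (-t) t) ×ˢ O := ⟨⟨by linarith, ht⟩, hx⟩
  set μ := ⟪variationNormal Y N E f a b (0, x), E x⟫ with hμ
  have hμ2 : μ ^ 2 = 1 / 4 := F.normal_E_sq hf hx
  have nY := F.dt_normal_Y hf hx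
  have nE := F.dt_normal_E hf hx hD ht
  have aa0 : secondCoeff Y N E f a b a a (0, x) = μ * hopf Y E a x := by
    rw [F.second_zero hf hx, pinner_comm (E x)]; rfl
  have bb0 : secondCoeff Y N E f a b b b (0, x) = μ * hopf Y E b x := by
    rw [F.second_zero hf hx, pinner_comm (E x)]; rfl
  have ab0 : secondCoeff Y N E f a b a b (0, x) = 0 := by
    rw [F.second_zero hf hx, F.EAB x hx, mul_zero]
  have aa1 : dd (1, 0) (secondCoeff Y N E f a b a a) (0, x)
      = μ * (dd a (dd a f) x + schwarz Y N a x * f x) := by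
    rw [F.dt_second hf hx, F.E_dd_dd_fE hf hx, F.aa_eq x hx, pinner_add_right, pinner_smul_right,
      pinner_smul_right, nY, nE]
    ring
  have bb1 : dd (1, 0) (secondCoeff Y N E f a b b b) (0, x)
      = μ * (dd b (dd b f) x + schwarz Y N b x * f x) := by
    rw [F.dt_second hf hx, F.swap.E_dd_dd_fE hf hx, F.swap.aa_eq x hx, pinner_add_right,
      pinner_smul_right, pinner_smul_right, nY, nE]
    ring
  have D0 := F.negDet_zero hf hx
  have D1 := F.dt_negDet hf hx
  -- `E` is trace-free, so the squared trace contributes only to second order in `t`.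
  have T0 : secondTrace Y N E f a b (0, x) = 0 := by
    unfold secondTrace metricCoeff
    rw [F.dd_variation_zero hf hx, F.dd_variation_zero hf hx, F.AA x hx, F.BB x hx, ab0]
    ring
  have sD := F.smNegDet hf hI a b
  have sT := F.smTrace hf hI
  have sS := fun ξ η => F.smSecond hf hI ξ η
  have sU := F.smTraceTerm hf hI hD
  have sN := F.smNum hf hI hD
  have sR := F.smSqrt hf hI hD
  have sW := F.smDensity hf hI hD
  have U1 : dd (1, 0) (fun p => secondTrace Y N E f a b p * secondTrace Y N E f a b p
        / (4 * negDet (variation Y N E f) a b p)) (0, x) = 0 := by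
    have h : dd (1, 0) (fun p => (secondTrace Y N E f a b p * secondTrace Y N E f a b p
        / (4 * negDet (variation Y N E f) a b p)) * (4 * negDet (variation Y N E f) a b p)) (0, x)
        = dd (1, 0) (fun p => secondTrace Y N E f a b p * secondTrace Y N E f a b p) (0, x) :=
      dd_congr sD.isOpen (fun p hp => div_mul_cancel₀ _
        (mul_pos (by norm_num) (hD p hp)).ne') hp
    rw [dd_mul (sU.diff hp) ((sD.const_mul 4).diff hp), dd_const_mul (sD.diff hp), D0, D1,
      dd_mul (sT.diff hp) (sT.diff hp), T0] at h
    linarith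
  have R0 : √(negDet (variation Y N E f) a b (0, x)) = 1 / 2 := by
    rw [D0, show (1 / 4 : ℝ) = (1 / 2) ^ 2 by norm_num]
    exact Real.sqrt_sq (by norm_num)
  -- The derivatives of the root and of the quotients come from the product rule, applied after
  -- multiplying the square or the denominator back.
  have R1 : dd (1, 0) (fun p => √(negDet (variation Y N E f) a b p)) (0, x) = 0 := by
    have h : dd (1, 0) (fun p => √(negDet (variation Y N E f) a b p)
        * √(negDet (variation Y N E f) a b p)) (0, x)
        = dd (1, 0) (negDet (variation Y N E f) a b) (0, x) :=
      dd_congr sD.isOpen (fun p hp => Real.mul_self_sqrt (hD p hp).le) hp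
    rw [dd_mul (sR.diff hp) (sR.diff hp), R0, D1] at h
    linarith
  have h : dd (1, 0) (fun p => variationDensity Y N E f a b p
      * (negDet (variation Y N E f) a b p * √(negDet (variation Y N E f) a b p))) (0, x)
      = dd (1, 0) (fun p => secondCoeff Y N E f a b a a p * secondCoeff Y N E f a b b b p
      - secondCoeff Y N E f a b a b p * secondCoeff Y N E f a b a b p
      + secondTrace Y N E f a b p * secondTrace Y N E f a b p
        / (4 * negDet (variation Y N E f) a b p)) (0, x) :=
    dd_congr sD.isOpen (fun p hp => div_mul_cancel₀ _
      (mul_pos (hD p hp) (Real.sqrt_pos.2 (hD p hp))).ne') hp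
  rw [dd_mul (sW.diff hp) ((sD.mul sR).diff hp), dd_mul (sD.diff hp) (sR.diff hp), R0, R1, D0, D1,
    dd_add ((((sS a a).mul (sS b b)).sub ((sS a b).mul (sS a b))).diff hp) (sU.diff hp), U1,
    dd_sub (((sS a a).mul (sS b b)).diff hp) (((sS a b).mul (sS a b)).diff hp),
    dd_mul ((sS a a).diff hp) ((sS b b).diff hp), dd_mul ((sS a b).diff hp) ((sS a b).diff hp),
    aa0, bb0, ab0, aa1, bb1] at h
  -- The denominator `D √D` is `1 / 8` at `t = 0`, and `8 μ² = 2`.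
  linear_combination 8 * h + 8 * (hopf Y E a x * (dd b (dd b f) x + schwarz Y N b x * f x)
        + hopf Y E b x * (dd a (dd a f) x + schwarz Y N a x * f x)) * hμ2

end AtZero

end NullFrame

/-! ### The Euler-Lagrange equation -/

theorem integrable_mul_of_tsupport {O : Set E2} {g k : E2 → ℝ} (hg : Continuous g)
    (hc : HasCompactSupport g) (hs : tsupport g ⊆ O) (hk : ContinuousOn k O) :
    Integrable (fun x => k x * g x) := by
  have h : IntegrableOn (fun x => k x * g x) (tsupport g) :=
    ((hk.mono hs).mul hg.continuousOn).integrableOn_compact hc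
  refine (integrableOn_iff_integrable_of_support_subset fun x hx => ?_).1 h
  exact subset_tsupport g (right_ne_zero_of_mul hx)

theorem tsupport_dd_subset (f : E2 → ℝ) (ξ : E2) : tsupport (dd ξ f) ⊆ tsupport f :=
  tsupport_fderiv_apply_subset ℝ ξ

theorem contDiff_dd {f : E2 → ℝ} (hf : ContDiff ℝ ∞ f) (ξ : E2) : ContDiff ℝ ∞ (dd ξ f) :=
  (hf.fderiv_right (by simp)).clm_apply contDiff_const

theorem integral_mul_dd {O : Set E2} {g k : E2 → ℝ} (hg : ContDiff ℝ ∞ g)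
    (hc : HasCompactSupport g) (hs : tsupport g ⊆ O) (hk : Sm O k) (ξ : E2) :
    ∫ x, k x * dd ξ g x = -∫ x, dd ξ k x * g x := by
  have hs' := (tsupport_dd_subset g ξ).trans hs
  have hc' : HasCompactSupport (dd ξ g) :=
    hc.of_isClosed_subset (isClosed_tsupport _) (tsupport_dd_subset g ξ)
  exact integral_mul_fderiv_eq_neg_fderiv_mul_of_integrable
    (integrable_mul_of_tsupport hg.continuous hc hs hk.dd.continuousOn)
    (integrable_mul_of_tsupport (contDiff_dd hg ξ).continuous hc' hs' hk.continuousOn)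
    (integrable_mul_of_tsupport hg.continuous hc hs hk.continuousOn)
    (fun x hx => hk.diff (hs hx)) (fun x _ => hg.differentiable (by simp) x)

theorem integral_mul_dd_dd {O : Set E2} {g k : E2 → ℝ} (hg : ContDiff ℝ ∞ g)
    (hc : HasCompactSupport g) (hs : tsupport g ⊆ O) (hk : Sm O k) (ξ : E2) :
    ∫ x, k x * dd ξ (dd ξ g) x = ∫ x, dd ξ (dd ξ k) x * g x := by
  have hs' := (tsupport_dd_subset g ξ).trans hs
  have hc' : HasCompactSupport (dd ξ g) :=
    hc.of_isClosed_subset (isClosed_tsupport _) (tsupport_dd_subset g ξ)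
  rw [integral_mul_dd (contDiff_dd hg ξ) hc' hs' hk, integral_mul_dd hg hc hs hk.dd, neg_neg]

/-- The fundamental lemma of the calculus of variations: `G` vanishes almost everywhere on `O`, and
by continuity a point with `G ≠ 0` would have a neighbourhood of positive measure where `G ≠ 0`. -/
theorem eq_zero_of_integral_bump {O : Set E2} {G : E2 → ℝ} (hO : IsOpen O)
    (hG : ContinuousOn G O)
    (h : ∀ g : E2 → ℝ, ContDiff ℝ ∞ g → HasCompactSupport g → tsupport g ⊆ O →
      ∫ x, G x * g x = 0) : ∀ x ∈ O, G x = 0 := by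
  have hae := hO.ae_eq_zero_of_integral_contDiff_smul_eq_zero (μ := volume) (f := G)
    (hG.locallyIntegrableOn hO.measurableSet) (fun g h1 h2 h3 => by
      simpa [smul_eq_mul, mul_comm] using h g h1 h2 h3)
  intro x hx
  by_contra hne
  have hopen : IsOpen (O ∩ G ⁻¹' {0}ᶜ) :=
    hG.isOpen_inter_preimage hO isOpen_compl_singleton
  have hpos := hopen.measure_pos volume ⟨x, hx, hne⟩
  refine hpos.ne' (measure_mono_null ?_ hae)
  rintro z ⟨hz, hz0⟩ hzz
  exact hz0 (hzz hz)

/-- Dividing the normal by its length `√D` multiplies the quadratic numerator by `1 / D`, which is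
the extra factor in `variationDensity`. -/
theorem wDensity_variation {Y N E : E2 → Fin 5 → ℝ} {f : E2 → ℝ} {a b : E2} {p : ℝ × E2}
    (hD : 0 < negDet (variation Y N E f) a b p) {r : ℝ}
    (hr : r = (√(negDet (variation Y N E f) a b p))⁻¹) :
    wDensity (metricCoeff (variation Y N E f) a a p) (metricCoeff (variation Y N E f) a b p)
      (metricCoeff (variation Y N E f) b b p) (r * secondCoeff Y N E f a b a a p)
      (r * secondCoeff Y N E f a b a b p) (r * secondCoeff Y N E f a b b b p)
      = variationDensity Y N E f a b p := by
  have hsq : √(negDet (variation Y N E f) a b p) ^ 2 = negDet (variation Y N E f) a b p :=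
    Real.sq_sqrt hD.le
  have hs : 0 < √(negDet (variation Y N E f) a b p) := Real.sqrt_pos.2 hD
  have hr2 : r ^ 2 = (negDet (variation Y N E f) a b p)⁻¹ := by rw [hr, inv_pow, hsq]
  have e : metricCoeff (variation Y N E f) a b p ^ 2
      - metricCoeff (variation Y N E f) a a p * metricCoeff (variation Y N E f) b b p
      = negDet (variation Y N E f) a b p := by
    unfold negDet; ring
  unfold wDensity variationDensity secondTrace
  rw [e, div_eq_div_iff hs.ne' (mul_pos hD hs).ne']
  set D := negDet (variation Y N E f) a b p
  set m₁₁ := metricCoeff (variation Y N E f) a a p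
  set m₁₂ := metricCoeff (variation Y N E f) a b p
  set m₂₂ := metricCoeff (variation Y N E f) b b p
  set h₁₁ := secondCoeff Y N E f a b a a p
  set h₁₂ := secondCoeff Y N E f a b a b p
  set h₂₂ := secondCoeff Y N E f a b b b p
  have hrD : r ^ 2 * D = 1 := by rw [hr2]; exact inv_mul_cancel₀ hD.ne'
  field_simp
  linear_combination (4 * D * (h₁₁ * h₂₂ - h₁₂ ^ 2)
    + (m₂₂ * h₁₁ - 2 * m₁₂ * h₁₂ + m₁₁ * h₂₂) ^ 2) * hrD

namespace NullFrame

variable {O : Set E2} {Y N E : E2 → Fin 5 → ℝ} {a b x : E2} {f : E2 → ℝ}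

theorem negDet_of_notMem (F : NullFrame O Y N E a b) (hf : Sm O f) (t : ℝ) (hx : x ∈ O)
    (hxf : x ∉ tsupport f) : negDet (variation Y N E f) a b (t, x) = 1 / 4 := by
  have hO' : IsOpen (O ∩ (tsupport f)ᶜ) := F.isOpen.inter (isClosed_tsupport f).isOpen_compl
  have sv := F.smVariation hf isOpen_univ
  have h : ∀ ξ, dd (0, ξ) (variation Y N E f) (t, x) = dd ξ Y x := fun ξ => by
    rw [← dd_slice sv (Set.mem_univ t) hx]
    refine dd_congr hO' (fun z hz => ?_) ⟨hx, hxf⟩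
    simp [variation, image_eq_zero_of_notMem_tsupport hz.2]
  unfold negDet metricCoeff
  rw [h, h, F.AA x hx, F.AB x hx]
  norm_num

/-- Outside the support of `f` nothing varies. On the compact support the determinant is `1 / 4` at
`t = 0`, and the tube lemma gives a uniform time interval. -/
theorem exists_negDet_pos (F : NullFrame O Y N E a b) (hf : Sm O f) (hc : HasCompactSupport f)
    (hs : tsupport f ⊆ O) :
    ∃ ε > 0, ∀ p ∈ (Set.Ioo (-ε) ε) ×ˢ O, 0 < negDet (variation Y N E f) a b p := by
  have hD := F.smNegDet hf isOpen_univ a b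
  have hopen := hD.continuousOn.isOpen_inter_preimage hD.isOpen (isOpen_Ioi (a := (0 : ℝ)))
  obtain ⟨u, v, hu, _, h0, hv, huv⟩ := generalized_tube_lemma (isCompact_singleton (x := (0 : ℝ)))
    hc hopen (by
      rintro ⟨t, z⟩ ⟨rfl, hz⟩
      refine ⟨⟨Set.mem_univ _, hs hz⟩, ?_⟩
      change 0 < negDet (variation Y N E f) a b (0, z)
      rw [F.negDet_zero hf (hs hz)]
      norm_num)
  obtain ⟨ε, hε, hball⟩ := Metric.isOpen_iff.1 hu 0 (h0 rfl)
  refine ⟨ε, hε, fun p hp => ?_⟩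
  obtain ⟨t, z⟩ := p
  by_cases hz : z ∈ tsupport f
  · refine (huv (a := (t, z)) ⟨hball ?_, hv hz⟩).2
    rw [Real.ball_eq_Ioo]
    simpa using hp.1
  · rw [F.negDet_of_notMem hf t hp.2 hz]
    norm_num

end NullFrame

/-! ### Variations on the surface and the Willmore equation -/

theorem IsLift.sm {M : Type*} [TopologicalSpace M] {y : M → Q31} {e : OpenPartialHomeomorph M E2} {Y : E2 → Fin 5 → ℝ}
    (h : IsLift y e e.target Y) : Sm e.target Y := ⟨e.open_target, h.1⟩

theorem IsLift.null {M : Type*} [TopologicalSpace M] {y : M → Q31} {e : OpenPartialHomeomorph M E2} {O : Set E2}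
    {Y : E2 → Fin 5 → ℝ} (h : IsLift y e O Y) (x : E2) (hx : x ∈ O) : ⟪Y x, Y x⟫ = 0 := by
  obtain ⟨h0, h1⟩ := h.2 x hx
  refine (y (e.symm x)).2 (Y x) ?_
  rw [h1, Projectivization.submodule_mk]
  exact Submodule.mem_span_singleton_self _

section Manifold

variable {M : Type*} [TopologicalSpace M] [ChartedSpace E2 M]

/-- Shrinks a chart to avoid a closed set, here the compact set on which a surface is varied. -/
theorem exists_restr {e : OpenPartialHomeomorph M E2}
    (he : e ∈ IsManifold.maximalAtlas (𝓡 2) ∞ M) {U : Set M} (hU : IsOpen U) {p : M}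
    (hp : p ∈ e.source) (hpU : p ∈ U) :
    ∃ e' ∈ IsManifold.maximalAtlas (𝓡 2) ∞ M, p ∈ e'.source ∧ e'.source ⊆ e.source ∩ U ∧
      e'.target ⊆ e.target ∧ (∀ x, e' x = e x) ∧ ∀ x, e'.symm x = e.symm x := by
  refine ⟨e.restr U, restr_mem_maximalAtlas (contDiffGroupoid ∞ (𝓡 2)) he hU, ?_, ?_, ?_,
    fun _ => rfl, fun _ => rfl⟩
  · rw [e.restr_source, hU.interior_eq]
    exact ⟨hp, hpU⟩
  · rw [e.restr_source, hU.interior_eq]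
  · intro x hx
    have h := (e.restr U).map_target hx
    have h2 := (e.restr U).right_inv hx
    rw [e.restr_source] at h
    rw [← h2]
    exact e.map_source h.1

open Classical in
/-- The variation of `y` given in the chart `e` by the normal variation of a lift. -/
def variationMap (y : M → Q31) (e : OpenPartialHomeomorph M E2) (Y N E : E2 → Fin 5 → ℝ)
    (f : E2 → ℝ) (hne : ∀ t, ∀ x ∈ e.target, variation Y N E f (t, x) ≠ 0)
    (hnull : ∀ t, ∀ x ∈ e.target,
      ⟪variation Y N E f (t, x), variation Y N E f (t, x)⟫ = 0) (t : ℝ) (p : M) : Q31 :=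
  if h : p ∈ e.source then
    Q31.mk (variation Y N E f (t, e p)) (hne t _ (e.map_source h)) (hnull t _ (e.map_source h))
  else y p

variable [T2Space M]

/-- The first variation vanishes for normal variations with compact support in a chart. -/
theorem integral_dt_density_eq_zero {y : M → Q31} (hW : IsWillmore y)
    {e : OpenPartialHomeomorph M E2} (he : e ∈ IsManifold.maximalAtlas (𝓡 2) ∞ M)
    {Y N E : E2 → Fin 5 → ℝ} (hY : IsLift y e e.target Y)
    (F : NullFrame e.target Y N E ex ey) {f : E2 → ℝ} (hf : ContDiff ℝ ∞ f)
    (hc : HasCompactSupport f) (hs : tsupport f ⊆ e.target) :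
    ∫ x in tsupport f, dd (1, 0) (variationDensity Y N E f ex ey) (0, x) = 0 := by
  have smf : Sm e.target f := ⟨e.open_target, hf.contDiffOn⟩
  have hne : ∀ t, ∀ x ∈ e.target, variation Y N E f (t, x) ≠ 0 := fun t x hx h0 => by
    have := F.variation_N (f := f) (t := t) hx
    rw [h0, pinner_zero_left] at this
    norm_num at this
  have hnull := fun t x hx => F.variation_null (f := f) (t := t) (x := x) hx
  obtain ⟨ε, hε, hD⟩ := F.exists_negDet_pos smf hc hs
  set z := variationMap y e Y N E f hne hnull with hz
  set K : Set M := e.symm '' tsupport f with hK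
  have hKc : IsCompact K := hc.image_of_continuousOn (e.continuousOn_symm.mono hs)
  have hKs : K ⊆ e.source := by
    rintro _ ⟨x, hx, rfl⟩
    exact e.map_target (hs hx)
  have heK : e '' K = tsupport f := by
    rw [hK, Set.image_image]
    refine (Set.image_congr fun x hx => e.right_inv (hs hx)).trans (Set.image_id' _)
  have hz_in : ∀ t, ∀ x (hx : x ∈ e.target), (z t (e.symm x)).1
      = Projectivization.mk ℝ (variation Y N E f (t, x)) (hne t x hx) := by
    intro t x hx
    rw [hz, variationMap, dif_pos (e.map_target hx)]
    simp only [Q31.mk, e.right_inv hx]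
  have hY' : ∀ p (hp : p ∈ e.source) (h : Y (e p) ≠ 0),
      (y p).1 = Projectivization.mk ℝ (Y (e p)) h := by
    intro p hp h
    obtain ⟨_, h1⟩ := hY.2 (e p) (e.map_source hp)
    rwa [e.left_inv hp] at h1
  have hz_eq : ∀ t p, (p ∈ e.source → variation Y N E f (t, e p) = Y (e p)) → z t p = y p := by
    intro t p h
    rw [hz, variationMap]
    split_ifs with hp
    · apply Subtype.ext
      have h2 := hne t (e p) (e.map_source hp)
      rw [h hp] at h2
      rw [hY' p hp h2]
      simp only [Q31.mk, h hp]
    · rfl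
  have hz0 : z 0 = y := by
    funext p
    exact hz_eq 0 p fun _ => congrFun NullFrame.variation_zero (e p)
  have hz_out : ∀ t, ∀ p ∉ K, z t p = y p := by
    intro t p hp
    refine hz_eq t p fun hps => ?_
    have h0 : f (e p) = 0 := by
      by_contra hne
      exact hp ⟨e p, subset_tsupport f hne, e.left_inv hps⟩
    simp [variation, h0]
  have hlift : ∀ t, IsLift (z t) e e.target (fun x => variation Y N E f (t, x)) := fun t =>
    ⟨((F.smVariation smf isOpen_univ).slice e.open_target (Set.mem_univ t)).cd,
      fun x hx => ⟨hne t x hx, hz_in t x hx⟩⟩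
  have hslice : ∀ t, ∀ x ∈ e.target, ∀ ξ, dd ξ (fun x => variation Y N E f (t, x)) x
      = dd (0, ξ) (variation Y N E f) (t, x) := fun t x hx ξ =>
    dd_slice (F.smVariation smf isOpen_univ) (Set.mem_univ t) hx ξ
  have hmet : ∀ t, ∀ x ∈ e.target, metricDet 2 (fun x => variation Y N E f (t, x)) x
      = -negDet (variation Y N E f) ex ey (t, x) := by
    intro t x hx
    change ⟪dd ex _ x, dd ex _ x⟫ * ⟪dd ey _ x, dd ey _ x⟫ - ⟪dd ex _ x, dd ey _ x⟫ ^ 2 = _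
    rw [hslice t x hx, hslice t x hx]
    unfold negDet metricCoeff
    ring
  -- Compact sets are closed because `M` is Hausdorff. A point outside `e.source` therefore has a
  -- chart that misses `K`, in which the varied surface equals `y` at all times.
  have hKo : IsOpen Kᶜ := hKc.isClosed.isOpen_compl
  have hout : ∀ p ∉ e.source, ∃ e' ∈ IsManifold.maximalAtlas (𝓡 2) ∞ M, p ∈ e'.source ∧
      ∃ Y' : E2 → Fin 5 → ℝ, ContDiffOn ℝ ∞ Y' e'.target ∧
        (∀ t, ∀ x ∈ e'.target, ∃ h : Y' x ≠ 0,
          (z t (e'.symm x)).1 = Projectivization.mk ℝ (Y' x) h) ∧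
        ∀ x ∈ e'.target, metricDet 2 Y' x < 0 := by
    intro p hp
    obtain ⟨e₁, he₁, hp₁, Y', hY₁, hdet⟩ := hW.1 p
    obtain ⟨e', he', hpe, hsrc, htgt, _, hsymm⟩ :=
      exists_restr he₁ hKo hp₁ (fun h => hp (hKs h))
    refine ⟨e', he', hpe, Y', hY₁.1.mono htgt, fun t x hx => ?_, fun x hx => hdet x (htgt hx)⟩
    obtain ⟨h0, h1⟩ := hY₁.2 x (htgt hx)
    refine ⟨h0, ?_⟩
    rw [hz_out t _ (hsrc (e'.map_target hx)).2, hsymm, h1]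
  have hvar : IsTimelikeVariation y K ε z := by
    refine ⟨hz0, fun t ht p => ?_, fun t _ p hp => hz_out t p hp, fun t₀ ht₀ p => ?_⟩
    · by_cases hp : p ∈ e.source
      · exact ⟨e, he, hp, _, hlift t, fun x hx => by
          rw [hmet t x hx]; linarith [hD (t, x) ⟨ht, hx⟩]⟩
      · obtain ⟨e', he', hpe, Y', h1, h2, h3⟩ := hout p hp
        exact ⟨e', he', hpe, Y', ⟨h1, h2 t⟩, h3⟩
    · by_cases hp : p ∈ e.source
      · exact ⟨e, he, hp, Set.univ, variation Y N E f, isOpen_univ, Set.mem_univ _,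
          (F.smVariation smf isOpen_univ).cd, fun t _ x hx => ⟨hne t x hx, hz_in t x hx⟩⟩
      · obtain ⟨e', he', hpe, Y', h1, h2, _⟩ := hout p hp
        exact ⟨e', he', hpe, Set.univ, fun q => Y' q.2, isOpen_univ, Set.mem_univ _,
          h1.comp contDiff_snd.contDiffOn fun _ hq => hq.2, fun t _ x hx => h2 t x hx⟩
  have hsw := F.smDensity smf isOpen_Ioo hD
  -- All of `K` lies in the chart `e`, so a single piece computes the energy.
  have henergy : ∀ t ∈ Set.Ioo (-ε) ε, HasWillmoreEnergy (z t) K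
      (∫ x in tsupport f, variationDensity Y N E f ex ey (t, x)) := by
    intro t ht
    refine ⟨1, fun _ => e, fun _ => K, fun _ x => variationDensity Y N E f ex ey (t, x),
      fun _ => ⟨he, hKs, ?_, ?_, ?_⟩, fun i j hij => (hij (Subsingleton.elim i j)).elim,
      Set.iUnion_const K, by simp [heK]⟩
    · rw [heK]
      exact (isClosed_tsupport f).measurableSet
    · intro x hx
      rw [heK] at hx
      have hxt := hs hx
      have hDx := hD (t, x) ⟨ht, hxt⟩
      have hs0 : 0 < √(negDet (variation Y N E f) ex ey (t, x)) := Real.sqrt_pos.2 hDx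
      set r := (√(negDet (variation Y N E f) ex ey (t, x)))⁻¹ with hr
      have smZ := (F.smVariation smf isOpen_univ).slice e.open_target (Set.mem_univ t)
      have hn := F.normal_self smf isOpen_Ioo (p := (t, x)) ⟨ht, hxt⟩ hDx
      obtain ⟨ξ, η, κ₁, κ₂, hhopf, hval⟩ := exists_hopfPair smZ (hnull t) hxt
        (by rw [hmet t x hxt]; linarith) (n := r • variationNormal Y N E f ex ey (t, x))
        (by
          rw [pinner_smul_left, pinner_smul_right, hn, ← Real.mul_self_sqrt hDx.le, hr]
          field_simp)
        (by unfold variationNormal; rw [pinner_smul_left, pinner_cross_fst, mul_zero])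
        (by rw [hslice t x hxt]; unfold variationNormal
            rw [pinner_smul_left, pinner_cross_trd, mul_zero])
        (by rw [hslice t x hxt]; unfold variationNormal
            rw [pinner_smul_left, pinner_cross_fth, mul_zero])
      refine ⟨e.target, e.open_target, hxt, subset_rfl, _, hlift t, ξ, η, κ₁, κ₂, hhopf, ?_⟩
      change variationDensity Y N E f ex ey (t, x) = _
      rw [hval, ← wDensity_variation hDx hr]
      have h2 := fun ξ η => dd_dd_slice (F.smVariation smf isOpen_univ) e.open_target
        (Set.mem_univ t) hxt ξ η
      simp only [hslice t x hxt, h2, pinner_smul_left]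
      rfl
    · rw [heK]
      exact ((hsw.slice e.open_target ht).continuousOn.mono hs).integrableOn_compact hc
  have hderiv := hW.2 K ε z hKc hε hvar
    (fun t => ∫ x in tsupport f, variationDensity Y N E f ex ey (t, x)) (by
      filter_upwards [Ioo_mem_nhds (show -ε < 0 by linarith) hε] with t ht
      exact henergy t ht)
  exact (hasDerivAt_setIntegral hε hsw e.open_target hc hs).unique hderiv

/-- The Willmore equation. -/
theorem willmore_eq {y : M → Q31} (hW : IsWillmore y)
    {e : OpenPartialHomeomorph M E2} (he : e ∈ IsManifold.maximalAtlas (𝓡 2) ∞ M)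
    {Y N E : E2 → Fin 5 → ℝ} (hY : IsLift y e e.target Y)
    (F : NullFrame e.target Y N E ex ey) (x : E2) (hx : x ∈ e.target) :
    dd ey (dd ey (hopf Y E ex)) x + schwarz Y N ey x * hopf Y E ex x = 0 := by
  set k₁ := hopf Y E ex with hk₁
  set k₂ := hopf Y E ey with hk₂
  have s₁ : Sm e.target k₁ := F.smHopf
  have s₂ : Sm e.target k₂ := F.swap.smHopf
  have sp : Sm e.target (schwarz Y N ex) := F.smSchwarz
  have sq : Sm e.target (schwarz Y N ey) := F.swap.smSchwarz
  -- Two integrations by parts move the derivatives from the bump function to the Hopf coefficients.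
  have hG : ∀ x ∈ e.target, (dd ey (dd ey k₁) x + schwarz Y N ey x * k₁ x)
      + (dd ex (dd ex k₂) x + schwarz Y N ex x * k₂ x) = 0 := by
    refine eq_zero_of_integral_bump e.open_target
      ((s₁.dd.dd.add (sq.mul s₁)).add (s₂.dd.dd.add (sp.mul s₂))).continuousOn
      fun f hf hc hs => ?_
    have smf : Sm e.target f := ⟨e.open_target, hf.contDiffOn⟩
    obtain ⟨ε, hε, hD⟩ := F.exists_negDet_pos smf hc hs
    have h := integral_dt_density_eq_zero hW he hY F hf hc hs
    rw [setIntegral_congr_fun (isClosed_tsupport f).measurableSet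
      fun x hx => F.dt_density smf (hs hx) hD hε] at h
    have hzero : ∀ ξ, ∀ x ∉ tsupport f, dd ξ (dd ξ f) x = 0 := fun ξ x hx =>
      image_eq_zero_of_notMem_tsupport fun h =>
        hx (tsupport_dd_subset f ξ (tsupport_dd_subset _ ξ h))
    rw [setIntegral_eq_integral_of_forall_compl_eq_zero (fun x hx => by
      rw [hzero ey x hx, hzero ex x hx, image_eq_zero_of_notMem_tsupport hx]
      ring)] at h
    have hs' := fun ξ => (tsupport_dd_subset (dd ξ f) ξ).trans
      ((tsupport_dd_subset f ξ).trans hs)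
    have hc' : ∀ ξ, HasCompactSupport (dd ξ (dd ξ f)) := fun ξ =>
      hc.of_isClosed_subset (isClosed_tsupport _)
        ((tsupport_dd_subset (dd ξ f) ξ).trans (tsupport_dd_subset f ξ))
    have i1 := integrable_mul_of_tsupport (contDiff_dd (contDiff_dd hf ey) ey).continuous
      (hc' ey) (hs' ey) s₁.continuousOn
    have i2 := integrable_mul_of_tsupport (contDiff_dd (contDiff_dd hf ex) ex).continuous
      (hc' ex) (hs' ex) s₂.continuousOn
    have i3 := integrable_mul_of_tsupport hf.continuous hc hs (sq.mul s₁).continuousOn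
    have i4 := integrable_mul_of_tsupport hf.continuous hc hs (sp.mul s₂).continuousOn
    have j1 := integrable_mul_of_tsupport hf.continuous hc hs
      (s₁.dd (ξ := ey).dd (ξ := ey)).continuousOn
    have j2 := integrable_mul_of_tsupport hf.continuous hc hs
      (s₂.dd (ξ := ex).dd (ξ := ex)).continuousOn
    have i12 : Integrable (fun x => k₁ x * dd ey (dd ey f) x + k₂ x * dd ex (dd ex f) x) :=
      i1.add i2
    have i34 : Integrable
        (fun x => schwarz Y N ey x * k₁ x * f x + schwarz Y N ex x * k₂ x * f x) := i3.add i4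
    have j12 : Integrable (fun x => dd ey (dd ey k₁) x * f x + dd ex (dd ex k₂) x * f x) :=
      j1.add j2
    have e1 : (fun x => 2 * (k₁ x * (dd ey (dd ey f) x + schwarz Y N ey x * f x)
        + k₂ x * (dd ex (dd ex f) x + schwarz Y N ex x * f x)))
        = fun x => 2 * ((k₁ x * dd ey (dd ey f) x + k₂ x * dd ex (dd ex f) x)
          + (schwarz Y N ey x * k₁ x * f x + schwarz Y N ex x * k₂ x * f x)) := by
      funext x
      ring
    rw [e1, integral_const_mul, integral_add i12 i34, integral_add i1 i2,
      integral_mul_dd_dd hf hc hs s₁, integral_mul_dd_dd hf hc hs s₂] at h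
    have e2 : (fun x => ((dd ey (dd ey k₁) x + schwarz Y N ey x * k₁ x)
        + (dd ex (dd ex k₂) x + schwarz Y N ex x * k₂ x)) * f x)
        = fun x => (dd ey (dd ey k₁) x * f x + dd ex (dd ex k₂) x * f x)
          + (schwarz Y N ey x * k₁ x * f x + schwarz Y N ex x * k₂ x * f x) := by
      funext x
      ring
    rw [e2, integral_add j12 i34, integral_add j1 j2]
    linarith
  -- The two summands are equal by Codazzi, so a vanishing sum makes each of them zero.
  have h1 := hG x hx
  have h2 := F.codazzi x hx
  linarith

end Manifold

/-! ### Isothermic surfaces -/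

/-- The frame of a canonical lift in asymptotic coordinates. -/
theorem nullFrame_of_canonical {O : Set E2} {Y : E2 → Fin 5 → ℝ} {a b : E2} (smY : Sm O Y)
    (YY : ∀ x ∈ O, ⟪Y x, Y x⟫ = 0) (AA : ∀ x ∈ O, ⟪dd a Y x, dd a Y x⟫ = 0)
    (BB : ∀ x ∈ O, ⟪dd b Y x, dd b Y x⟫ = 0) (AB : ∀ x ∈ O, ⟪dd a Y x, dd b Y x⟫ = 1 / 2) :
    NullFrame O Y
      (fun x => (2 : ℝ) • dd b (dd a Y) x
        + (2 * ⟪dd b (dd a Y) x, dd b (dd a Y) x⟫) • Y x)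
      (fun x => (4 : ℝ) • cross (Y x) (dd b (dd a Y) x) (dd a Y x) (dd b Y x)) a b := by
  have YD : ∀ ξ, ∀ x ∈ O, ⟪Y x, dd ξ Y x⟫ = 0 := fun ξ x hx => by
    have := dd_pinner_eq_zero (ξ := ξ) smY smY YY hx
    rw [pinner_comm (dd ξ Y x)] at this
    linarith
  have Y_AB : ∀ x ∈ O, ⟪Y x, dd b (dd a Y) x⟫ = -1 / 2 := fun x hx => by
    have := dd_pinner_eq_zero (ξ := b) smY smY.dd (YD a) hx
    rw [pinner_comm (dd b Y x), AB x hx] at this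
    linarith
  have A_AB : ∀ x ∈ O, ⟪dd b (dd a Y) x, dd a Y x⟫ = 0 := fun x hx => by
    have := dd_pinner_eq_zero (ξ := b) smY.dd smY.dd AA hx
    rw [pinner_comm (dd a Y x)] at this
    linarith
  have B_AB : ∀ x ∈ O, ⟪dd b (dd a Y) x, dd b Y x⟫ = 0 := fun x hx => by
    have := dd_pinner_eq_zero (ξ := a) smY.dd smY.dd BB hx
    rw [pinner_comm (dd b Y x), dd_comm smY hx] at this
    linarith
  refine ⟨smY, ?_, ?_, YY, ?_, ?_, AA, BB, AB, ?_, ?_, ?_, ?_, ?_, ?_, ?_, ?_⟩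
  · exact (smY.dd.dd.const_smul 2).add (((smY.dd.dd.pinner smY.dd.dd).const_mul 2).smul smY)
  · exact (Sm.cross smY smY.dd.dd smY.dd smY.dd).const_smul 4
  -- Writing `q = ⟪Y_ab, Y_ab⟫`, the value is `4 q - 4 q`: the `Y` term in `N` is chosen to make it
  -- null.
  · intro x hx
    simp only [pinner_add_left, pinner_add_right, pinner_smul_left, pinner_smul_right, YY x hx,
      Y_AB x hx, pinner_comm (dd b (dd a Y) x) (Y x)]
    ring
  · intro x hx
    simp only [pinner_add_right, pinner_smul_right, YY x hx, Y_AB x hx]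
    ring
  · intro x hx
    simp only [pinner_add_left, pinner_smul_left, YD a x hx, A_AB x hx]
    ring
  · intro x hx
    simp only [pinner_add_left, pinner_smul_left, YD b x hx, B_AB x hx]
    ring
  · intro x hx
    simp only [pinner_smul_left, pinner_smul_right]
    -- The cross product has square `(1 / 2)² * (1 / 2)² = 1 / 16`, which explains the factor `4`.
    rw [pinner_cross_self (YY x hx) (by rw [Y_AB x hx]; norm_num) (YD a x hx) (YD b x hx)
      (by rw [AA x hx, AB x hx]; norm_num), Y_AB x hx, AA x hx, AB x hx]
    norm_num
  · intro x hx
    simp only [pinner_smul_left, pinner_cross_fst, mul_zero]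
  · intro x hx
    simp only [pinner_smul_left, pinner_add_right, pinner_smul_right, pinner_cross_fst,
      pinner_cross_snd]
    ring
  · intro x hx
    simp only [pinner_smul_left, pinner_cross_trd, mul_zero]
  · intro x hx
    simp only [pinner_smul_left, pinner_cross_fth, mul_zero]
  · intro x hx
    simp only [pinner_smul_left, pinner_cross_snd, mul_zero]

/-- A coordinate neighbourhood of a point with a canonical lift of an isothermic Willmore surface,
and its parallel vector `c`. -/
structure ParallelChart {M : Type*} [TopologicalSpace M] [ChartedSpace E2 M] (y : M → Q31) (p : M)
    (e : OpenPartialHomeomorph M E2) (O : Set E2) (Y N E : E2 → Fin 5 → ℝ) (k : E2 → ℝ)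
    (σ : ℝ) (c : Fin 5 → ℝ) : Prop where
  atlas : e ∈ IsManifold.maximalAtlas (𝓡 2) ∞ M
  mem : p ∈ e.source
  memO : e p ∈ O
  sub : O ⊆ e.target
  lift : IsLift y e O Y
  frame : NullFrame O Y N E ex ey
  smk : Sm O k
  k0 : ∀ x ∈ O, k x ≠ 0
  σ0 : σ ≠ 0
  h1 : ∀ x ∈ O, hopf Y E ex x = σ * k x
  -- The factor `1` keeps the symmetric form `α k`, `β k`, with `α = σ` and `β = 1`, in which the
  -- directions can be exchanged.
  h2 : ∀ x ∈ O, hopf Y E ey x = 1 * k x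
  hc : ∀ x ∈ O, parallelVec Y N k (σ * 1) ex ey x = c

section Manifold

variable {M : Type*} [TopologicalSpace M] [ChartedSpace E2 M]

namespace ParallelChart

variable {y : M → Q31} {p : M} {e : OpenPartialHomeomorph M E2} {O : Set E2}
  {Y N E : E2 → Fin 5 → ℝ} {k : E2 → ℝ} {σ : ℝ} {c : Fin 5 → ℝ} {x : E2}

theorem pinner_E (D : ParallelChart y p e O Y N E k σ c) (hx : x ∈ O) : ⟪c, E x⟫ = 0 := by
  rw [← D.hc x hx, D.frame.parallelVec_E _ hx]

theorem pinner_Y (D : ParallelChart y p e O Y N E k σ c) (hx : x ∈ O) : ⟪c, Y x⟫ = k x := by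
  rw [← D.hc x hx, D.frame.parallelVec_Y _ hx]

theorem ne_zero (D : ParallelChart y p e O Y N E k σ c) : c ≠ 0 := by
  intro h
  have := D.pinner_Y D.memO
  rw [h, pinner_zero_left] at this
  exact D.k0 _ D.memO this.symm

end ParallelChart

theorem span_ex_ey (ξ : E2) : ξ = ξ 0 • ex + ξ 1 • ey := by
  ext i
  fin_cases i <;> simp [ex, ey]

theorem exists_parallelChart [T2Space M] {y : M → Q31} (hI : IsIsothermic y) (hW : IsWillmore y)
    (p : M) : ∃ e O Y N E k σ c, ParallelChart y p e O Y N E k σ c := by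
  obtain ⟨σ, hσ, hS⟩ : ∃ σ : ℝ, σ ≠ 0 ∧ IsSignedIsothermic σ y := by
    rcases hI with h | h
    exacts [⟨1, by norm_num, h⟩, ⟨-1, by norm_num, h⟩]
  obtain ⟨e, he, hp, Y, hY, hκ⟩ := hS.2.2 p
  have smY : Sm e.target Y := hY.sm
  have F := nullFrame_of_canonical (a := ex) (b := ey) smY hY.null
    (fun x hx => by obtain ⟨_, _, h, _⟩ := hκ x hx; exact h.1)
    (fun x hx => by obtain ⟨_, _, h, _⟩ := hκ x hx; exact h.2.1)
    (fun x hx => by obtain ⟨_, _, h, _⟩ := hκ x hx; exact h.2.2.1)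
  set N : E2 → Fin 5 → ℝ := fun x => (2 : ℝ) • dd ey (dd ex Y) x
        + (2 * ⟪dd ey (dd ex Y) x, dd ey (dd ex Y) x⟫) • Y x with hN
  set E : E2 → Fin 5 → ℝ := fun x => (4 : ℝ) • cross (Y x) (dd ey (dd ex Y) x) (dd ex Y x)
    (dd ey Y x) with hE
  have hgE : ∀ x ∈ e.target, ∀ v ∈ gaussSpace Y x ex ey, ⟪E x, v⟫ = 0 := by
    intro x hx v hv
    have hle : gaussSpace Y x ex ey ≤ LinearMap.ker (pinnerL 5 2 (E x)) := by
      unfold gaussSpace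
      rw [Submodule.span_le]
      rintro z (rfl | rfl | rfl | rfl)
      exacts [F.EY x hx, F.EA x hx, F.EB x hx, F.EAB x hx]
    simpa using hle hv
  set k := hopf Y E ey with hk
  have hcoef : ∀ x ∈ e.target, ∀ κ₁ κ₂, IsHopfPair Y x ex ey κ₁ κ₂ →
      hopf Y E ex x = ⟪κ₁, E x⟫ ∧ hopf Y E ey x = ⟪κ₂, E x⟫ := by
    intro x hx κ₁ κ₂ h
    have e1 := hgE x hx _ h.2.2.2.2.2.1
    have e2 := hgE x hx _ h.2.2.2.2.2.2
    rw [pinner_sub_right] at e1 e2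
    rw [pinner_comm κ₁, pinner_comm κ₂]
    exact ⟨(pinner_comm _ _).trans (sub_eq_zero.1 e1), (pinner_comm _ _).trans (sub_eq_zero.1 e2)⟩
  have h1 : ∀ x ∈ e.target, hopf Y E ex x = σ * k x := by
    intro x hx
    obtain ⟨κ₁, κ₂, h, rfl⟩ := hκ x hx
    rw [(hcoef x hx _ _ h).1, hk, (hcoef x hx _ _ h).2, pinner_smul_left]
  -- If `k` vanishes, `κ₂` is orthogonal to `V` and to `E`, so it is zero. Then `κ₁ = σ κ₂ = 0`, and
  -- the point is umbilic.
  have k0 : ∀ x ∈ e.target, k x ≠ 0 := by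
    intro x hx h0
    obtain ⟨κ₁, κ₂, h, rfl⟩ := hκ x hx
    have hκE : ⟪κ₂, E x⟫ = 0 := by rw [← (hcoef x hx _ _ h).2]; exact h0
    have horth := h.2.2.2.2.1
    have hmem : ∀ v ∈ ({Y x, pd ex Y x, pd ey Y x, pd ey (pd ex Y) x} : Set (Fin 5 → ℝ)),
        ⟪κ₂, v⟫ = 0 := fun v hv => horth v (Submodule.subset_span hv)
    have hκ0 : κ₂ = 0 := by
      have hY0 : ⟪κ₂, Y x⟫ = 0 := hmem _ (by simp)
      have hAB0 : ⟪κ₂, dd ey (dd ex Y) x⟫ = 0 :=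
        hmem (pd ey (pd ex Y) x) (by simp)
      refine (F.block hx).eq_zero hY0 ?_ (hmem (pd ex Y x) (by simp)) (hmem (pd ey Y x) (by simp))
        hκE
      rw [hN, pinner_add_right, pinner_smul_right, pinner_smul_right, hY0, hAB0]
      ring
    refine hS.2.1 (e.symm x) ⟨e, he, e.map_target hx, Y, hY, ex, ey, ?_⟩
    rw [e.right_inv hx]
    rw [hκ0, smul_zero] at h
    exact h
  have smk : Sm e.target k := F.swap.smHopf
  have h2 : ∀ x ∈ e.target, hopf Y E ey x = 1 * k x := fun x _ => (one_mul _).symm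
  have hw1 : ∀ x ∈ e.target, dd ey (dd ey k) x = -(schwarz Y N ey x * k x) := by
    intro x hx
    have h := willmore_eq hW he hY F x hx
    rw [h1 x hx, dd_congr e.open_target (fun z hz => by
      rw [dd_congr (g := fun z => σ * k z) e.open_target h1 hz, dd_const_mul (smk.diff hz)]) hx,
      dd_const_mul (smk.dd.diff hx)] at h
    exact mul_left_cancel₀ hσ (by linarith)
  have hw2 : ∀ x ∈ e.target, dd ex (dd ex k) x = -(schwarz Y N ex x * k x) := by
    intro x hx
    have h := willmore_eq hW he hY F x hx
    have h' := F.codazzi x hx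
    rw [h] at h'
    linarith
  have dc1 : ∀ x ∈ e.target, dd ex (parallelVec Y N k (σ * 1) ex ey) x = 0 := fun x hx =>
    F.dd_parallelVec smk h1 h2 hw2 hx
  have dc2 : ∀ x ∈ e.target, dd ey (parallelVec Y N k (σ * 1) ex ey) x = 0 := fun x hx => by
    rw [dd_congr e.open_target (fun z hz => NullFrame.parallelVec_swap smk _ hz) hx, mul_comm σ 1]
    exact F.swap.dd_parallelVec smk h2 h1 hw1 hx
  have smc : Sm e.target (parallelVec Y N k (σ * 1) ex ey) :=
    (((((smk.dd.dd.const_mul 2).add ((smk.pow 3).const_mul _)).neg.smul F.smY).add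
      ((smk.dd.const_mul 2).smul F.smA)).add ((smk.dd.const_mul 2).smul F.smB)).add
      (smk.neg.smul F.smN)
  -- The chart target may be disconnected. On a ball, vanishing derivatives imply that the vector is
  -- constant.
  obtain ⟨ε, hε, hball⟩ := Metric.isOpen_iff.1 e.open_target (e p) (e.map_source hp)
  refine ⟨e, Metric.ball (e p) ε, Y, N, E, k, σ, parallelVec Y N k (σ * 1) ex ey (e p),
    he, hp, Metric.mem_ball_self hε, hball, ⟨hY.1.mono hball, fun x hx => hY.2 x (hball hx)⟩,
    F.mono Metric.isOpen_ball hball, smk.mono Metric.isOpen_ball hball,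
    fun x hx => k0 x (hball hx), hσ, fun x hx => h1 x (hball hx), fun x hx => h2 x (hball hx),
    fun x hx => ?_⟩
  refine Metric.isOpen_ball.is_const_of_fderiv_eq_zero (convex_ball (e p) ε).isPreconnected
    (fun z hz => (smc.diff (hball hz)).differentiableWithinAt) (fun z hz => ?_) hx
    (Metric.mem_ball_self hε)
  ext1 ξ
  change dd ξ (parallelVec Y N k (σ * 1) ex ey) z = 0
  rw [span_ex_ey ξ, dd_dir_add, dd_dir_smul, dd_dir_smul, dc1 z (hball hz), dc2 z (hball hz)]
  simp

end Manifold

/-! ### Change of lift and coordinates -/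

/-- `v` is orthogonal to the bundle `V` of the lift `Z` at `x`: it is orthogonal to `Z` and its
derivatives, and its second fundamental form has no trace. -/
structure IsGaussNormal (Z : E2 → Fin 5 → ℝ) (x : E2) (v : Fin 5 → ℝ) : Prop where
  zero : ⟪v, Z x⟫ = 0
  one : ⟪v, dd ex Z x⟫ = 0
  two : ⟪v, dd ey Z x⟫ = 0
  trace : ⟪dd ey Z x, dd ey Z x⟫ * ⟪v, dd ex (dd ex Z) x⟫
    - 2 * ⟪dd ex Z x, dd ey Z x⟫ * ⟪v, dd ey (dd ex Z) x⟫
    + ⟪dd ex Z x, dd ex Z x⟫ * ⟪v, dd ey (dd ey Z) x⟫ = 0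

section Transfer

variable {O O' : Set E2} {φ : E2 → E2} {x ξ η : E2}

theorem Sm.comp {F : Type*} [NormedAddCommGroup F] [NormedSpace ℝ F] {f : E2 → F} (hf : Sm O f)
    (hφ : Sm O' φ) (h : ∀ x ∈ O', φ x ∈ O) : Sm O' (fun x => f (φ x)) :=
  ⟨hφ.isOpen, hf.cd.comp hφ.cd h⟩

theorem dd_comp {F : Type*} [NormedAddCommGroup F] [NormedSpace ℝ F] {f : E2 → F} (hf : Sm O f)
    (hφ : Sm O' φ) (h : ∀ x ∈ O', φ x ∈ O) (hx : x ∈ O') :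
    dd ξ (fun x => f (φ x)) x
      = (dd ξ φ x) 0 • dd ex f (φ x) + (dd ξ φ x) 1 • dd ey f (φ x) := by
  have h1 := ((hf.diff (h x hx)).hasFDerivAt.comp x (hφ.diff hx).hasFDerivAt).fderiv
  rw [← dd_dir_smul, ← dd_dir_smul, ← dd_dir_add, ← span_ex_ey]
  unfold dd
  rw [show (fun x => f (φ x)) = f ∘ φ from rfl, h1]
  rfl

theorem Sm.coord (hφ : Sm O φ) (i : Fin 2) : Sm O (fun x => φ x i) :=
  hφ.clm (EuclideanSpace.proj i)

variable {Z Z' : E2 → Fin 5 → ℝ} {r : E2 → ℝ} {v : Fin 5 → ℝ}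

theorem dd_transfer (hZ : Sm O Z) (hφ : Sm O' φ) (h : ∀ x ∈ O', φ x ∈ O) (hr : Sm O' r)
    (hZ' : ∀ x ∈ O', Z' x = r x • Z (φ x)) (hx : x ∈ O') (ξ : E2) :
    dd ξ Z' x = r x • ((dd ξ φ x) 0 • dd ex Z (φ x) + (dd ξ φ x) 1 • dd ey Z (φ x))
      + dd ξ r x • Z (φ x) := by
  rw [dd_congr hr.isOpen hZ' hx, dd_smul (hr.diff hx) ((hZ.comp hφ h).diff hx),
    dd_comp hZ hφ h hx]

theorem pinner_dd_transfer (hZ : Sm O Z) (hnull : ∀ x ∈ O, ⟪Z x, Z x⟫ = 0) (hφ : Sm O' φ)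
    (h : ∀ x ∈ O', φ x ∈ O) (hr : Sm O' r) (hZ' : ∀ x ∈ O', Z' x = r x • Z (φ x)) (hx : x ∈ O')
    (ξ η : E2) : ⟪dd ξ Z' x, dd η Z' x⟫ = r x ^ 2 * (
      (dd ξ φ x) 0 * (dd η φ x) 0 * ⟪dd ex Z (φ x), dd ex Z (φ x)⟫
      + ((dd ξ φ x) 0 * (dd η φ x) 1 + (dd ξ φ x) 1 * (dd η φ x) 0)
        * ⟪dd ex Z (φ x), dd ey Z (φ x)⟫
      + (dd ξ φ x) 1 * (dd η φ x) 1 * ⟪dd ey Z (φ x), dd ey Z (φ x)⟫) := by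
  have YD : ∀ ζ, ⟪Z (φ x), dd ζ Z (φ x)⟫ = 0 := fun ζ => by
    have := dd_pinner_eq_zero (ξ := ζ) hZ hZ hnull (h x hx)
    rw [pinner_comm (dd ζ Z (φ x))] at this
    linarith
  rw [dd_transfer hZ hφ h hr hZ' hx, dd_transfer hZ hφ h hr hZ' hx]
  simp only [pinner_add_left, pinner_add_right, pinner_smul_left, pinner_smul_right, YD,
    hnull _ (h x hx), pinner_comm (dd ex Z (φ x)) (Z (φ x)),
    pinner_comm (dd ey Z (φ x)) (Z (φ x)), pinner_comm (dd ey Z (φ x)) (dd ex Z (φ x))]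
  ring

theorem dd_pinner_const (hZ : Sm O Z) (v : Fin 5 → ℝ) (hx : x ∈ O) (ξ : E2) :
    dd ξ (fun z => ⟪v, Z z⟫) x = ⟪v, dd ξ Z x⟫ := by
  rw [dd_pinner ((Sm.const hZ.isOpen v).diff hx) (hZ.diff hx), dd_const, pinner_zero_left,
    zero_add]

/-- Derivatives of `r` and second derivatives of `φ` only multiply pairings of `v` with `Z` and its
first derivatives, which vanish at the point. So the second fundamental form is tensorial. -/
theorem second_transfer (hZ : Sm O Z) (hφ : Sm O' φ) (h : ∀ x ∈ O', φ x ∈ O) (hr : Sm O' r)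
    (hZ' : ∀ x ∈ O', Z' x = r x • Z (φ x)) (hx : x ∈ O') (v0 : ⟪v, Z (φ x)⟫ = 0)
    (v1 : ⟪v, dd ex Z (φ x)⟫ = 0) (v2 : ⟪v, dd ey Z (φ x)⟫ = 0) (ξ η : E2) :
    ⟪v, dd η (dd ξ Z') x⟫ = r x * (
      (dd ξ φ x) 0 * (dd η φ x) 0 * ⟪v, dd ex (dd ex Z) (φ x)⟫
      + ((dd ξ φ x) 0 * (dd η φ x) 1 + (dd ξ φ x) 1 * (dd η φ x) 0)
        * ⟪v, dd ey (dd ex Z) (φ x)⟫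
      + (dd ξ φ x) 1 * (dd η φ x) 1 * ⟪v, dd ey (dd ey Z) (φ x)⟫) := by
  have smZ' : Sm O' Z' := (hr.smul (hZ.comp hφ h)).congr hZ'
  have s1 : Sm O' (fun z => (dd ξ φ z) 0) := hφ.dd.coord 0
  have s2 : Sm O' (fun z => (dd ξ φ z) 1) := hφ.dd.coord 1
  have u0 : Sm O (fun z => ⟪v, Z z⟫) := (Sm.const hZ.isOpen v).pinner hZ
  have u1 : Sm O (fun z => ⟪v, dd ex Z z⟫) := (Sm.const hZ.isOpen v).pinner hZ.dd
  have u2 : Sm O (fun z => ⟪v, dd ey Z z⟫) := (Sm.const hZ.isOpen v).pinner hZ.dd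
  have c0 := u0.comp hφ h
  have c1 := u1.comp hφ h
  have c2 := u2.comp hφ h
  have e1 : ∀ z ∈ O', ⟪v, dd ξ Z' z⟫ = r z * ((dd ξ φ z) 0 * ⟪v, dd ex Z (φ z)⟫
      + (dd ξ φ z) 1 * ⟪v, dd ey Z (φ z)⟫) + dd ξ r z * ⟪v, Z (φ z)⟫ := by
    intro z hz
    rw [dd_transfer hZ hφ h hr hZ' hz]
    simp only [pinner_add_right, pinner_smul_right]
  rw [← dd_pinner_const smZ'.dd v hx, dd_congr hr.isOpen e1 hx,
    dd_add ((hr.mul ((s1.mul c1).add (s2.mul c2))).diff hx) ((hr.dd.mul c0).diff hx),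
    dd_mul (hr.diff hx) (((s1.mul c1).add (s2.mul c2)).diff hx),
    dd_add ((s1.mul c1).diff hx) ((s2.mul c2).diff hx), dd_mul (s1.diff hx) (c1.diff hx),
    dd_mul (s2.diff hx) (c2.diff hx), dd_mul (hr.dd.diff hx) (c0.diff hx),
    dd_comp u0 hφ h hx, dd_comp u1 hφ h hx, dd_comp u2 hφ h hx,
    dd_pinner_const hZ v (h x hx), dd_pinner_const hZ v (h x hx),
    dd_pinner_const hZ.dd v (h x hx), dd_pinner_const hZ.dd v (h x hx),
    dd_pinner_const hZ.dd v (h x hx), dd_pinner_const hZ.dd v (h x hx), v0, v1, v2,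
    dd_comm (ξ := ex) (η := ey) hZ (h x hx)]
  simp only [smul_eq_mul]
  ring

theorem IsGaussNormal.transfer (hZ : Sm O Z) (hnull : ∀ x ∈ O, ⟪Z x, Z x⟫ = 0) (hφ : Sm O' φ)
    (h : ∀ x ∈ O', φ x ∈ O) (hr : Sm O' r) (hZ' : ∀ x ∈ O', Z' x = r x • Z (φ x)) (hx : x ∈ O')
    (hv : IsGaussNormal Z (φ x) v) : IsGaussNormal Z' x v := by
  have h1 : ∀ ξ, ⟪v, dd ξ Z' x⟫ = 0 := fun ξ => by
    rw [dd_transfer hZ hφ h hr hZ' hx]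
    simp only [pinner_add_right, pinner_smul_right, hv.zero, hv.one, hv.two]
    ring
  refine ⟨by rw [hZ' x hx, pinner_smul_right, hv.zero, mul_zero], h1 _, h1 _, ?_⟩
  simp only [second_transfer hZ hφ h hr hZ' hx hv.zero hv.one hv.two,
    pinner_dd_transfer hZ hnull hφ h hr hZ' hx]
  -- The metric scales by `r²` and the second form by `r`. The trace, taken with the adjugate
  -- metric, gains the squared Jacobian.
  linear_combination r x ^ 3 * ((dd ex φ x) 0 * (dd ey φ x) 1 - (dd ex φ x) 1 * (dd ey φ x) 0) ^ 2
    * hv.trace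

theorem metricDet_transfer (hZ : Sm O Z) (hnull : ∀ x ∈ O, ⟪Z x, Z x⟫ = 0) (hφ : Sm O' φ)
    (h : ∀ x ∈ O', φ x ∈ O) (hr : Sm O' r) (hZ' : ∀ x ∈ O', Z' x = r x • Z (φ x))
    (hx : x ∈ O') : metricDet 2 Z' x
      = (r x ^ 2 * ((dd ex φ x) 0 * (dd ey φ x) 1 - (dd ex φ x) 1 * (dd ey φ x) 0)) ^ 2
        * metricDet 2 Z (φ x) := by
  change ⟪dd ex Z' x, dd ex Z' x⟫ * ⟪dd ey Z' x, dd ey Z' x⟫ - ⟪dd ex Z' x, dd ey Z' x⟫ ^ 2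
    = _ * (⟪dd ex Z (φ x), dd ex Z (φ x)⟫ * ⟪dd ey Z (φ x), dd ey Z (φ x)⟫
      - ⟪dd ex Z (φ x), dd ey Z (φ x)⟫ ^ 2)
  simp only [pinner_dd_transfer hZ hnull hφ h hr hZ' hx]
  ring

/-- The chain rule for `ψ ∘ φ = id`: the two Jacobian determinants have product `1`. -/
theorem jacobian_ne_zero {ψ : E2 → E2} (hψ : Sm O ψ) (hφ : Sm O' φ) (h : ∀ x ∈ O', φ x ∈ O)
    (hinv : ∀ x ∈ O', ψ (φ x) = x) (hx : x ∈ O') :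
    (dd ex φ x) 0 * (dd ey φ x) 1 - (dd ex φ x) 1 * (dd ey φ x) 0 ≠ 0 := by
  have key : ∀ ξ, (dd ξ φ x) 0 • dd ex ψ (φ x) + (dd ξ φ x) 1 • dd ey ψ (φ x) = ξ := fun ξ => by
    rw [← dd_comp hψ hφ h hx, dd_congr hφ.isOpen hinv hx]
    simp [dd]
  have k : ∀ ξ i, (dd ξ φ x) 0 * (dd ex ψ (φ x)) i + (dd ξ φ x) 1 * (dd ey ψ (φ x)) i = ξ i :=
    fun ξ i => congrArg (fun w : E2 => w i) (key ξ)
  have k1 := (k ex 0).trans (show ex 0 = (1 : ℝ) by simp [ex])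
  have k2 := (k ex 1).trans (show ex 1 = (0 : ℝ) by simp [ex])
  have k4 := (k ey 1).trans (show ey 1 = (1 : ℝ) by simp [ey])
  intro h0
  have : ((dd ex φ x) 0 * (dd ey φ x) 1 - (dd ex φ x) 1 * (dd ey φ x) 0)
      * ((dd ex ψ (φ x)) 0 * (dd ey ψ (φ x)) 1 - (dd ey ψ (φ x)) 0 * (dd ex ψ (φ x)) 1) = 1 := by
    linear_combination ((dd ey φ x) 0 * (dd ex ψ (φ x)) 1 + (dd ey φ x) 1 * (dd ey ψ (φ x)) 1) * k1
      + k4 - ((dd ey φ x) 0 * (dd ex ψ (φ x)) 0 + (dd ey φ x) 1 * (dd ey ψ (φ x)) 0) * k2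
  rw [h0, zero_mul] at this
  norm_num at this

end Transfer

/-! ### The globally constant vector -/

section Global

variable {M : Type*} [TopologicalSpace M] [ChartedSpace E2 M]

theorem sm_transition {e₁ e₂ : OpenPartialHomeomorph M E2}
    (h₁ : e₁ ∈ IsManifold.maximalAtlas (𝓡 2) ∞ M) (h₂ : e₂ ∈ IsManifold.maximalAtlas (𝓡 2) ∞ M) :
    Sm (e₁.target ∩ e₁.symm ⁻¹' e₂.source) (fun x => e₂ (e₁.symm x)) := by
  refine ⟨e₁.isOpen_inter_preimage_symm e₂.open_source, ?_⟩
  rw [← contMDiffOn_iff_contDiffOn]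
  exact (contMDiffOn_of_mem_maximalAtlas h₂).comp
    ((contMDiffOn_symm_of_mem_maximalAtlas h₁).mono Set.inter_subset_left) fun x hx => hx.2

/-- The domain on which two lifts can be compared. -/
def overlap (e₁ e₂ : OpenPartialHomeomorph M E2) (O₂ : Set E2) : Set E2 :=
  (e₁.target ∩ e₁.symm ⁻¹' e₂.source) ∩ (fun x => e₂ (e₁.symm x)) ⁻¹' O₂

theorem sm_overlap {e₁ e₂ : OpenPartialHomeomorph M E2}
    (h₁ : e₁ ∈ IsManifold.maximalAtlas (𝓡 2) ∞ M) (h₂ : e₂ ∈ IsManifold.maximalAtlas (𝓡 2) ∞ M)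
    {O₂ : Set E2} (hO : IsOpen O₂) : Sm (overlap e₁ e₂ O₂) (fun x => e₂ (e₁.symm x)) := by
  have h := sm_transition h₁ h₂
  exact h.mono (h.continuousOn.isOpen_inter_preimage h.isOpen hO) Set.inter_subset_left

theorem mem_overlap {M : Type*} [TopologicalSpace M] {e₁ e₂ : OpenPartialHomeomorph M E2}
    {O₂ : Set E2} {m : M}
    (h₁ : m ∈ e₁.source) (h₂ : m ∈ e₂.source) (h : e₂ m ∈ O₂) : e₁ m ∈ overlap e₁ e₂ O₂ := by
  refine ⟨⟨e₁.map_source h₁, ?_⟩, ?_⟩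
  · rw [Set.mem_preimage, e₁.left_inv h₁]
    exact h₂
  · rw [Set.mem_preimage, e₁.left_inv h₁]
    exact h

theorem NullFrame.isGaussNormal {O : Set E2} {Y N E : E2 → Fin 5 → ℝ} {x : E2}
    (F : NullFrame O Y N E ex ey) (hx : x ∈ O) : IsGaussNormal Y x (E x) :=
  ⟨F.EY x hx, F.EA x hx, F.EB x hx, by rw [F.AA x hx, F.BB x hx, F.EAB x hx]; ring⟩

theorem NullFrame.eq_smul_of_isGaussNormal {O : Set E2} {Y N E : E2 → Fin 5 → ℝ} {x : E2}
    (F : NullFrame O Y N E ex ey) (hx : x ∈ O) {v : Fin 5 → ℝ} (hv : IsGaussNormal Y x v) :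
    v = ⟪v, E x⟫ • E x := by
  have htr := hv.trace
  rw [F.AA x hx, F.BB x hx, F.AB x hx] at htr
  have hab : ⟪v, dd ey (dd ex Y) x⟫ = 0 := by linarith
  refine (F.block hx).eq_smul hv.zero ?_ hv.one hv.two
  rw [F.ab_eq x hx, pinner_add_right, pinner_smul_right, pinner_smul_right, hv.zero] at hab
  linarith

theorem exists_smul_of_isLift {M : Type*} [TopologicalSpace M] {y : M → Q31}
    {e₁ e₂ : OpenPartialHomeomorph M E2} {O₁ O₂ : Set E2} {Y₁ Y₂ : E2 → Fin 5 → ℝ} (h₁ : IsLift y e₁ O₁ Y₁) (h₂ : IsLift y e₂ O₂ Y₂) {x : E2}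
    (hx : x ∈ O₁) (hx' : x ∈ overlap e₁ e₂ O₂) : ∃ a : ℝ, Y₁ x = a • Y₂ (e₂ (e₁.symm x)) := by
  obtain ⟨n₁, q₁⟩ := h₁.2 x hx
  obtain ⟨n₂, q₂⟩ := h₂.2 _ hx'.2
  rw [e₂.left_inv hx'.1.2, q₁, Projectivization.mk_eq_mk_iff'] at q₂
  obtain ⟨a, ha⟩ := q₂
  exact ⟨a, ha.symm⟩

namespace ParallelChart

variable {y : M → Q31} {p q : M} {e₁ e₂ : OpenPartialHomeomorph M E2} {O₁ O₂ : Set E2}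
  {Y₁ N₁ E₁ Y₂ N₂ E₂ : E2 → Fin 5 → ℝ} {k₁ k₂ : E2 → ℝ} {σ₁ σ₂ : ℝ} {c₁ c₂ : Fin 5 → ℝ}

/-- Being a Gauss normal is independent of lift and chart, so `E₂` is a multiple of `E₁`, to which
`c₁` is orthogonal. -/
theorem pinner_E_overlap (D₁ : ParallelChart y p e₁ O₁ Y₁ N₁ E₁ k₁ σ₁ c₁)
    (D₂ : ParallelChart y q e₂ O₂ Y₂ N₂ E₂ k₂ σ₂ c₂) {m : M} (h₁ : m ∈ e₁.source)
    (h₂ : m ∈ e₂.source) (m₁ : e₁ m ∈ O₁) (m₂ : e₂ m ∈ O₂) : ⟪c₁, E₂ (e₂ m)⟫ = 0 := by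
  have hφ := sm_overlap D₁.atlas D₂.atlas D₂.frame.isOpen
  have hO : IsOpen (O₁ ∩ overlap e₁ e₂ O₂) := D₁.frame.isOpen.inter hφ.isOpen
  have hφ' := hφ.mono hO Set.inter_subset_right
  have hmap : ∀ x ∈ O₁ ∩ overlap e₁ e₂ O₂, e₂ (e₁.symm x) ∈ O₂ := fun x hx => hx.2.2
  -- The ratio of the two lifts is read off by pairing with `N₂`, as `⟪Y₂, N₂⟫ = -1`. This formula
  -- shows its smoothness.
  have hr : Sm (O₁ ∩ overlap e₁ e₂ O₂) (fun x => -⟪Y₁ x, N₂ (e₂ (e₁.symm x))⟫) :=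
    ((D₁.frame.smY.mono hO Set.inter_subset_left).pinner
      (D₂.frame.smN.comp hφ' hmap)).neg
  have hY : ∀ x ∈ O₁ ∩ overlap e₁ e₂ O₂,
      Y₁ x = (-⟪Y₁ x, N₂ (e₂ (e₁.symm x))⟫) • Y₂ (e₂ (e₁.symm x)) := by
    intro x hx
    obtain ⟨a, ha⟩ := exists_smul_of_isLift D₁.lift D₂.lift hx.1 hx.2
    have : -⟪Y₁ x, N₂ (e₂ (e₁.symm x))⟫ = a := by
      rw [ha, pinner_smul_left, D₂.frame.YN _ (hmap x hx)]
      ring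
    rw [this, ← ha]
  have hm : e₁ m ∈ O₁ ∩ overlap e₁ e₂ O₂ := ⟨m₁, mem_overlap h₁ h₂ m₂⟩
  have hem : e₂ (e₁.symm (e₁ m)) = e₂ m := by rw [e₁.left_inv h₁]
  have hG := IsGaussNormal.transfer D₂.frame.smY D₂.frame.YY hφ' hmap hr hY hm
    (v := E₂ (e₂ m)) (by rw [hem]; exact D₂.frame.isGaussNormal m₂)
  rw [D₁.frame.eq_smul_of_isGaussNormal m₁ hG, pinner_smul_right, D₁.pinner_E m₁, mul_zero]

theorem exists_smul (D₁ : ParallelChart y p e₁ O₁ Y₁ N₁ E₁ k₁ σ₁ c₁)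
    (D₂ : ParallelChart y q e₂ O₂ Y₂ N₂ E₂ k₂ σ₂ c₂) (h₁ : q ∈ e₁.source) (m₁ : e₁ q ∈ O₁) :
    ∃ a : ℝ, c₁ = a • c₂ := by
  have hφ := sm_overlap D₂.atlas D₁.atlas D₁.frame.isOpen
  have hO : IsOpen (O₂ ∩ overlap e₂ e₁ O₁) := D₂.frame.isOpen.inter hφ.isOpen
  have hsub : O₂ ∩ overlap e₂ e₁ O₁ ⊆ O₂ := Set.inter_subset_left
  have hq : e₂ q ∈ O₂ ∩ overlap e₂ e₁ O₁ := ⟨D₂.memO, mem_overlap D₂.mem h₁ m₁⟩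
  have h := (D₂.frame.mono hO hsub).eq_smul_parallelVec (D₂.smk.mono hO hsub)
    (fun x hx => D₂.k0 x hx.1) D₂.σ0 one_ne_zero (fun x hx => D₂.h1 x hx.1)
    (fun x hx => D₂.h2 x hx.1) (v := c₁) (fun x hx => by
      have h3 := D₁.pinner_E_overlap D₂ (m := e₂.symm x) hx.2.1.2 (e₂.map_target hx.2.1.1) hx.2.2
        (by rw [e₂.right_inv hx.2.1.1]; exact hx.1)
      rwa [e₂.right_inv hx.2.1.1] at h3) hq
  rw [D₂.hc _ D₂.memO] at h
  exact ⟨_, h⟩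

end ParallelChart

/-- A coordinate neighbourhood with a canonical lift whose Gauss map is orthogonal to the
constant vector `c`. -/
structure AdaptedChart (y : M → Q31) (c : Fin 5 → ℝ) (p : M) (e : OpenPartialHomeomorph M E2)
    (O : Set E2) (Y N E : E2 → Fin 5 → ℝ) : Prop where
  atlas : e ∈ IsManifold.maximalAtlas (𝓡 2) ∞ M
  mem : p ∈ e.source
  memO : e p ∈ O
  lift : IsLift y e O Y
  frame : NullFrame O Y N E ex ey
  cE : ∀ x ∈ O, ⟪c, E x⟫ = 0
  cY : ∀ x ∈ O, ⟪c, Y x⟫ ≠ 0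

theorem exists_adapted [T2Space M] [ConnectedSpace M] {y : M → Q31} (hI : IsIsothermic y)
    (hW : IsWillmore y) :
    ∃ c : Fin 5 → ℝ, c ≠ 0 ∧ ∀ p, ∃ e O Y N E, AdaptedChart y c p e O Y N E := by
  choose e O Y N E k σ c D using exists_parallelChart hI hW
  -- The parallel vectors are defined only up to scale, so it is their lines that are locally
  -- constant.
  have hloc : IsLocallyConstant fun p => Submodule.span ℝ {c p} := by
    rw [IsLocallyConstant.iff_exists_open]
    intro p
    refine ⟨(e p).source ∩ e p ⁻¹' O p,
      (e p).isOpen_inter_preimage (D p).frame.isOpen, ⟨(D p).mem, (D p).memO⟩, fun q hq => ?_⟩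
    obtain ⟨a, ha⟩ := (D p).exists_smul (D q) hq.1 hq.2
    have ha0 : a ≠ 0 := by
      rintro rfl
      exact (D p).ne_zero (by rw [ha, zero_smul])
    change Submodule.span ℝ {c q} = Submodule.span ℝ {c p}
    rw [ha, Submodule.span_singleton_smul_eq (IsUnit.mk0 a ha0)]
  obtain ⟨p₀⟩ := (inferInstance : Nonempty M)
  refine ⟨c p₀, (D p₀).ne_zero, fun p => ?_⟩
  have hmem : c p₀ ∈ Submodule.span ℝ {c p} := by
    have h := hloc.apply_eq_of_preconnectedSpace p₀ p
    rw [← h]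
    exact Submodule.mem_span_singleton_self _
  obtain ⟨a, ha⟩ := Submodule.mem_span_singleton.1 hmem
  have ha0 : a ≠ 0 := by
    rintro rfl
    exact (D p₀).ne_zero (by rw [← ha, zero_smul])
  refine ⟨e p, O p, Y p, N p, E p, (D p).atlas, (D p).mem, (D p).memO, (D p).lift, (D p).frame,
    fun x hx => ?_, fun x hx => ?_⟩
  · rw [← ha, pinner_smul_left, (D p).pinner_E hx, mul_zero]
  · rw [← ha, pinner_smul_left, (D p).pinner_Y hx]
    exact mul_ne_zero ha0 ((D p).k0 x hx)

/-- The lift of `y` normalized by `⟨c, ·⟩ = 1`. -/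
def normLift (y : M → Q31) (c : Fin 5 → ℝ) (m : M) : Fin 5 → ℝ :=
  (1 / ⟪c, (y m).1.rep⟫) • (y m).1.rep

/-- The normalization is homogeneous of degree zero, so the arbitrary choice of `rep` cancels and
the lift is as smooth as any local one. -/
theorem normLift_eq {M : Type*} {y : M → Q31} {c : Fin 5 → ℝ} {m : M} {v : Fin 5 → ℝ} (hv : v ≠ 0)
    (h : (y m).1 = Projectivization.mk ℝ v hv) : normLift y c m = (1 / ⟪c, v⟫) • v := by
  have h2 := (Projectivization.mk_rep (y m).1).trans h
  rw [Projectivization.mk_eq_mk_iff'] at h2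
  obtain ⟨a, ha⟩ := h2
  have ha0 : a ≠ 0 := by
    rintro rfl
    exact (y m).1.rep_nonzero (by rw [← ha, zero_smul])
  unfold normLift
  rw [← ha, pinner_smul_right, smul_smul]
  congr 1
  field_simp

/-- Properties of the normalized lift `W` near `x` in a chart. -/
structure IsAdapted (c : Fin 5 → ℝ) (W : E2 → Fin 5 → ℝ) (x : E2) (O : Set E2)
    (E : Fin 5 → ℝ) : Prop where
  sm : Sm O W
  mem : x ∈ O
  null : ∀ z ∈ O, ⟪W z, W z⟫ = 0
  cW : ∀ z ∈ O, ⟪c, W z⟫ = 1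
  det : metricDet 2 W x < 0
  EE : ⟪E, E⟫ = 1
  cE : ⟪c, E⟫ = 0
  normal : IsGaussNormal W x E

theorem isAdapted_normLift {y : M → Q31} {c : Fin 5 → ℝ}
    (hA : ∀ p, ∃ e O Y N E, AdaptedChart y c p e O Y N E) {e : OpenPartialHomeomorph M E2}
    (he : e ∈ IsManifold.maximalAtlas (𝓡 2) ∞ M) {x : E2} (hx : x ∈ e.target) :
    ∃ O E, IsAdapted c (fun z => normLift y c (e.symm z)) x O E := by
  obtain ⟨e', O, Y, N, E, D⟩ := hA (e.symm x)
  have hφ := sm_overlap he D.atlas D.frame.isOpen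
  have hmap : ∀ z ∈ overlap e e' O, e' (e.symm z) ∈ O := fun z hz => hz.2
  have hxO : x ∈ overlap e e' O := by
    have := mem_overlap (e.map_target hx) D.mem D.memO
    rwa [e.right_inv hx] at this
  have hr : Sm (overlap e e' O) (fun z => 1 / ⟪c, Y (e' (e.symm z))⟫) :=
    (Sm.const hφ.isOpen 1).div ((Sm.const hφ.isOpen c).pinner (D.frame.smY.comp hφ hmap))
      fun z hz => D.cY _ (hmap z hz)
  have hW : ∀ z ∈ overlap e e' O, normLift y c (e.symm z)
      = (1 / ⟪c, Y (e' (e.symm z))⟫) • Y (e' (e.symm z)) := by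
    intro z hz
    obtain ⟨h0, h1⟩ := D.lift.2 _ (hmap z hz)
    rw [e'.left_inv hz.1.2] at h1
    exact normLift_eq h0 h1
  have hψ := sm_transition D.atlas he
  refine ⟨overlap e e' O, E (e' (e.symm x)),
    (hr.smul (D.frame.smY.comp hφ hmap)).congr hW, hxO, fun z hz => ?_, fun z hz => ?_, ?_,
    D.frame.EE _ (hmap x hxO), D.cE _ (hmap x hxO), ?_⟩
  · rw [hW z hz, pinner_smul_smul, D.frame.YY _ (hmap z hz), mul_zero]
  · rw [hW z hz, pinner_smul_right]
    exact one_div_mul_cancel (D.cY _ (hmap z hz))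
  · rw [metricDet_transfer D.frame.smY D.frame.YY hφ hmap hr hW hxO]
    have hJ : (dd ex (fun z => e' (e.symm z)) x) 0 * (dd ey (fun z => e' (e.symm z)) x) 1
        - (dd ex (fun z => e' (e.symm z)) x) 1 * (dd ey (fun z => e' (e.symm z)) x) 0 ≠ 0 := by
      refine jacobian_ne_zero hψ hφ (fun z hz => ⟨e'.map_source hz.1.2, ?_⟩) (fun z hz => ?_) hxO
      · rw [Set.mem_preimage, e'.left_inv hz.1.2]
        exact e.map_target hz.1.1
      · rw [e'.left_inv hz.1.2, e.right_inv hz.1.1]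
    have hdet : metricDet 2 Y (e' (e.symm x)) < 0 := by
      change ⟪dd ex Y _, dd ex Y _⟫ * ⟪dd ey Y _, dd ey Y _⟫ - ⟪dd ex Y _, dd ey Y _⟫ ^ 2 < 0
      rw [D.frame.AA _ (hmap x hxO), D.frame.AB _ (hmap x hxO)]
      norm_num
    have hr0 := one_div_ne_zero (D.cY _ (hmap x hxO))
    exact mul_neg_of_pos_of_neg (by positivity) hdet
  · exact (D.frame.isGaussNormal (hmap x hxO)).transfer D.frame.smY D.frame.YY hφ hmap hr hW hxO

end Global

/-! ### Orthogonal transformations -/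

namespace O32

/-- The inverse transformation. -/
def symm (T : O32) : O32 where
  toEquiv := T.toEquiv.symm
  pinner_map v w := by
    rw [← T.pinner_map, T.toEquiv.apply_symm_apply, T.toEquiv.apply_symm_apply]

/-- The composition of two transformations. -/
def trans (T S : O32) : O32 where
  toEquiv := T.toEquiv.trans S.toEquiv
  pinner_map v w := by
    rw [LinearEquiv.trans_apply, LinearEquiv.trans_apply, S.pinner_map, T.pinner_map]

theorem reflect_reflect {u : Fin 5 → ℝ} (hu : ⟪u, u⟫ ≠ 0) (w : Fin 5 → ℝ) :
    w - (2 / ⟪u, u⟫ * ⟪u, w⟫) • u - (2 / ⟪u, u⟫ * ⟪u, w - (2 / ⟪u, u⟫ * ⟪u, w⟫) • u⟫) • u = w := by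
  have h : 2 / ⟪u, u⟫ * (⟪u, w⟫ - 2 / ⟪u, u⟫ * ⟪u, w⟫ * ⟪u, u⟫) = -(2 / ⟪u, u⟫ * ⟪u, w⟫) := by
    field_simp
    ring
  rw [pinner_sub_right, pinner_smul_right, h]
  module

theorem pinner_reflect {u : Fin 5 → ℝ} (hu : ⟪u, u⟫ ≠ 0) (v w : Fin 5 → ℝ) :
    ⟪v - (2 / ⟪u, u⟫ * ⟪u, v⟫) • u, w - (2 / ⟪u, u⟫ * ⟪u, w⟫) • u⟫ = ⟪v, w⟫ := by
  rw [pinner_sub_right, pinner_sub_left, pinner_sub_left, pinner_smul_right, pinner_smul_right,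
    pinner_smul_left, pinner_smul_left, pinner_comm v u]
  field_simp
  ring

/-- The reflection in the hyperplane orthogonal to `u`. -/
def reflection (u : Fin 5 → ℝ) (hu : ⟪u, u⟫ ≠ 0) : O32 where
  toEquiv :=
    { toFun := fun w => w - (2 / ⟪u, u⟫ * ⟪u, w⟫) • u
      invFun := fun w => w - (2 / ⟪u, u⟫ * ⟪u, w⟫) • u
      map_add' := fun v w => by
        rw [pinner_add_right]
        module
      map_smul' := fun r w => by
        rw [pinner_smul_right, RingHom.id_apply]
        module
      left_inv := fun w => reflect_reflect hu w
      right_inv := fun w => reflect_reflect hu w }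
  pinner_map v w := pinner_reflect hu v w

theorem reflection_apply (u : Fin 5 → ℝ) (hu : ⟪u, u⟫ ≠ 0) (w : Fin 5 → ℝ) :
    (reflection u hu).toEquiv w = w - (2 / ⟪u, u⟫ * ⟪u, w⟫) • u := rfl

/-- Vectors of equal square are exchanged by the reflection along their difference, if this
difference is not null. -/
theorem exists_map_sub {a b : Fin 5 → ℝ} (h : ⟪a, a⟫ = ⟪b, b⟫) (hab : ⟪a - b, a - b⟫ ≠ 0) :
    ∃ T : O32, T.toEquiv a = b := by
  refine ⟨reflection (a - b) hab, ?_⟩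
  have h2 : ⟪a - b, a - b⟫ = 2 * ⟪a - b, a⟫ := by
    simp only [pinner_sub_left, pinner_sub_right, pinner_comm b a, h]
    ring
  have h3 : 2 / ⟪a - b, a - b⟫ * ⟪a - b, a⟫ = 1 := by
    rw [h2] at hab ⊢
    have := right_ne_zero_of_mul hab
    field_simp
  rw [reflection_apply, h3, one_smul]
  abel

/-- Vectors that are not lightlike and have the same length are equivalent up to sign. -/
theorem exists_map_of_ne {a b : Fin 5 → ℝ} (h : ⟪a, a⟫ = ⟪b, b⟫) (ha : ⟪a, a⟫ ≠ 0) :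
    ∃ (T : O32) (r : ℝ), r ≠ 0 ∧ T.toEquiv a = r • b := by
  -- The squares of `a - b` and `a + b` add up to `4 ⟪a, a⟫ ≠ 0`, so one of them admits the
  -- reflection, which maps `a` to `b` or to `-b`.
  by_cases hab : ⟪a - b, a - b⟫ = 0
  · have hab' : ⟪a - -b, a - -b⟫ ≠ 0 := by
      intro h0
      simp only [pinner_sub_left, pinner_sub_right, pinner_neg_left, pinner_neg_right,
        pinner_comm b a] at hab h0
      exact ha (by linarith)
    obtain ⟨T, hT⟩ := exists_map_sub (a := a) (b := -b)
      (by rw [pinner_neg_left, pinner_neg_right, neg_neg, h]) hab'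
    exact ⟨T, -1, by norm_num, by rw [hT, neg_one_smul]⟩
  · obtain ⟨T, hT⟩ := exists_map_sub h hab
    exact ⟨T, 1, one_ne_zero, by rw [hT, one_smul]⟩

theorem exists_map_of_null {a b : Fin 5 → ℝ} (ha : ⟪a, a⟫ = 0) (hb : ⟪b, b⟫ = 0)
    (hab : ⟪a, b⟫ ≠ 0) : ∃ T : O32, T.toEquiv a = b :=
  exists_map_sub (by rw [ha, hb]) (by
    simp only [pinner_sub_left, pinner_sub_right, pinner_comm b a, ha, hb]
    intro h
    exact hab (by linarith))

end O32

theorem pinner_five (v w : Fin 5 → ℝ) :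
    ⟪v, w⟫ = v 0 * w 0 + v 1 * w 1 + v 2 * w 2 - v 3 * w 3 - v 4 * w 4 := by
  simp [pinner, Fin.sum_univ_succ]
  ring

theorem exists_map_null (a : Fin 5 → ℝ) (ha0 : a ≠ 0) (ha : ⟪a, a⟫ = 0) :
    ∃ T : O32, T.toEquiv a = ![1, 0, 0, 0, 1] := by
  have hb : ⟪![1, 0, 0, 0, 1], ![1, 0, 0, 0, 1]⟫ = 0 := by simp [pinner_five]
  by_cases hab : ⟪a, ![1, 0, 0, 0, 1]⟫ = 0
  -- When the null vectors are orthogonal, go through a null vector `d` orthogonal to neither.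
  -- Orthogonality means `a 0 = a 4`. If this entry is nonzero, `(1, 0, 0, 0, -1)` works; otherwise
  -- `(1, 0, 0, 1, 0)` does, since `a 3 = 0` would leave a positive definite vector of square zero.
  · obtain ⟨d, hd, had, hdb⟩ : ∃ d : Fin 5 → ℝ, ⟪d, d⟫ = 0 ∧ ⟪a, d⟫ ≠ 0 ∧
        ⟪d, ![1, 0, 0, 0, 1]⟫ ≠ 0 := by
      have h04 : a 0 = a 4 := by
        simp [pinner_five] at hab
        linarith
      by_cases h : a 0 = 0
      · refine ⟨![1, 0, 0, 1, 0], by simp [pinner_five], ?_, by simp [pinner_five]⟩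
        intro h3
        have h3' : a 3 = 0 := by
          simp [pinner_five, h] at h3
          exact h3
        rw [pinner_five, ← h04, h, h3'] at ha
        apply ha0
        have h1 : a 1 = 0 := by nlinarith [sq_nonneg (a 1), sq_nonneg (a 2)]
        have h2 : a 2 = 0 := by nlinarith [sq_nonneg (a 1), sq_nonneg (a 2)]
        funext i
        fin_cases i
        exacts [h, h1, h2, h3', h04 ▸ h]
      · refine ⟨![1, 0, 0, 0, -1], by simp [pinner_five], ?_, by simp [pinner_five]⟩
        simp [pinner_five, ← h04]
        exact h
    obtain ⟨T, hT⟩ := O32.exists_map_of_null ha hd had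
    obtain ⟨S, hS⟩ := O32.exists_map_of_null hd hb hdb
    refine ⟨T.trans S, ?_⟩
    change S.toEquiv (T.toEquiv a) = _
    rw [hT, hS]
  · exact O32.exists_map_of_null ha hb hab

theorem exists_map_of_sign {c b : Fin 5 → ℝ} (h : 0 < ⟪c, c⟫ * ⟪b, b⟫) :
    ∃ (T : O32) (r : ℝ), r ≠ 0 ∧ T.toEquiv c = r • b := by
  have hc : ⟪c, c⟫ ≠ 0 := left_ne_zero_of_mul h.ne'
  have hb : ⟪b, b⟫ ≠ 0 := right_ne_zero_of_mul h.ne'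
  have hq : 0 < ⟪c, c⟫ / ⟪b, b⟫ := by
    rw [div_eq_mul_inv]
    rcases lt_or_gt_of_ne hb with hb' | hb'
    · exact mul_pos_of_neg_of_neg (by nlinarith) (inv_lt_zero.2 hb')
    · exact mul_pos (by nlinarith) (inv_pos.2 hb')
  set s := √(⟪c, c⟫ / ⟪b, b⟫) with hs
  have hs0 : s ≠ 0 := (Real.sqrt_pos.2 hq).ne'
  have hs2 : s ^ 2 = ⟪c, c⟫ / ⟪b, b⟫ := Real.sq_sqrt hq.le
  obtain ⟨T, r, hr, hT⟩ := O32.exists_map_of_ne (a := c) (b := s • b)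
    (by rw [pinner_smul_smul, hs2, div_mul_cancel₀ _ hb]) hc
  exact ⟨T, r * s, mul_ne_zero hr hs0, by rw [hT, smul_smul]⟩

/-! ### Minimal surfaces in the space forms -/

/-- The space form in `ℝ^m_s` with tangent spaces `T` is the section of the light cone by
`⟨c, ·⟩ = -1`, projected by `π`. -/
structure IsSpaceForm (m s : ℕ) (c : Fin 5 → ℝ) (π : (Fin 5 → ℝ) →L[ℝ] (Fin m → ℝ))
    (T : (Fin m → ℝ) → Set (Fin m → ℝ)) : Prop where
  isom : ∀ v w, ⟪c, v⟫ = 0 → ⟪c, w⟫ = 0 → pinner m s (π v) (π w) = ⟪v, w⟫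
  normal : ∀ V ν, ⟪V, V⟫ = 0 → ⟪c, V⟫ = -1 → ν ∈ T (π V) →
    ∃ n, ⟪c, n⟫ = 0 ∧ ⟪n, V⟫ = 0 ∧ ∀ w, ⟪c, w⟫ = 0 → pinner m s ν (π w) = ⟪n, w⟫

/-- Because `⟪c, W⟫ = 1`, the vector `c` can replace `N` in the block frame. Within the space form
the unit normal is thus `E` up to sign. -/
theorem IsAdapted.eq_smul {c : Fin 5 → ℝ} {W : E2 → Fin 5 → ℝ} {x : E2} {O : Set E2}
    {E : Fin 5 → ℝ} (h : IsAdapted c W x O E) {n : Fin 5 → ℝ} (nc : ⟪n, c⟫ = 0)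
    (nW : ⟪n, W x⟫ = 0) (n1 : ⟪n, dd ex W x⟫ = 0) (n2 : ⟪n, dd ey W x⟫ = 0) :
    n = ⟪n, E⟫ • E := by
  have hd : ∀ ξ, ⟪W x, dd ξ W x⟫ = 0 := fun ξ => by
    have := dd_pinner_eq_zero (ξ := ξ) h.sm h.sm h.null h.mem
    rw [pinner_comm (dd ξ W x)] at this
    linarith
  have hdet := h.det
  have hF : IsBlockFrame (W x) c (dd ex W x) (dd ey W x) E :=
    ⟨h.null x h.mem, by rw [pinner_comm, h.cW x h.mem]; norm_num, hd _, hd _, hdet.ne, h.EE,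
      h.normal.zero, by rw [pinner_comm, h.cE], h.normal.one, h.normal.two⟩
  exact hF.eq_smul nW nc n1 n2

/-- The normalized lift projects to a minimal surface, in the coordinates of a chart. -/
theorem IsAdapted.minimal {m s : ℕ} {c c' : Fin 5 → ℝ} {π : (Fin 5 → ℝ) →L[ℝ] (Fin m → ℝ)}
    {T : (Fin m → ℝ) → Set (Fin m → ℝ)} (hπ : IsSpaceForm m s c' π T) {W : E2 → Fin 5 → ℝ}
    {x : E2} {O : Set E2} {E : Fin 5 → ℝ} (h : IsAdapted c W x O E) (S : O32) {r : ℝ} (hr : r ≠ 0)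
    (hS : S.toEquiv c = r • c') {X : E2 → Fin m → ℝ}
    (hX : ∀ z, X z = π ((-r) • S.toEquiv (W z))) :
    metricDet s X x < 0 ∧ ∀ ν ∈ T (X x), pinner m s ν (pd ex X x) = 0 →
      pinner m s ν (pd ey X x) = 0 → meanCurvature s X x ν = 0 := by
  have hcc : ∀ w, ⟪c', (-r) • S.toEquiv w⟫ = -⟪c, w⟫ := fun w => by
    rw [← S.pinner_map c w, hS, pinner_smul_left, pinner_smul_right]
    ring
  set L : (Fin 5 → ℝ) →L[ℝ] (Fin m → ℝ) :=
    π.comp ((-r) • (S.toEquiv : (Fin 5 → ℝ) →ₗ[ℝ] (Fin 5 → ℝ)).toContinuousLinearMap) with hL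
  have hLa : ∀ w, L w = π ((-r) • S.toEquiv w) := fun w => rfl
  have hXL : X = fun z => L (W z) := funext hX
  have d1 : ∀ ξ, ∀ z ∈ O, dd ξ X z = L (dd ξ W z) := fun ξ z hz => by
    rw [hXL, dd_clm L (h.sm.diff hz)]
  have d2 : ∀ ξ η, dd η (dd ξ X) x = L (dd η (dd ξ W) x) := fun ξ η => by
    rw [dd_congr h.sm.isOpen (d1 ξ) h.mem, dd_clm L (h.sm.dd.diff h.mem)]
  have smc : Sm O (fun _ : E2 => c) := Sm.const h.sm.isOpen c
  have c1 : ∀ ξ, ∀ z ∈ O, ⟪c, dd ξ W z⟫ = 0 := fun ξ z hz => by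
    rw [← dd_pinner_const h.sm c hz, dd_eq_zero h.sm.isOpen h.cW hz]
  have c2 : ∀ ξ η, ⟪c, dd η (dd ξ W) x⟫ = 0 := fun ξ η => by
    rw [← dd_pinner_const h.sm.dd c h.mem, dd_eq_zero h.sm.isOpen (c1 ξ) h.mem]
  -- All derivatives of `W` are orthogonal to `c`, as `⟪c, W⟫` is constant, and there the projection
  -- is isometric up to the factor `r²`.
  have hiso : ∀ v w, ⟪c, v⟫ = 0 → ⟪c, w⟫ = 0 → pinner m s (L v) (L w) = r ^ 2 * ⟪v, w⟫ := by
    intro v w hv hw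
    rw [hLa, hLa, hπ.isom _ _ (by rw [hcc, hv, neg_zero]) (by rw [hcc, hw, neg_zero]),
      pinner_smul_left, pinner_smul_right, S.pinner_map]
    ring
  have hmet : metricDet s X x = (r ^ 2) ^ 2 * metricDet 2 W x := by
    change pinner m s (dd ex X x) (dd ex X x) * pinner m s (dd ey X x) (dd ey X x)
      - pinner m s (dd ex X x) (dd ey X x) ^ 2 = (r ^ 2) ^ 2 *
      (⟪dd ex W x, dd ex W x⟫ * ⟪dd ey W x, dd ey W x⟫ - ⟪dd ex W x, dd ey W x⟫ ^ 2)
    rw [d1 _ x h.mem, d1 _ x h.mem, hiso _ _ (c1 _ x h.mem) (c1 _ x h.mem),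
      hiso _ _ (c1 _ x h.mem) (c1 _ x h.mem), hiso _ _ (c1 _ x h.mem) (c1 _ x h.mem)]
    ring
  refine ⟨by rw [hmet]; exact mul_neg_of_pos_of_neg (by positivity) h.det, fun ν hν h1 h2 => ?_⟩
  change pinner m s ν (dd ex X x) = 0 at h1
  change pinner m s ν (dd ey X x) = 0 at h2
  -- Lift the normal `ν` to `ℝ^5_2` and pull it back by the adjoint of `(-r) • S`. The result is
  -- normal to `W` and orthogonal to `c`, hence a multiple of `E`, whose second fundamental form is
  -- trace-free.
  obtain ⟨n, nc, nV, nw⟩ := hπ.normal ((-r) • S.toEquiv (W x)) ν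
    (by rw [pinner_smul_smul, S.pinner_map, h.null x h.mem, mul_zero])
    (by rw [hcc, h.cW x h.mem]) (by rwa [← hX])
  have hn : ∀ w, ⟪(-r) • S.symm.toEquiv n, w⟫ = ⟪n, (-r) • S.toEquiv w⟫ := fun w => by
    rw [pinner_smul_left, pinner_smul_right, ← S.pinner_map (S.symm.toEquiv n) w]
    change -r * ⟪S.toEquiv (S.toEquiv.symm n), S.toEquiv w⟫ = _
    rw [S.toEquiv.apply_symm_apply]
  have hνL : ∀ w, ⟪c, w⟫ = 0 → pinner m s ν (L w) = ⟪(-r) • S.symm.toEquiv n, w⟫ := fun w hw => by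
    rw [hLa, nw _ (by rw [hcc, hw, neg_zero]), hn]
  have hE := h.eq_smul (n := (-r) • S.symm.toEquiv n)
    (by rw [hn, hS, pinner_smul_right, pinner_smul_right, pinner_comm, nc]; ring)
    (by rw [hn, nV])
    (by rw [← hνL _ (c1 _ x h.mem), ← d1 _ x h.mem, h1])
    (by rw [← hνL _ (c1 _ x h.mem), ← d1 _ x h.mem, h2])
  have hνE : ∀ w, ⟪c, w⟫ = 0 →
      pinner m s ν (L w) = ⟪(-r) • S.symm.toEquiv n, E⟫ * ⟪E, w⟫ := fun w hw => by
    rw [hνL w hw]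
    nth_rewrite 1 [hE]
    rw [pinner_smul_left]
  change (pinner m s (dd ey X x) (dd ey X x) * pinner m s (dd ex (dd ex X) x) ν
    - 2 * pinner m s (dd ex X x) (dd ey X x) * pinner m s (dd ey (dd ex X) x) ν
    + pinner m s (dd ex X x) (dd ex X x) * pinner m s (dd ey (dd ey X) x) ν)
    / (2 * metricDet s X x) = 0
  rw [pinner_comm _ ν, pinner_comm _ ν, pinner_comm _ ν, d1 _ x h.mem, d1 _ x h.mem, d2, d2, d2,
    hiso _ _ (c1 _ x h.mem) (c1 _ x h.mem), hiso _ _ (c1 _ x h.mem) (c1 _ x h.mem),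
    hiso _ _ (c1 _ x h.mem) (c1 _ x h.mem), hνE _ (c2 _ _), hνE _ (c2 _ _), hνE _ (c2 _ _)]
  rw [div_eq_zero_iff]
  left
  linear_combination r ^ 2 * ⟪(-r) • S.symm.toEquiv n, E⟫ * h.normal.trace

/-! ### From the normalized lift to a surface in the space form -/

section Main

variable {M : Type*} [TopologicalSpace M] [ChartedSpace E2 M]

/-- The factor `-r` carries the section `⟪c, ·⟫ = 1` to `⟪c', ·⟫ = -1`, because `S c = r c'`. -/
theorem normLift_props {c c' : Fin 5 → ℝ} {y : M → Q31}
    (hA : ∀ p, ∃ e O Y N E, AdaptedChart y c p e O Y N E) (S : O32) {r : ℝ} (hr : r ≠ 0)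
    (hS : S.toEquiv c = r • c') (p : M) :
    ⟪(-r) • S.toEquiv (normLift y c p), (-r) • S.toEquiv (normLift y c p)⟫ = 0 ∧
      ⟪c', (-r) • S.toEquiv (normLift y c p)⟫ = -1 ∧
      ∀ w hw hn, w = (-r) • S.toEquiv (normLift y c p) → S.act (y p) = Q31.mk w hw hn := by
  obtain ⟨e, O, Y, N, E, D⟩ := hA p
  obtain ⟨h0, h1⟩ := D.lift.2 _ D.memO
  rw [e.left_inv D.mem] at h1
  have hn := normLift_eq (c := c) h0 h1
  have hcY := D.cY _ D.memO
  refine ⟨?_, ?_, ?_⟩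
  · rw [pinner_smul_smul, S.pinner_map, hn, pinner_smul_smul, D.frame.YY _ D.memO]
    ring
  · have h2 := S.pinner_map c (normLift y c p)
    rw [hS, pinner_smul_left] at h2
    rw [pinner_smul_right]
    have h3 : ⟪c, normLift y c p⟫ = 1 := by
      rw [hn, pinner_smul_right]
      exact one_div_mul_cancel hcY
    linarith
  · intro w hw _ hwe
    apply Subtype.ext
    change Projectivization.map S.toEquiv.toLinearMap S.toEquiv.injective (y p).1
      = Projectivization.mk ℝ w hw
    rw [h1, Projectivization.map_mk, Projectivization.mk_eq_mk_iff']
    refine ⟨(-r * (1 / ⟪c, Y (e p)⟫))⁻¹, ?_⟩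
    rw [hwe, hn, map_smul, smul_smul, smul_smul, LinearEquiv.coe_coe]
    have : -r * (1 / ⟪c, Y (e p)⟫) ≠ 0 := mul_ne_zero (neg_ne_zero.2 hr) (one_div_ne_zero hcY)
    rw [mul_assoc, inv_mul_cancel₀ this, one_smul]

variable [IsManifold (𝓡 2) ∞ M]

theorem isTimelikeMinimal_of_adapted {m s : ℕ} {c c' : Fin 5 → ℝ}
    {π : (Fin 5 → ℝ) →L[ℝ] (Fin m → ℝ)} {T : (Fin m → ℝ) → Set (Fin m → ℝ)}
    (hπ : IsSpaceForm m s c' π T) {y : M → Q31}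
    (hA : ∀ p, ∃ e O Y N E, AdaptedChart y c p e O Y N E) (S : O32) {r : ℝ} (hr : r ≠ 0)
    (hS : S.toEquiv c = r • c') :
    IsTimelikeMinimal s T (fun p => π ((-r) • S.toEquiv (normLift y c p))) := by
  refine ⟨fun p => ?_, fun e he x hx => ?_⟩
  · have he := IsManifold.chart_mem_maximalAtlas (I := 𝓡 2) (n := ∞) p
    have hp := mem_chart_source E2 p
    set e := chartAt E2 p
    obtain ⟨O, E, h⟩ := isAdapted_normLift hA he (e.map_source hp)
    set L : (Fin 5 → ℝ) →L[ℝ] (Fin m → ℝ) :=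
      π.comp ((-r) • (S.toEquiv : (Fin 5 → ℝ) →ₗ[ℝ] (Fin 5 → ℝ)).toContinuousLinearMap)
    have h1 : ContDiffAt ℝ ∞ (fun z => L (normLift y c (e.symm z))) (e p) :=
      (h.sm.clm L).contDiffAt h.mem
    have h2 : ContMDiffAt (𝓡 2) (𝓡 2) ∞ e p :=
      (contMDiffOn_of_mem_maximalAtlas he).contMDiffAt (e.open_source.mem_nhds hp)
    refine (ContMDiffAt.comp p h1.contMDiffAt h2).congr_of_eventuallyEq ?_
    filter_upwards [e.open_source.mem_nhds hp] with q hq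
    change π ((-r) • S.toEquiv (normLift y c q))
      = π ((-r) • S.toEquiv (normLift y c (e.symm (e q))))
    rw [e.left_inv hq]
  · obtain ⟨O, E, h⟩ := isAdapted_normLift hA he hx
    obtain ⟨h1, h2⟩ := h.minimal hπ S hr hS
      (X := (fun p => π ((-r) • S.toEquiv (normLift y c p))) ∘ e.symm) fun z => rfl
    exact ⟨h1, fun ν hν _ h3 h4 => h2 ν hν h3 h4⟩

end Main

/-- The projection `ℝ^5 → ℝ^m` to the coordinates in the range of `f`. -/
def coordProj {m : ℕ} (f : Fin m → Fin 5) : (Fin 5 → ℝ) →L[ℝ] (Fin m → ℝ) :=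
  ContinuousLinearMap.pi fun i => ContinuousLinearMap.proj (f i)

@[simp] theorem coordProj_apply {m : ℕ} (f : Fin m → Fin 5) (v : Fin 5 → ℝ) (i : Fin m) :
    coordProj f v i = v (f i) := rfl

/-! ### The three model space forms -/

theorem pinner_three (v w : Fin 3 → ℝ) :
    pinner 3 1 v w = v 0 * w 0 + v 1 * w 1 - v 2 * w 2 := by
  simp [pinner, Fin.sum_univ_succ]
  ring

theorem pinner_four_one (v w : Fin 4 → ℝ) :
    pinner 4 1 v w = v 0 * w 0 + v 1 * w 1 + v 2 * w 2 - v 3 * w 3 := by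
  simp [pinner, Fin.sum_univ_succ]
  ring

theorem pinner_four_two (v w : Fin 4 → ℝ) :
    pinner 4 2 v w = v 0 * w 0 + v 1 * w 1 - v 2 * w 2 - v 3 * w 3 := by
  simp [pinner, Fin.sum_univ_succ]
  ring

theorem isSpaceForm_R : IsSpaceForm 3 1 ![1, 0, 0, 0, 1] (coordProj ![1, 2, 3])
    (fun _ => Set.univ) := by
  constructor
  · intro v w hv hw
    simp [pinner_five] at hv hw
    simp [pinner_five, pinner_three]
    linear_combination -w 0 * hv - v 4 * hw
  · intro V ν hV hc _
    have hc' : V 0 - V 4 = -1 := by simpa [pinner_five] using hc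
    -- Here `c` is null and killed by the projection. The multiple of `c` added to `ν` makes the
    -- lift orthogonal to `V`, and is not seen by vectors orthogonal to `c`.
    refine ⟨![ν 0 * V 1 + ν 1 * V 2 - ν 2 * V 3, ν 0, ν 1, ν 2,
      ν 0 * V 1 + ν 1 * V 2 - ν 2 * V 3], by simp [pinner_five], ?_, fun w hw => ?_⟩
    · simp [pinner_five]
      linear_combination (ν 0 * V 1 + ν 1 * V 2 - ν 2 * V 3) * hc'
    · have hw' : w 0 - w 4 = 0 := by simpa [pinner_five] using hw
      simp [pinner_five, pinner_three]
      linear_combination -(ν 0 * V 1 + ν 1 * V 2 - ν 2 * V 3) * hw'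

theorem isSpaceForm_S : IsSpaceForm 4 1 ![0, 0, 0, 0, 1] (coordProj ![0, 1, 2, 3])
    (fun a => {ν | pinner 4 1 a ν = 0}) := by
  constructor
  · intro v w hv hw
    simp [pinner_five] at hv hw
    simp [pinner_five, pinner_four_one, hv]
  · intro V ν hV hc hν
    have hν' : pinner 4 1 (coordProj ![0, 1, 2, 3] V) ν = 0 := hν
    simp [pinner_four_one] at hν'
    refine ⟨![ν 0, ν 1, ν 2, ν 3, 0], by simp [pinner_five], ?_, fun w hw => ?_⟩
    · simp [pinner_five]
      linarith
    · simp [pinner_five, pinner_four_one]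

theorem isSpaceForm_H : IsSpaceForm 4 2 ![-1, 0, 0, 0, 0] (coordProj ![1, 2, 3, 4])
    (fun a => {ν | pinner 4 2 a ν = 0}) := by
  constructor
  · intro v w hv hw
    simp [pinner_five] at hv hw
    simp [pinner_five, pinner_four_two, hv]
  · intro V ν hV hc hν
    have hν' : pinner 4 2 (coordProj ![1, 2, 3, 4] V) ν = 0 := hν
    simp [pinner_four_two] at hν'
    refine ⟨![0, ν 0, ν 1, ν 2, ν 3], by simp [pinner_five], ?_, fun w hw => ?_⟩
    · simp [pinner_five]
      linarith
    · simp [pinner_five, pinner_four_two]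

/-- A timelike, null or spacelike `c` leads to `S^3_1`, `ℝ^3_1` or `H^3_1`. The normalization turns
the lift into exactly the representative used in `phiS`, `phiR` or `phiH`. -/
theorem exists_isMinimal {M : Type*} [TopologicalSpace M] [T2Space M] [ConnectedSpace M]
    [ChartedSpace E2 M] [IsManifold (𝓡 2) ∞ M]
    (y : M → Q31)
    (hI : IsIsothermic y) (hW : IsWillmore y) :
    ∃ T : O32,
      (∃ x : M → R31, IsMinimalR x ∧
        ∀ p, T.act (y p) = phiR (x p)) ∨
      (∃ x : M → S31, IsMinimalS x ∧
        ∀ p, T.act (y p) = phiS (x p)) ∨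
      (∃ x : M → H31, IsMinimalH x ∧
        ∀ p, T.act (y p) = phiH (x p)) := by
  obtain ⟨c, hc0, hA⟩ := exists_adapted hI hW
  rcases lt_trichotomy (pinner 5 2 c c) 0 with hc | hc | hc
  · obtain ⟨S, r, hr, hS⟩ := exists_map_of_sign (c := c) (b := ![0, 0, 0, 0, 1])
      (by simpa [pinner_five] using hc)
    have hp := normLift_props hA S hr hS
    have h4 : ∀ p, ((-r) • S.toEquiv (normLift y c p)) 4 = 1 := fun p => by
      have := (hp p).2.1
      rw [pinner_five] at this
      simp only [Matrix.cons_val] at this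
      linarith
    refine ⟨S, Or.inr (Or.inl ⟨fun p => ⟨coordProj ![0, 1, 2, 3]
      ((-r) • S.toEquiv (normLift y c p)), ?_⟩,
      isTimelikeMinimal_of_adapted isSpaceForm_S hA S hr hS, fun p => (hp p).2.2 _ _ _ ?_⟩)⟩
    · have h := (hp p).1
      rw [pinner_five, h4 p] at h
      change pinner 4 1 _ _ = 1
      rw [pinner_four_one]
      simp only [coordProj_apply, Matrix.cons_val]
      linarith
    · funext i
      fin_cases i
      exacts [rfl, rfl, rfl, rfl, (h4 p).symm]
  · obtain ⟨S, hS⟩ := exists_map_null c hc0 hc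
    have hS' : S.toEquiv c = (1 : ℝ) • ![1, 0, 0, 0, 1] := by rw [hS, one_smul]
    have hp := normLift_props hA S one_ne_zero hS'
    refine ⟨S, Or.inl ⟨fun p => coordProj ![1, 2, 3] ((-1 : ℝ) • S.toEquiv (normLift y c p)),
      isTimelikeMinimal_of_adapted isSpaceForm_R hA S one_ne_zero hS',
      fun p => (hp p).2.2 _ _ _ ?_⟩⟩
    have h1 := (hp p).1
    have h2 := (hp p).2.1
    set V := (-1 : ℝ) • S.toEquiv (normLift y c p)
    rw [pinner_five] at h1 h2
    simp only [Matrix.cons_val] at h2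
    -- Nullity reads `⟪x, x⟫ = (V 4 - V 0) (V 4 + V 0)`, and the first factor is `1` by the
    -- normalization.
    have hx : pinner 3 1 (coordProj ![1, 2, 3] V) (coordProj ![1, 2, 3] V) = V 0 + V 4 := by
      rw [pinner_three]
      simp only [coordProj_apply, Matrix.cons_val]
      linear_combination h1 + (V 0 + V 4) * (-h2)
    rw [hx]
    funext i
    fin_cases i
    · change (-1 + (V 0 + V 4)) / 2 = V 0
      linarith
    · rfl
    · rfl
    · rfl
    · change (1 + (V 0 + V 4)) / 2 = V 4
      linarith
  · obtain ⟨S, r, hr, hS⟩ := exists_map_of_sign (c := c) (b := ![-1, 0, 0, 0, 0])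
      (by simpa [pinner_five] using hc)
    have hp := normLift_props hA S hr hS
    have h0 : ∀ p, ((-r) • S.toEquiv (normLift y c p)) 0 = 1 := fun p => by
      have := (hp p).2.1
      rw [pinner_five] at this
      simp only [Matrix.cons_val] at this
      linarith
    refine ⟨S, Or.inr (Or.inr ⟨fun p => ⟨coordProj ![1, 2, 3, 4]
      ((-r) • S.toEquiv (normLift y c p)), ?_⟩,
      isTimelikeMinimal_of_adapted isSpaceForm_H hA S hr hS, fun p => (hp p).2.2 _ _ _ ?_⟩)⟩
    · have h := (hp p).1
      rw [pinner_five, h0 p] at h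
      change pinner 4 2 _ _ = -1
      rw [pinner_four_two]
      simp only [coordProj_apply, Matrix.cons_val]
      linarith
    · funext i
      fin_cases i
      exacts [(h0 p).symm, rfl, rfl, rfl, rfl]

end TimelikeSurface

end

theorem theoremB {M : Type*} [TopologicalSpace M] [T2Space M] [ConnectedSpace M]
    [ChartedSpace TimelikeSurface.E2 M] [IsManifold (𝓡 2) ∞ M]
    (y : M → TimelikeSurface.Q31)
    (hI : TimelikeSurface.IsIsothermic y) (hW : TimelikeSurface.IsWillmore y) :
    ∃ T : TimelikeSurface.O32,
      (∃ x : M → TimelikeSurface.R31, TimelikeSurface.IsMinimalR x ∧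
        ∀ p, T.act (y p) = TimelikeSurface.phiR (x p)) ∨
      (∃ x : M → TimelikeSurface.S31, TimelikeSurface.IsMinimalS x ∧
        ∀ p, T.act (y p) = TimelikeSurface.phiS (x p)) ∨
      (∃ x : M → TimelikeSurface.H31, TimelikeSurface.IsMinimalH x ∧
        ∀ p, T.act (y p) = TimelikeSurface.phiH (x p)) :=
  TimelikeSurface.exists_isMinimal y hI hW
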